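/- Let $K$ be a number field with ring of integers $\mathcal O_K$. A rigid adelic space over $K$ is a nonzero finite-dimensional $K$-vector space $E$ together with an $\mathcal O_K$-lattice $L\subset E$ (a finitely generated $\mathcal O_K$-submodule spanning $E$) and positive definite Hermitian forms $h_\gamma$ on $E\otimes_\gamma\mathbf C$ for all embeddings $\gamma:K\to\mathbf C$, compatible with complex conjugation (so $h_\gamma$ comes from a real symmetric form if $\gamma$ is real). If $L=\bigoplus_i\mathfrak a_i b_i$ with fractional ideals $\mathfrak a_i$ and a $K$-basis $(b_i)$ of $E$, put $$H(E)=\Bigl(N\bigl(\textstyle\prod_i\mathfrak a_i\bigr)\prod_{\gamma}\det\bigl(h_\gamma(b_i,b_j)\bigr)^{1/2}\Bigr)^{1/[K:\mathbf Q]},\qquad H_r(E)=H(E)^{1/\dim E},\qquad H_{\min}(E)=\min_{0\ne W\subset E}H_r(W),$$ where a subspace $W$ carries the lattice $L\cap W$ and the restricted forms. $E$ is semistable if $H_r(W)\ge H_r(E)$ for all $0\neq W\subset E$. Tensor products carry the tensor product lattices and forms; the dual $E^\vee=\operatorname{Hom}_K(E,K)$ carries the lattice $\operatorname{Hom}_{\mathcal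 O_K}(L,\mathcal O_K)$ and the dual forms. A similarity is a $K$-linear map that, at every place $v$ of $K$, multiplies the local norm on $E_v=E\otimes_K K_v$ by some constant $\lambda_v>0$, with $\lambda_v=1$ for all but finitely many $v$; here, for infinite $v$, $\|x\|_v=h_v(x,x)^{1/2}$, and for finite $v$, $\|x\|_v=\inf\{|\alpha|_v:\alpha\in K_v,\ x\in\alpha L_v\}$, with $L_v=L\otimes_{\mathcal O_K}\mathcal O_{K_v}$. $E$ is isodual if there is a similarity $\sigma:E\to E^\vee$; it is orthogonal (resp. symplectic) if $\sigma$ can be chosen such that the bilinear form $b_\sigma(x,y)=\sigma(x)(y)$ is symmetric (resp. alternating). If $K$ is a CM field, $E$ is unitary if there is a similarity $\sigma:E\to\overline{E^\vee}$ such that the sesquilinear form $b_\sigma$ is Hermitian, where the conjugate dual $\overline{E^\vee}$ is $E^\vee$ with the same lattice and the same norms at the infinite places, and with the external law $\alpha\star\varphi=\overline\alpha\varphi$. **Theorem.** The following are equivalent: 1. (Bost's conjecture over $K$) $H_{\min}(E\otimes F)=H_{\min}(E)\,H_{\min}(F)$ for all rigid adelic spaces $E$ and $F$ over $K$; 2.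 $H_{\min}(E\otimes F)=H_{\min}(E)\,H_{\min}(F)$ whenever $E$ and $F$ are semistable isodual rigid adelic spaces over $K$. The same equivalence holds with "isodual" in 2 replaced by "orthogonal", by "symplectic", or, if $K$ is a CM field, by "unitary". -/

import Mathlib

open scoped TensorProduct nonZeroDivisors ComplexOrder
open NumberField IsDedekindDomain Module

universe u v w

noncomputable section

/-! ## Hermitian bundles, alias rigid adelic spaces, over a number field -/

section Basics

variable {K : Type u} [Field K] [NumberField K]
variable {E : Type v} [AddCommGroup E] [Module K E]
variable {F : Type w} [AddCommGroup F] [Module K F]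

/-- A form on `E` which is semilinear in the first variable with respect to the conjugate of the
embedding `γ : K → ℂ` and semilinear in the second variable with respect to `γ`. Such forms are the
same thing as forms on the complex vector space `E ⊗_γ ℂ` which are antilinear in the first and
linear in the second variable. -/
abbrev SesqForm (γ : K →+* ℂ) (E : Type v) [AddCommGroup E] [Module K E] : Type v :=
  E →ₛₗ[(starRingEnd ℂ).comp γ] E →ₛₗ[γ] ℂ

/-- The Gram matrix of a family of vectors. -/
def SesqForm.gram {γ : K →+* ℂ} (h : SesqForm γ E) {ι : Type*} (e : ι → E) : Matrix ι ι ℂ :=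
  Matrix.of fun i j => h (e i) (e j)

/-- An `𝓞 K`-lattice `L` in the `K`-vector space `E`: a finitely generated `𝓞 K`-submodule that
spans `E` over `K`. (As `𝓞 K` is finite over `ℤ`, finite generation over `𝓞 K` and over `ℤ` are the
same.) -/
structure IsOKLattice (K : Type u) [Field K] [NumberField K] {E : Type v} [AddCommGroup E]
    [Module K E] (L : AddSubgroup E) : Prop where
  smul_mem : ∀ (a : 𝓞 K) {x : E}, x ∈ L → (a : K) • x ∈ L
  fg : L.FG
  span_eq_top : Submodule.span K (L : Set E) = ⊤

/-- A structure of rigid adelic space on the `K`-vector space `E`, given as a Hermitian bundle: an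
`𝓞 K`-lattice in `E` and, for every embedding `γ` of `K` in `ℂ`, a positive definite Hermitian form
on `E ⊗_γ ℂ`, this family being invariant under complex conjugation. For a real embedding
the invariance says that the form is the extension of a real symmetric form on `E ⊗_γ ℝ`; for a
pair of conjugate embeddings it says that the two forms are the two realizations of one Hermitian
form at the corresponding complex place. -/
structure RigidAdelicSpace (K : Type u) [Field K] [NumberField K] (E : Type v) [AddCommGroup E]
    [Module K E] where
  /-- the underlying `𝓞 K`-lattice -/
  lattice : AddSubgroup E
  isLattice : IsOKLattice K lattice
  /-- the Hermitian forms at the infinite places -/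
  form : ∀ γ : K →+* ℂ, SesqForm γ E
  /-- Invariance under complex conjugation. -/
  form_conj : ∀ (γ : K →+* ℂ) (x y : E),
    form (ComplexEmbedding.conjugate γ) x y = starRingEnd ℂ (form γ x y)
  /-- The extension of the form to `E ⊗_γ ℂ` is positive definite (and in particular Hermitian). It
  is not enough to ask for positivity on `E`; one has to ask that
  `∑ i, ∑ j, conj (z i) * h (e i) (e j) * z j > 0` for linearly independent vectors `e i` of `E`
  and complex numbers `z i` that do not all vanish. -/
  form_posDef : ∀ (γ : K →+* ℂ) (n : ℕ) (e : Fin n → E), LinearIndependent K e →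
    ((form γ).gram e).PosDef

/-! ### Pseudo-bases and heights -/

/-- A pseudo-basis of `L`: a `K`-basis `b` of `E` and fractional ideals `𝔞 i` with
`L = ⨁ i, 𝔞 i • b i`. -/
structure PseudoBasis (K : Type u) [Field K] [NumberField K] {E : Type v} [AddCommGroup E]
    [Module K E] (L : AddSubgroup E) where
  ideal : Fin (finrank K E) → FractionalIdeal (𝓞 K)⁰ K
  basis : Basis (Fin (finrank K E)) K E
  mem_iff : ∀ x : E, x ∈ L ↔ ∀ i, basis.repr x i ∈ ideal i

theorem IsOKLattice.exists_smul_mem {L : AddSubgroup E} (hL : IsOKLattice K L) (x : E) :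
    ∃ d : 𝓞 K, d ≠ 0 ∧ (d : K) • x ∈ L := by
  have hx : x ∈ Submodule.span K (L : Set E) := by rw [hL.span_eq_top]; trivial
  induction hx using Submodule.span_induction with
  | mem x hx => exact ⟨1, one_ne_zero, by simpa using hx⟩
  | zero => exact ⟨1, one_ne_zero, by simp⟩
  | add x y _ _ hx hy =>
    obtain ⟨d, hd, hx⟩ := hx
    obtain ⟨e, he, hy⟩ := hy
    refine ⟨d * e, mul_ne_zero hd he, ?_⟩
    rw [smul_add]
    refine L.add_mem ?_ ?_
    · have := hL.smul_mem e hx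
      rwa [smul_smul, mul_comm, ← map_mul] at this
    · have := hL.smul_mem d hy
      rwa [smul_smul, ← map_mul] at this
  | smul a x _ hx =>
    obtain ⟨d, hd, hx⟩ := hx
    obtain ⟨p, q, hq, rfl⟩ := IsFractionRing.div_surjective (A := 𝓞 K) a
    refine ⟨q * d, mul_ne_zero (nonZeroDivisors.ne_zero hq) hd, ?_⟩
    have hq' : algebraMap (𝓞 K) K q ≠ 0 := by
      simpa using nonZeroDivisors.ne_zero hq
    have := hL.smul_mem p hx
    rw [smul_smul] at this ⊢
    convert this using 2
    change algebraMap (𝓞 K) K (q * d) * _ = algebraMap (𝓞 K) K p * algebraMap (𝓞 K) K d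
    rw [map_mul]
    field_simp

theorem AddSubgroup.fg_of_le_fg {A : Type*} [AddCommGroup A] {L M : AddSubgroup A} (h : M ≤ L)
    (hL : L.FG) : M.FG := by
  rw [← AddSubgroup.toIntSubmodule_toAddSubgroup L, ← Submodule.fg_iff_addSubgroup_fg] at hL
  rw [← AddSubgroup.toIntSubmodule_toAddSubgroup M, ← Submodule.fg_iff_addSubgroup_fg]
  exact hL.of_le (by simpa using h)

theorem AddSubgroup.fg_of_map_fg {A B : Type*} [AddCommGroup A] [AddCommGroup B] (f : A →+ B)
    (hf : Function.Injective f) {L : AddSubgroup A} (hL : (L.map f).FG) : L.FG := by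
  rw [← AddSubgroup.toIntSubmodule_toAddSubgroup L, ← Submodule.fg_iff_addSubgroup_fg]
  refine Submodule.fg_of_fg_map_injective f.toIntLinearMap hf ?_
  rw [Submodule.fg_iff_addSubgroup_fg]
  convert hL
  ext; simp

theorem IsOKLattice.comap_subtype {L : AddSubgroup E} (hL : IsOKLattice K L)
    (W : Submodule K E) : IsOKLattice K (L.comap W.subtype.toAddMonoidHom) where
  smul_mem a x hx := hL.smul_mem a hx
  fg := AddSubgroup.fg_of_map_fg W.subtype.toAddMonoidHom W.subtype_injective
    (AddSubgroup.fg_of_le_fg (AddSubgroup.map_comap_le _ _) hL.fg)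
  span_eq_top := by
    rw [eq_top_iff]
    intro x _
    obtain ⟨d, hd, hx⟩ := hL.exists_smul_mem (x : E)
    have hd' : (d : K) ≠ 0 := by simpa using hd
    rw [← inv_smul_smul₀ hd' x]
    exact Submodule.smul_mem _ _ (Submodule.subset_span hx)

theorem exists_pseudoBasis_aux (n : ℕ) : ∀ (E : Type v) [AddCommGroup E] [Module K E]
    [FiniteDimensional K E] (L : AddSubgroup E), IsOKLattice K L → finrank K E = n →
    ∃ (a : Fin n → FractionalIdeal (𝓞 K)⁰ K) (b : Basis (Fin n) K E),
      ∀ x : E, x ∈ L ↔ ∀ i, b.repr x i ∈ a i := by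
  induction n with
  | zero =>
    intro E _ _ _ L hL hn
    have : Subsingleton E := finrank_zero_iff.mp hn
    refine ⟨0, Basis.empty E, fun x => ?_⟩
    rw [Subsingleton.elim x 0]
    simp [L.zero_mem]
  | succ n ih =>
    intro E _ _ _ L hL hn
    let c := Module.finBasisOfFinrankEq K E hn
    let f : E →ₗ[K] K := c.coord 0
    let W := LinearMap.ker f
    have hf : Function.Surjective f := by
      intro t
      exact ⟨t • c 0, by simp [f]⟩
    have hW : finrank K W = n := by
      have := f.finrank_range_add_finrank_ker
      rw [LinearMap.range_eq_top.mpr hf, finrank_top, finrank_self, hn] at this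
      change finrank K (LinearMap.ker f) = n
      omega
    obtain ⟨a, b, hab⟩ := ih W _ (hL.comap_subtype W) hW
    -- the image of the lattice under the functional, as a fractional ideal
    let I₀ : Submodule (𝓞 K) K :=
      { carrier := f '' (L : Set E)
        add_mem' := by
          rintro _ _ ⟨x, hx, rfl⟩ ⟨y, hy, rfl⟩
          exact ⟨x + y, L.add_mem hx hy, map_add _ _ _⟩
        zero_mem' := ⟨0, L.zero_mem, map_zero _⟩
        smul_mem' := by
          rintro r _ ⟨x, hx, rfl⟩
          exact ⟨(r : K) • x, hL.smul_mem r hx, by rw [map_smul]; rfl⟩ }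
    have hI₀ : I₀.FG := by
      have h1 : (L.map f.toAddMonoidHom).FG := by
        obtain ⟨S, hS⟩ := hL.fg
        classical
        refine ⟨S.image f, ?_⟩
        rw [← hS, AddMonoidHom.map_closure]
        simp
      obtain ⟨S, hS⟩ := h1
      refine ⟨S, le_antisymm ?_ ?_⟩
      · rw [Submodule.span_le]
        intro x hx
        have : x ∈ L.map f.toAddMonoidHom := by
          rw [← hS]; exact AddSubgroup.subset_closure hx
        exact this
      · intro x hx
        have hx' : x ∈ AddSubgroup.closure (S : Set K) := by rw [hS]; exact hx
        have : AddSubgroup.closure (S : Set K) ≤ (Submodule.span (𝓞 K) (S : Set K)).toAddSubgroup :=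
          (AddSubgroup.closure_le _).mpr Submodule.subset_span
        exact this hx'
    let I : FractionalIdeal (𝓞 K)⁰ K := ⟨I₀, FractionalIdeal.isFractional_of_fg hI₀⟩
    have hI : ∀ t, t ∈ I ↔ ∃ x ∈ L, f x = t := fun t => Iff.rfl
    have hI0 : I ≠ 0 := by
      intro h0
      obtain ⟨d, hd, hx⟩ := hL.exists_smul_mem (c 0)
      have h1 : (d : K) ∈ I := (hI _).mpr ⟨_, hx, by simp [f]⟩
      rw [h0, FractionalIdeal.mem_zero_iff] at h1
      exact hd (by simpa using h1)
    have key : ∀ z ∈ I * I⁻¹, ∃ y : E, f y = z ∧ ∀ t ∈ I, t • y ∈ L := by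
      intro z hz
      refine FractionalIdeal.mul_induction_on hz ?_ ?_
      · intro i hi j hj
        obtain ⟨x, hx, rfl⟩ := (hI i).mp hi
        refine ⟨j • x, by simp [mul_comm], fun t ht => ?_⟩
        have h1 : t * j ∈ I * I⁻¹ := FractionalIdeal.mul_mem_mul ht hj
        rw [mul_inv_cancel₀ hI0, FractionalIdeal.mem_one_iff] at h1
        obtain ⟨r, hr⟩ := h1
        rw [smul_smul, ← hr]
        exact hL.smul_mem r hx
      · rintro x y ⟨x', hx, hx'⟩ ⟨y', hy, hy'⟩
        exact ⟨x' + y', by rw [map_add, hx, hy], fun t ht => by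
          rw [smul_add]; exact L.add_mem (hx' t ht) (hy' t ht)⟩
    obtain ⟨y, hfy, hy⟩ := key 1 (by
      rw [mul_inv_cancel₀ hI0]; exact FractionalIdeal.one_mem_one _)
    have hker : ∀ x : E, x - f x • y ∈ W := fun x => by
      change f _ = 0
      simp [hfy]
    let B : Basis (Fin (n + 1)) K E := Basis.mkFinCons y b
      (fun t x hx h => by
        have h1 : f (t • y + x) = 0 := by rw [h, map_zero]
        have h2 : f x = 0 := hx
        simpa [hfy, h2] using h1)
      (fun x => ⟨-f x, by
        have := hker x
        rwa [sub_eq_add_neg, ← neg_smul] at this⟩)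
    have hB : ∀ x : E, (B.repr x : Fin (n + 1) → K) =
        Fin.cons (f x) (b.repr ⟨x - f x • y, hker x⟩ : Fin n → K) := by
      intro x
      rw [← B.repr_sum_self (Fin.cons (f x) (b.repr ⟨x - f x • y, hker x⟩ : Fin n → K))]
      congr 2
      have h1 := congrArg (Submodule.subtype W) (b.sum_repr ⟨x - f x • y, hker x⟩)
      rw [map_sum] at h1
      simp only [map_smul, Submodule.subtype_apply] at h1
      rw [Fin.sum_univ_succ]
      simp only [B, Basis.coe_mkFinCons, Fin.cons_zero, Fin.cons_succ, Function.comp_apply]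
      rw [h1]
      abel
    refine ⟨Fin.cons I a, B, fun x => ?_⟩
    rw [Fin.forall_fin_succ, hB]
    have h2 := hab ⟨x - f x • y, hker x⟩
    have h3 : (⟨x - f x • y, hker x⟩ : W) ∈ L.comap W.subtype.toAddMonoidHom ↔
      x - f x • y ∈ L := Iff.rfl
    rw [h3] at h2
    simp only [Fin.cons_zero, Fin.cons_succ, ← h2]
    constructor
    · intro hx
      have h4 : f x ∈ I := (hI _).mpr ⟨x, hx, rfl⟩
      exact ⟨h4, L.sub_mem hx (hy _ h4)⟩
    · rintro ⟨h4, h5⟩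
      simpa using L.add_mem h5 (hy _ h4)

theorem IsOKLattice.nonempty_pseudoBasis [FiniteDimensional K E] {L : AddSubgroup E}
    (hL : IsOKLattice K L) : Nonempty (PseudoBasis K L) := by
  obtain ⟨a, b, h⟩ := exists_pseudoBasis_aux (K := K) (finrank K E) E L hL rfl
  exact ⟨⟨a, b, h⟩⟩

namespace RigidAdelicSpace

/-- The normalized height
`H(E) = (N(∏ 𝔞 i) * ∏_{v ∣ ∞} det (h_v (b i, b j)) ^ (e_v / 2)) ^ (1 / [K : ℚ])`, where `(𝔞 i, b i)`
is a pseudo-basis of the lattice, and `e_v` is `1` or `2` for a real or complex place `v`. Here the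
product is written over the embeddings of `K` in `ℂ`, of which a complex place accounts for two,
with equal determinants. For `E = 0` this is `1`. -/
def height [FiniteDimensional K E] (A : RigidAdelicSpace K E) : ℝ :=
  let p := Classical.choice A.isLattice.nonempty_pseudoBasis
  ((FractionalIdeal.absNorm (∏ i, p.ideal i) : ℝ) *
    ∏ γ : K →+* ℂ, (((A.form γ).gram p.basis).det.re) ^ (1 / 2 : ℝ)) ^ (1 / (finrank ℚ K : ℝ))

/-- The reduced height `H_r(E) = H(E) ^ (1 / dim E)` (for `E ≠ 0`). -/
def reducedHeight [FiniteDimensional K E] (A : RigidAdelicSpace K E) : ℝ :=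
  A.height ^ (1 / (finrank K E : ℝ))

/-- The structure induced on a subspace `W`: the lattice is the intersection with `W`, and the forms
are restricted. -/
def restrict (A : RigidAdelicSpace K E) (W : Submodule K E) : RigidAdelicSpace K W where
  lattice := A.lattice.comap W.subtype.toAddMonoidHom
  isLattice := A.isLattice.comap_subtype W
  form γ := LinearMap.mk₂'ₛₗ ((starRingEnd ℂ).comp γ) γ (fun x y => A.form γ x y)
    (by intros; simp) (by intros; simp) (by intros; simp) (by intros; simp)
  form_conj γ x y := A.form_conj γ x y
  form_posDef γ n e he :=
    A.form_posDef γ n (W.subtype ∘ e) (he.map' W.subtype W.ker_subtype)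

/-- `H_min(E)`, the minimum of the reduced heights of the nonzero subspaces of `E`
(for `E ≠ 0`). -/
def minHeight [FiniteDimensional K E] (A : RigidAdelicSpace K E) : ℝ :=
  sInf {r : ℝ | ∃ W : Submodule K E, W ≠ ⊥ ∧ r = (A.restrict W).reducedHeight}

/-- Semistability: `H_r(W) ≥ H_r(E)` for all nonzero subspaces `W`. -/
def IsSemistable [FiniteDimensional K E] (A : RigidAdelicSpace K E) : Prop :=
  ∀ W : Submodule K E, W ≠ ⊥ → A.reducedHeight ≤ (A.restrict W).reducedHeight

end RigidAdelicSpace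

/-! ### Positive definiteness in terms of one basis -/

theorem SesqForm.gram_posDef_of_basis {γ : K →+* ℂ} (h : SesqForm γ E) {ι : Type*} [Fintype ι]
    (b : Basis ι K E) (hb : (h.gram b).PosDef) {κ : Type*} [Fintype κ] (e : κ → E)
    (he : LinearIndependent K e) : (h.gram e).PosDef := by
  classical
  let M : Matrix ι κ K := Matrix.of fun i k => b.repr (e k) i
  have hM : Function.Injective M.mulVecLin := by
    rw [← LinearMap.ker_eq_bot, LinearMap.ker_eq_bot']
    intro z hz
    have h1 : ∑ k, z k • e k = 0 := by
      apply b.repr.injective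
      ext i
      have := congrFun hz i
      simpa [Matrix.mulVec, dotProduct, M, mul_comm] using this
    exact funext (Fintype.linearIndependent_iff.mp he z h1)
  obtain ⟨g, hg⟩ := LinearMap.exists_leftInverse_of_injective M.mulVecLin
    (LinearMap.ker_eq_bot.mpr hM)
  have hN : LinearMap.toMatrix' g * M = 1 := by
    have := congrArg LinearMap.toMatrix' hg
    rwa [LinearMap.toMatrix'_comp, LinearMap.toMatrix'_id, ← Matrix.toLin'_apply',
      LinearMap.toMatrix'_toLin'] at this
  have hC : (LinearMap.toMatrix' g).map γ * M.map γ = 1 := by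
    rw [← Matrix.map_mul, hN, Matrix.map_one _ (map_zero γ) (map_one γ)]
  have hinj : Function.Injective (M.map γ).mulVec := by
    intro z z' hz
    have := congrArg ((LinearMap.toMatrix' g).map γ).mulVec hz
    simpa [Matrix.mulVec_mulVec, hC] using this
  have hgram : h.gram e = (M.map γ).conjTranspose * h.gram b * M.map γ := by
    ext k l
    simp only [SesqForm.gram, Matrix.of_apply, Matrix.mul_apply, Matrix.conjTranspose_apply,
      Matrix.map_apply, M]
    conv_lhs => rw [← b.sum_repr (e k), ← b.sum_repr (e l)]
    simp only [map_sum, LinearMap.sum_apply, LinearMap.map_smulₛₗ, LinearMap.smul_apply,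
      RingHom.comp_apply, smul_eq_mul, Finset.sum_mul, Finset.mul_sum]
    refine Finset.sum_congr rfl fun i _ => Finset.sum_congr rfl fun j _ => ?_
    simp only [RCLike.star_def]
    ring
  rw [hgram]
  exact hb.conjTranspose_mul_mul_same hinj

/-! ### The dual space -/

/-- The dual lattice `Hom(L, 𝓞 K)`, inside the dual space. -/
def dualLattice (K : Type u) [Field K] [NumberField K] {E : Type v} [AddCommGroup E] [Module K E]
    (L : AddSubgroup E) : AddSubgroup (Dual K E) where
  carrier := {φ | ∀ x ∈ L, φ x ∈ (algebraMap (𝓞 K) K).range}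
  add_mem' hφ hψ x hx := add_mem (hφ x hx) (hψ x hx)
  zero_mem' _ _ := zero_mem _
  neg_mem' hφ x hx := neg_mem (hφ x hx)

theorem IsOKLattice.dual [FiniteDimensional K E] {L : AddSubgroup E} (hL : IsOKLattice K L) :
    IsOKLattice K (dualLattice K L) where
  smul_mem a φ hφ x hx := mul_mem ⟨a, rfl⟩ (hφ x hx)
  fg := by
    -- embed into `(𝓞 K) ^ n` by evaluating at a basis contained in the lattice
    let c := Module.finBasis K E
    choose d hd hc using fun i => hL.exists_smul_mem (c i)
    let f : Dual K E →+ (Fin (finrank K E) → K) :=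
      { toFun := fun φ i => φ ((d i : K) • c i)
        map_zero' := by ext; simp
        map_add' := by intros; ext; simp [mul_add] }
    have hf : Function.Injective f := by
      intro φ ψ h
      refine c.ext fun i => ?_
      have h1 : φ ((d i : K) • c i) = ψ ((d i : K) • c i) := congrFun h i
      have hd' : (d i : K) ≠ 0 := by simpa using hd i
      simpa [hd'] using h1
    refine AddSubgroup.fg_of_map_fg f hf ?_
    let g : (Fin (finrank K E) → 𝓞 K) →+ (Fin (finrank K E) → K) :=
      { toFun := fun z i => (z i : K)
        map_zero' := by ext; simp
        map_add' := by intros; ext; simp }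
    refine AddSubgroup.fg_of_le_fg (L := g.range) ?_ ?_
    · rintro _ ⟨φ, hφ, rfl⟩
      choose z hz using fun i => hφ _ (hc i)
      exact ⟨z, funext hz⟩
    · rw [AddMonoidHom.range_eq_map, ← AddSubgroup.toIntSubmodule_toAddSubgroup (⊤ : AddSubgroup _)]
      have h1 : ((⊤ : Submodule ℤ (Fin (finrank K E) → 𝓞 K)).map g.toIntLinearMap).FG :=
        (Module.Finite.fg_top (R := ℤ)).map _
      rw [Submodule.fg_iff_addSubgroup_fg] at h1
      convert h1
      ext; simp
  span_eq_top := by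
    rw [eq_top_iff]
    intro φ _
    obtain ⟨S, hS⟩ := hL.fg
    obtain ⟨q, hq⟩ := IsLocalization.exist_integer_multiples (𝓞 K)⁰ S (fun x => φ x)
    have hq' : ((q : 𝓞 K) : K) ≠ 0 := by simp
    rw [← inv_smul_smul₀ hq' φ]
    refine Submodule.smul_mem _ _ (Submodule.subset_span ?_)
    intro x hx
    rw [← hS] at hx
    induction hx using AddSubgroup.closure_induction with
    | mem x hx =>
      obtain ⟨r, hr⟩ := hq x hx
      exact ⟨r, by rw [hr, Algebra.smul_def]; rfl⟩
    | zero => rw [map_zero]; exact zero_mem _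
    | add x y _ _ hx hy => rw [map_add]; exact add_mem hx hy
    | neg x _ hx => rw [map_neg]; exact neg_mem hx

/-- The form on the dual space whose Gram matrix in the dual of the basis `b` is the transposed
inverse of the Gram matrix of `h` in the basis `b`. -/
def SesqForm.dual {γ : K →+* ℂ} (h : SesqForm γ E) {ι : Type*} [Fintype ι] [DecidableEq ι]
    (b : ι → E) : SesqForm γ (Dual K E) :=
  LinearMap.mk₂'ₛₗ ((starRingEnd ℂ).comp γ) γ
    (fun φ ψ => ∑ i, ∑ j, starRingEnd ℂ (γ (φ (b i))) * (h.gram b)⁻¹ j i * γ (ψ (b j)))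
    (by intros; simp [add_mul, Finset.sum_add_distrib])
    (by intros; simp [Finset.mul_sum, mul_assoc])
    (by intros; simp [mul_add, Finset.sum_add_distrib])
    (by intros; simp [Finset.mul_sum, mul_left_comm])

theorem SesqForm.gram_dualBasis {γ : K →+* ℂ} (h : SesqForm γ E) {ι : Type*} [Fintype ι]
    [DecidableEq ι] (b : Basis ι K E) :
    (h.dual b).gram b.dualBasis = (h.gram b)⁻¹.transpose := by
  ext k l
  change ∑ i, ∑ j, starRingEnd ℂ (γ (b.dualBasis k (b i))) * (h.gram b)⁻¹ j i *
    γ (b.dualBasis l (b j)) = (h.gram b)⁻¹ l k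
  simp only [Basis.dualBasis_apply_self]
  rw [Finset.sum_eq_single k (fun i _ hi => by simp [hi]) (by simp),
    Finset.sum_eq_single l (fun j _ hj => by simp [hj]) (by simp)]
  simp

/-- The dual form computes the squares of the operator norms of linear forms `φ`: `h^∨ (φ, φ)` is
the greatest value of `|φ x| ^ 2 / h (x, x)` for nonzero `x = ∑ i, z i ⊗ b i` in `E ⊗_γ ℂ`. -/
theorem SesqForm.dual_isGreatest {γ : K →+* ℂ} (h : SesqForm γ E) {ι : Type*} [Fintype ι]
    [Nonempty ι] [DecidableEq ι] (b : Basis ι K E) (hb : (h.gram b).PosDef) (φ : Dual K E) :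
    IsGreatest {r : ℝ | ∃ z : ι → ℂ, z ≠ 0 ∧ r = ‖∑ i, z i * γ (φ (b i))‖ ^ 2 /
      (∑ i, ∑ j, starRingEnd ℂ (z i) * h (b i) (b j) * z j).re} (h.dual b φ φ).re := by
  set G := h.gram b with hG
  set w : ι → ℂ := fun i => γ (φ (b i)) with hw
  set u : ι → ℂ := G⁻¹.mulVec (star w) with hu
  have hGu : G.mulVec u = star w := by
    rw [hu, Matrix.mulVec_mulVec, Matrix.mul_nonsing_inv _
      ((Matrix.isUnit_iff_isUnit_det _).mp hb.isUnit), Matrix.one_mulVec]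
  have hpos : ∀ z : ι → ℂ, z ≠ 0 → 0 < star z ⬝ᵥ G.mulVec z := fun z hz =>
    hb.dotProduct_mulVec_pos hz
  -- the form and its dual in coordinates
  have hform : ∀ z : ι → ℂ, ∑ i, ∑ j, starRingEnd ℂ (z i) * h (b i) (b j) * z j =
      star z ⬝ᵥ G.mulVec z := by
    intro z
    simp [dotProduct, Matrix.mulVec, hG, SesqForm.gram, Finset.mul_sum, mul_assoc]
  have hdual : h.dual b φ φ = w ⬝ᵥ u := by
    simp only [SesqForm.dual, LinearMap.mk₂'ₛₗ_apply, dotProduct, hu, Matrix.mulVec,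
      Finset.mul_sum]
    rw [Finset.sum_comm]
    refine Finset.sum_congr rfl fun i _ => Finset.sum_congr rfl fun j _ => ?_
    simp only [hw, Pi.star_apply, RCLike.star_def]
    ring
  have hev : ∀ z : ι → ℂ, ∑ i, z i * γ (φ (b i)) = star u ⬝ᵥ G.mulVec z := by
    intro z
    rw [Matrix.dotProduct_mulVec, ← hb.1.eq, ← Matrix.star_mulVec, hGu, star_star,
      dotProduct_comm]
    rfl
  have hdual' : h.dual b φ φ = star u ⬝ᵥ G.mulVec u := by
    rw [hdual, ← hev, dotProduct_comm]
    rfl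
  simp only [hform, hev, hdual']
  constructor
  · by_cases hu0 : u = 0
    · refine ⟨1, one_ne_zero, ?_⟩
      simp [hu0]
    · refine ⟨u, hu0, ?_⟩
      have h1 := hpos u hu0
      obtain ⟨h2, h3⟩ := Complex.pos_iff.mp h1
      have h4 : star u ⬝ᵥ G.mulVec u = ((star u ⬝ᵥ G.mulVec u).re : ℂ) :=
        Complex.ext rfl (by simp [← h3])
      rw [h4, Complex.norm_real, Complex.ofReal_re, Real.norm_eq_abs, sq_abs]
      field_simp
  · rintro _ ⟨z, hz, rfl⟩
    obtain ⟨h2, h3⟩ := Complex.pos_iff.mp (hpos z hz)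
    rw [div_le_iff₀ h2]
    -- the Cauchy-Schwarz inequality
    set a := star u ⬝ᵥ G.mulVec z with ha
    set t := star z ⬝ᵥ G.mulVec z with ht
    set D := star u ⬝ᵥ G.mulVec u with hD
    have ha' : star z ⬝ᵥ G.mulVec u = starRingEnd ℂ a := by
      rw [ha, ← RCLike.star_def, Matrix.dotProduct_mulVec, ← hb.1.eq, ← Matrix.star_mulVec, hb.1.eq,
        ← Matrix.star_dotProduct]
    have htr : t = (t.re : ℂ) := Complex.ext rfl (by simp [← h3])
    have hx := hb.posSemidef.dotProduct_mulVec_nonneg (t • u - starRingEnd ℂ a • z)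
    have hexp : star (t • u - starRingEnd ℂ a • z) ⬝ᵥ G.mulVec (t • u - starRingEnd ℂ a • z) =
        t * (D * t - a * starRingEnd ℂ a) := by
      have hts : star t = t := by rw [htr]; simp
      simp only [star_sub, star_smul, Matrix.mulVec_sub, Matrix.mulVec_smul, sub_dotProduct,
        dotProduct_sub, smul_dotProduct, dotProduct_smul, smul_eq_mul, ← ha, ← ht, ← hD, ha', hts,
        RCLike.star_def, Complex.conj_conj]
      ring
    rw [hexp, htr, Complex.mul_conj, Complex.normSq_eq_norm_sq] at hx
    have hx' := (Complex.nonneg_iff.mp hx).1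
    rw [Complex.re_ofReal_mul, Complex.sub_re, Complex.re_mul_ofReal, Complex.ofReal_re] at hx'
    have := nonneg_of_mul_nonneg_right hx' h2
    linarith

namespace RigidAdelicSpace

/-- The dual rigid adelic space: the lattice is `Hom(L, 𝓞 K)`, and the forms at the infinite places
are the dual ones, which give the squares of the operator norms. -/
def dual [FiniteDimensional K E] (A : RigidAdelicSpace K E) : RigidAdelicSpace K (Dual K E) where
  lattice := dualLattice K A.lattice
  isLattice := A.isLattice.dual
  form γ := (A.form γ).dual (Module.finBasis K E)
  form_conj γ φ ψ := by
    have h1 : (A.form (ComplexEmbedding.conjugate γ)).gram (Module.finBasis K E) =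
        ((A.form γ).gram (Module.finBasis K E)).map (starRingEnd ℂ) := by
      ext i j
      exact A.form_conj γ _ _
    have h2 : ((A.form (ComplexEmbedding.conjugate γ)).gram (Module.finBasis K E))⁻¹ =
        ((A.form γ).gram (Module.finBasis K E))⁻¹.map (starRingEnd ℂ) := by
      rw [h1]
      refine Matrix.inv_eq_left_inv ?_
      rw [← Matrix.map_mul, Matrix.nonsing_inv_mul _ ((Matrix.isUnit_iff_isUnit_det _).mp
        (A.form_posDef γ _ _ (Module.finBasis K E).linearIndependent).isUnit),
        Matrix.map_one _ (map_zero _) (map_one _)]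
    simp [SesqForm.dual, h2]
  form_posDef γ n e he := by
    refine SesqForm.gram_posDef_of_basis _ (Module.finBasis K E).dualBasis ?_ e he
    rw [SesqForm.gram_dualBasis]
    exact (A.form_posDef γ _ _ (Module.finBasis K E).linearIndependent).inv.transpose

end RigidAdelicSpace

/-! ### Tensor products -/

/-- The image of `L ⊗ M` in `E ⊗ F`. -/
def tensorLattice (K : Type u) [Field K] [NumberField K] {E : Type v} [AddCommGroup E] [Module K E]
    {F : Type w} [AddCommGroup F] [Module K F] (L : AddSubgroup E) (M : AddSubgroup F) :
    AddSubgroup (E ⊗[K] F) :=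
  AddSubgroup.closure {z | ∃ x ∈ L, ∃ y ∈ M, z = x ⊗ₜ[K] y}

theorem IsOKLattice.tensor {L : AddSubgroup E} {M : AddSubgroup F} (hL : IsOKLattice K L)
    (hM : IsOKLattice K M) : IsOKLattice K (tensorLattice K L M) where
  smul_mem a z hz := by
    induction hz using AddSubgroup.closure_induction with
    | mem z hz =>
      obtain ⟨x, hx, y, hy, rfl⟩ := hz
      exact AddSubgroup.subset_closure ⟨(a : K) • x, hL.smul_mem a hx, y, hy, rfl⟩
    | zero => rw [smul_zero]; exact zero_mem _
    | add x y _ _ hx hy => rw [smul_add]; exact add_mem hx hy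
    | neg x _ hx => rw [smul_neg]; exact neg_mem hx
  fg := by
    classical
    obtain ⟨S, hS⟩ := hL.fg
    obtain ⟨T, hT⟩ := hM.fg
    refine ⟨(S ×ˢ T).image fun p => p.1 ⊗ₜ[K] p.2, le_antisymm ?_ ?_⟩
    · rw [AddSubgroup.closure_le]
      intro z hz
      simp only [Finset.coe_image, Set.mem_image, Finset.mem_coe, Finset.mem_product] at hz
      obtain ⟨⟨x, y⟩, ⟨hx, hy⟩, rfl⟩ := hz
      refine AddSubgroup.subset_closure ⟨x, ?_, y, ?_, rfl⟩
      · rw [← hS]; exact AddSubgroup.subset_closure hx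
      · rw [← hT]; exact AddSubgroup.subset_closure hy
    · rw [tensorLattice, AddSubgroup.closure_le]
      rintro _ ⟨x, hx, y, hy, rfl⟩
      rw [← hS] at hx
      rw [← hT] at hy
      rw [SetLike.mem_coe]
      induction hx using AddSubgroup.closure_induction with
      | mem x hx =>
        induction hy using AddSubgroup.closure_induction with
        | mem y hy =>
          refine AddSubgroup.subset_closure ?_
          simp only [Finset.coe_image, Set.mem_image, Finset.mem_coe, Finset.mem_product]
          exact ⟨(x, y), ⟨hx, hy⟩, rfl⟩
        | zero => rw [TensorProduct.tmul_zero]; exact zero_mem _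
        | add y y' _ _ h h' => rw [TensorProduct.tmul_add]; exact add_mem h h'
        | neg y _ h => rw [TensorProduct.tmul_neg]; exact neg_mem h
      | zero => rw [TensorProduct.zero_tmul]; exact zero_mem _
      | add x x' _ _ h h' => rw [TensorProduct.add_tmul]; exact add_mem h h'
      | neg x _ h => rw [TensorProduct.neg_tmul]; exact neg_mem h
  span_eq_top := by
    rw [eq_top_iff]
    intro z _
    induction z using TensorProduct.induction_on with
    | zero => exact zero_mem _
    | add x y hx hy => exact add_mem (hx trivial) (hy trivial)
    | tmul x y =>
      obtain ⟨d, hd, hx⟩ := hL.exists_smul_mem x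
      obtain ⟨d', hd', hy⟩ := hM.exists_smul_mem y
      have h1 : (d : K) ≠ 0 := by simpa using hd
      have h2 : (d' : K) ≠ 0 := by simpa using hd'
      rw [← inv_smul_smul₀ h1 x, ← inv_smul_smul₀ h2 y, TensorProduct.smul_tmul_smul]
      exact Submodule.smul_mem _ _
        (Submodule.subset_span (AddSubgroup.subset_closure ⟨_, hx, _, hy, rfl⟩))

/-- The tensor product of two forms, with
`(h ⊗ h') (x ⊗ y, x' ⊗ y') = h (x, x') * h' (y, y')`. -/
def SesqForm.tensor {γ : K →+* ℂ} (h : SesqForm γ E) (h' : SesqForm γ F) :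
    SesqForm γ (E ⊗[K] F) :=
  TensorProduct.lift (LinearMap.mk₂'ₛₗ ((starRingEnd ℂ).comp γ) ((starRingEnd ℂ).comp γ)
    (fun x y => TensorProduct.lift (LinearMap.mk₂'ₛₗ γ γ (fun x' y' => h x x' * h' y y')
      (by intros; simp [add_mul]) (by intros; simp [mul_assoc])
      (by intros; simp [mul_add]) (by intros; simp [mul_left_comm])))
    (by intros; apply TensorProduct.ext'; intros; simp [add_mul])
    (by intros; apply TensorProduct.ext'; intros; simp [mul_assoc])
    (by intros; apply TensorProduct.ext'; intros; simp [mul_add])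
    (by intros; apply TensorProduct.ext'; intros; simp [mul_left_comm]))

@[simp]
theorem SesqForm.tensor_tmul {γ : K →+* ℂ} (h : SesqForm γ E) (h' : SesqForm γ F) (x x' : E)
    (y y' : F) : h.tensor h' (x ⊗ₜ y) (x' ⊗ₜ y') = h x x' * h' y y' := rfl

namespace RigidAdelicSpace

/-- The tensor product of two rigid adelic spaces: the lattice is the image of `L ⊗ M` in `E ⊗ F`,
and the forms at the infinite places are the tensor products of the forms. -/
def tensor [FiniteDimensional K E] [FiniteDimensional K F] (A : RigidAdelicSpace K E)
    (B : RigidAdelicSpace K F) : RigidAdelicSpace K (E ⊗[K] F) where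
  lattice := tensorLattice K A.lattice B.lattice
  isLattice := A.isLattice.tensor B.isLattice
  form γ := (A.form γ).tensor (B.form γ)
  form_conj γ z z' := by
    induction z using TensorProduct.induction_on with
    | zero => simp
    | add x y hx hy => simp [hx, hy]
    | tmul x y =>
      induction z' using TensorProduct.induction_on with
      | zero => simp
      | add x y hx hy => simp [hx, hy]
      | tmul x' y' => simp [A.form_conj, B.form_conj]
  form_posDef γ n e he := by
    refine SesqForm.gram_posDef_of_basis _
      ((Module.finBasis K E).tensorProduct (Module.finBasis K F)) ?_ e he
    have h1 := (A.form_posDef γ _ _ (Module.finBasis K E).linearIndependent).kronecker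
      (B.form_posDef γ _ _ (Module.finBasis K F).linearIndependent)
    have h2 : ((A.form γ).tensor (B.form γ)).gram
        ((Module.finBasis K E).tensorProduct (Module.finBasis K F)) =
        Matrix.kroneckerMap (fun s t => s * t) ((A.form γ).gram (Module.finBasis K E))
          ((B.form γ).gram (Module.finBasis K F)) := by
      ext ⟨i, j⟩ ⟨i', j'⟩
      simp [SesqForm.gram, Basis.tensorProduct_apply]
    rw [h2]
    exact h1

/-! ### Local norms and similarities -/

/-- The local norm on `E ⊗ K_v` at a finite place `v`:
`‖x‖_v = inf {|α|_v : α ∈ K_v, x ∈ α L_v}`, where `L_v` is the `𝓞_v`-module generated by `L`. -/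
def finiteNorm (A : RigidAdelicSpace K E) (v : HeightOneSpectrum (𝓞 K))
    (x : v.adicCompletion K ⊗[K] E) : ℝ :=
  sInf {r : ℝ | ∃ α : v.adicCompletion K, r = ‖α‖ ∧
    ∃ y ∈ Submodule.span (v.adicCompletionIntegers K)
      {z : v.adicCompletion K ⊗[K] E | ∃ l ∈ A.lattice, z = 1 ⊗ₜ[K] l}, x = α • y}

/-- A similarity between rigid adelic spaces: a `K`-linear map that is locally a similarity at every
place, the ratio being `1` at all but finitely many places. At an infinite place, `σ` is a similarity
of ratio `c` if it multiplies the Hermitian form by `c ^ 2`. -/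
def IsSimilarity (A : RigidAdelicSpace K E) (B : RigidAdelicSpace K F) (σ : E →ₗ[K] F) : Prop :=
  (∀ γ : K →+* ℂ, ∃ c : ℝ, 0 < c ∧
    ∀ x y : E, B.form γ (σ x) (σ y) = (c : ℂ) ^ 2 * A.form γ x y) ∧
  ∃ c : HeightOneSpectrum (𝓞 K) → ℝ, (∀ v, 0 < c v) ∧ {v | c v ≠ 1}.Finite ∧
    ∀ v (x : v.adicCompletion K ⊗[K] E),
      B.finiteNorm v (σ.baseChange (v.adicCompletion K) x) = c v * A.finiteNorm v x

/-! ### Isodual spaces -/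

/-- `E` is isodual if there is a similarity `σ : E → E^∨`. -/
def IsIsodual [FiniteDimensional K E] (A : RigidAdelicSpace K E) : Prop :=
  ∃ σ : E →ₗ[K] Dual K E, A.IsSimilarity A.dual σ

/-- `E` is orthogonal if there is a similarity `σ : E → E^∨` for which the bilinear form
`b (x, y) = σ x y` is symmetric. -/
def IsOrthogonal [FiniteDimensional K E] (A : RigidAdelicSpace K E) : Prop :=
  ∃ σ : E →ₗ[K] Dual K E, A.IsSimilarity A.dual σ ∧ ∀ x y, σ x y = σ y x

/-- `E` is symplectic if there is a similarity `σ : E → E^∨` for which the bilinear form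
`b (x, y) = σ x y` is alternating. -/
def IsSymplectic [FiniteDimensional K E] (A : RigidAdelicSpace K E) : Prop :=
  ∃ σ : E →ₗ[K] Dual K E, A.IsSimilarity A.dual σ ∧ ∀ x, σ x x = 0

end RigidAdelicSpace

end Basics

/-! ### Conjugate spaces over a CM field -/

section CM

variable {K : Type u} [Field K] [NumberField K] [IsCMField K]
variable {E : Type v} [AddCommGroup E] [Module K E]

/-- The conjugate of a `K`-vector space `E`, `K` being a CM field: the same additive group with the
external law `a ⋆ x = conj a • x`. -/
def ConjSpace (_ : Type u) (E : Type v) : Type v := E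

instance : AddCommGroup (ConjSpace K E) := inferInstanceAs (AddCommGroup E)

instance : Module K (ConjSpace K E) :=
  Module.compHom E (IsCMField.complexConj K : K →+* K)

/-- The identity map from a space to its conjugate. -/
def ConjSpace.of (K : Type u) {E : Type v} [AddCommGroup E] : E ≃+ ConjSpace K E :=
  AddEquiv.refl E

theorem ConjSpace.of_symm_smul (a : K) (x : ConjSpace K E) :
    (ConjSpace.of K).symm (a • x) = IsCMField.complexConj K a • (ConjSpace.of K).symm x := rfl

theorem IsOKLattice.conj {L : AddSubgroup E} (hL : IsOKLattice K L) :
    IsOKLattice K (L.map (ConjSpace.of K).toAddMonoidHom) where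
  smul_mem a x hx := by
    obtain ⟨x, hx, rfl⟩ := hx
    exact ⟨_, hL.smul_mem (RingOfIntegers.mapRingHom (IsCMField.complexConj K) a) hx, rfl⟩
  fg := by
    classical
    obtain ⟨S, hS⟩ := hL.fg
    refine ⟨S.image (ConjSpace.of K), ?_⟩
    rw [← hS, AddMonoidHom.map_closure]
    simp
  span_eq_top := by
    rw [eq_top_iff]
    intro x _
    obtain ⟨d, hd, hx⟩ := hL.exists_smul_mem ((ConjSpace.of K).symm x)
    have hd' : IsCMField.complexConj K (d : K) ≠ 0 := by simpa using hd
    rw [← inv_smul_smul₀ hd' x]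
    refine Submodule.smul_mem _ _ (Submodule.subset_span ⟨_, hx, ?_⟩)
    apply (ConjSpace.of K).symm.injective
    rw [ConjSpace.of_symm_smul, IsCMField.complexConj_apply_apply]
    rfl

namespace RigidAdelicSpace

/-- The rigid adelic structure on the conjugate space: the lattice and the norms at the infinite
places are the same. -/
def conj (A : RigidAdelicSpace K E) : RigidAdelicSpace K (ConjSpace K E) where
  lattice := A.lattice.map (ConjSpace.of K).toAddMonoidHom
  isLattice := A.isLattice.conj
  form γ := LinearMap.mk₂'ₛₗ ((starRingEnd ℂ).comp γ) γ
    (fun x y => A.form (ComplexEmbedding.conjugate γ)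
      ((ConjSpace.of K).symm x) ((ConjSpace.of K).symm y))
    (by intros; simp) (by intros; simp [ConjSpace.of_symm_smul])
    (by intros; simp) (by intros; simp [ConjSpace.of_symm_smul])
  form_conj γ x y := A.form_conj _ _ _
  form_posDef γ n e he := by
    refine A.form_posDef _ n ((ConjSpace.of K).symm ∘ e) ?_
    rw [Fintype.linearIndependent_iff] at he ⊢
    intro g hg i
    have h1 := he (fun i => IsCMField.complexConj K (g i)) (by
      apply (ConjSpace.of K).symm.injective
      rw [map_sum, map_zero, ← hg]
      refine Finset.sum_congr rfl fun j _ => ?_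
      rw [ConjSpace.of_symm_smul, IsCMField.complexConj_apply_apply]
      rfl) i
    simpa using h1

/-- `E` is unitary (over a CM field) if there is a similarity `σ` from `E` onto its conjugate dual
for which the sesquilinear form `b (x, y) = σ x y` is Hermitian. -/
def IsUnitary [FiniteDimensional K E] (A : RigidAdelicSpace K E) : Prop :=
  ∃ σ : E →ₗ[K] ConjSpace K (Dual K E), A.IsSimilarity A.dual.conj σ ∧
    ∀ x y, ((ConjSpace.of K).symm (σ x)) y =
      IsCMField.complexConj K (((ConjSpace.of K).symm (σ y)) x)

end RigidAdelicSpace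

end CM

/-! ### Tensor multiplicativity of the minimal height -/

section Bost

variable (K : Type u) [Field K] [NumberField K]

/-- Bost's conjecture over the number field `K`: `H_min(E ⊗ F) = H_min(E) * H_min(F)` for all
(nonzero) rigid adelic spaces `E` and `F` over `K`. -/
def BostConjecture : Prop :=
  ∀ (E F : Type u) [AddCommGroup E] [Module K E] [FiniteDimensional K E] [Nontrivial E]
    [AddCommGroup F] [Module K F] [FiniteDimensional K F] [Nontrivial F]
    (A : RigidAdelicSpace K E) (B : RigidAdelicSpace K F),
    (A.tensor B).minHeight = A.minHeight * B.minHeight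

/-- The equality `H_min(E ⊗ F) = H_min(E) * H_min(F)` holds for all (nonzero) rigid adelic spaces
`E` and `F` over `K` that both have the property `P`. -/
def BostConjectureFor
    (P : ∀ (E : Type u) [AddCommGroup E] [Module K E] [FiniteDimensional K E],
      RigidAdelicSpace K E → Prop) : Prop :=
  ∀ (E F : Type u) [AddCommGroup E] [Module K E] [FiniteDimensional K E] [Nontrivial E]
    [AddCommGroup F] [Module K F] [FiniteDimensional K F] [Nontrivial F]
    (A : RigidAdelicSpace K E) (B : RigidAdelicSpace K F), P E A → P F B →
    (A.tensor B).minHeight = A.minHeight * B.minHeight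

end Bost

end

/-!
# Tensor multiplicativity of the minimal height and isodual spaces

The basic tool is an inequality for contractions, that is, linear maps `f : E → F` that do not
increase the norm at any place. If `f` is surjective, then `H(ker f) * H(F) ≤ H(E)`
(`RigidAdelicSpace.IsContraction.height_ker_mul_le`). At the finite places this follows from a
pseudo-basis of the lattice adapted to the kernel, together with the inclusion
`det P • ∏ 𝔞 i ⊆ ∏ 𝔞' i` for a matrix `P` that maps `⨁ 𝔞 i` into `⨁ 𝔞' i`; at the infinite places,
it follows from Schur complements and the monotonicity of determinants of positive definite matrices.

Write `A.HeightBound m` for the property `m ^ dim W ≤ H(W)` for all subspaces `W`; for `m ≥ 0` and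
`E ≠ 0` it means that `m ≤ H_min(E)`. By the inequality above, the bound passes from the target of
an injective contraction to its source, and from the kernel and the target of a contraction to its
source. With `H(E^∨) = H(E)⁻¹` it also yields all comparisons of heights needed for annihilators.
So no quotient metrics are necessary: the quotient of `E` by `W` is realized as the dual of the
annihilator `W^⊥ ⊆ E^∨`.

The inequality `H_min(E ⊗ F) ≤ H_min(E) * H_min(F)` always holds, since `H_r` is at most
multiplicative on tensor products of subspaces. The opposite inequality is a `HeightBound` for
`E ⊗ F`, and it is first reduced to semistable spaces by induction on the dimensions. If `E` is not
semistable, and `m < H_min(E)`, then a proper subspace `W` of almost minimal reduced height has the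
property that `W` and `E / W` both have bound `m`
(`RigidAdelicSpace.exists_heightBound_of_not_isSemistable`), and the bounds for `W ⊗ F` and
`(E / W) ⊗ F` imply one for `E ⊗ F`. As `m` tends to `H_min(E)`, the claim results; it is not needed
that the minimum is attained.

If `E` is semistable, with `m = H_r(E)`, then `E^∨` is semistable with reduced height `m⁻¹`. Let its
norms at the infinite places be multiplied by `m ^ 2`. The orthogonal sum of `E` and this space is
semistable with reduced height `m`, and the bilinear forms `φ y ± ψ x` on it show that it is
orthogonal and symplectic, the rescaling being absorbed by the ratio of the similarity. Over a CM
field, the conjugate of `E^∨` in place of `E^∨` gives a unitary space. So, if `E'` and `F'` are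
obtained in this way from semistable spaces `E` and `F`, then `E ⊗ F` embeds in `E' ⊗ F'`, and the
multiplicativity for `E'` and `F'` gives the bound `H_r(E) * H_r(F)` for `E ⊗ F`.
-/

set_option linter.unusedSectionVars false

/-! ### Fractional ideals -/

section FractionalIdeals

variable {K : Type u} [Field K] [NumberField K]

theorem FractionalIdeal.absNorm_pos {I : FractionalIdeal (𝓞 K)⁰ K} (hI : I ≠ 0) :
    0 < FractionalIdeal.absNorm I :=
  lt_of_le_of_ne (FractionalIdeal.absNorm_nonneg I)
    fun h => hI (FractionalIdeal.absNorm_eq_zero_iff.mp h.symm)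

theorem FractionalIdeal.absNorm_anti {I J : FractionalIdeal (𝓞 K)⁰ K} (hI : I ≠ 0) (h : I ≤ J) :
    FractionalIdeal.absNorm J ≤ FractionalIdeal.absNorm I := by
  have hJ : J ≠ 0 := by
    rintro rfl
    exact hI (le_antisymm h (FractionalIdeal.zero_le _))
  have h1 : J⁻¹ * I ≤ 1 := by
    rw [← inv_mul_cancel₀ hJ]
    exact mul_le_mul_right h _
  obtain ⟨I₀, hI₀⟩ := FractionalIdeal.le_one_iff_exists_coeIdeal.mp h1
  have h2 : I = J * (I₀ : FractionalIdeal (𝓞 K)⁰ K) := by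
    rw [hI₀, ← mul_assoc, mul_inv_cancel₀ hJ, one_mul]
  have h3 : I₀ ≠ ⊥ := by
    rintro rfl
    exact hI (by simpa using h2)
  have h4 : (1 : ℚ) ≤ Ideal.absNorm I₀ := by
    exact_mod_cast Nat.one_le_iff_ne_zero.mpr (Ideal.absNorm_ne_zero_iff_mem_nonZeroDivisors.mpr
      (mem_nonZeroDivisors_of_ne_zero h3))
  rw [h2, map_mul, FractionalIdeal.coeIdeal_absNorm]
  exact le_mul_of_one_le_right (FractionalIdeal.absNorm_nonneg J) h4

theorem FractionalIdeal.prod_mem_prod {ι : Type*} (s : Finset ι)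
    (a : ι → FractionalIdeal (𝓞 K)⁰ K) (t : ι → K) (h : ∀ i ∈ s, t i ∈ a i) :
    ∏ i ∈ s, t i ∈ ∏ i ∈ s, a i := by
  classical
  induction s using Finset.induction_on with
  | empty => simp
  | insert i s hi ih =>
    rw [Finset.prod_insert hi, Finset.prod_insert hi]
    exact FractionalIdeal.mul_mem_mul (h i (by simp)) (ih fun j hj => h j (by simp [hj]))

/-- A product of fractional ideals is generated by products of elements. -/
theorem FractionalIdeal.mul_mem_of_forall_prod {ι : Type*} (s : Finset ι)
    (a : ι → FractionalIdeal (𝓞 K)⁰ K) (J : FractionalIdeal (𝓞 K)⁰ K) (c : K)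
    (h : ∀ t : ι → K, (∀ i ∈ s, t i ∈ a i) → c * ∏ i ∈ s, t i ∈ J) :
    ∀ x ∈ ∏ i ∈ s, a i, c * x ∈ J := by
  classical
  induction s using Finset.induction_on generalizing c with
  | empty =>
    intro x hx
    rw [Finset.prod_empty, FractionalIdeal.mem_one_iff] at hx
    obtain ⟨r, rfl⟩ := hx
    have := J.1.smul_mem r (h (fun _ => 0) (by simp))
    rw [Finset.prod_empty, mul_one, Algebra.smul_def, mul_comm] at this
    exact this
  | insert i s hi ih =>
    intro x hx
    rw [Finset.prod_insert hi] at hx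
    refine FractionalIdeal.mul_induction_on hx ?_ ?_
    · intro u hu v hv
      rw [← mul_assoc]
      refine ih (c * u) ?_ v hv
      intro t ht
      have := h (Function.update t i u) ?_
      · rw [Finset.prod_insert hi, Function.update_self, ← mul_assoc] at this
        rwa [Finset.prod_congr rfl fun j hj => Function.update_of_ne
          (fun h : j = i => hi (h ▸ hj)) u t] at this
      · intro j hj
        by_cases hji : j = i
        · subst hji; simpa using hu
        · rw [Function.update_of_ne hji]
          exact ht j (by simpa [hji] using hj)
    · intro x y hx hy
      rw [mul_add]
      exact J.1.add_mem hx hy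

/-- If the matrix `P` maps `⨁ i, a i` into `⨁ i, a' i`, then `det P • ∏ a ≤ ∏ a'`. -/
theorem FractionalIdeal.spanSingleton_det_mul_prod_le {ι : Type*} [Fintype ι] [DecidableEq ι]
    (a a' : ι → FractionalIdeal (𝓞 K)⁰ K) (P : Matrix ι ι K)
    (h : ∀ i, ∀ t ∈ a i, ∀ j, P j i * t ∈ a' j) :
    FractionalIdeal.spanSingleton (𝓞 K)⁰ P.det * ∏ i, a i ≤ ∏ i, a' i := by
  rw [FractionalIdeal.spanSingleton_mul_le_iff]
  refine FractionalIdeal.mul_mem_of_forall_prod _ _ _ _ fun t ht => ?_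
  rw [Matrix.det_apply, Finset.sum_mul]
  refine Submodule.sum_mem (∏ i, a' i : FractionalIdeal (𝓞 K)⁰ K).1 fun σ _ => ?_
  have h1 : (∏ i, P (σ i) i * t i) ∈ ∏ i, a' i := by
    have := FractionalIdeal.prod_mem_prod Finset.univ (fun i => a' (σ i))
      (fun i => P (σ i) i * t i) (fun i _ => h i _ (ht i (by simp)) _)
    rwa [Equiv.prod_comp σ] at this
  rw [Finset.prod_mul_distrib] at h1
  rcases Int.units_eq_one_or (Equiv.Perm.sign σ) with hs | hs
  · simpa [hs] using h1
  · simpa [hs] using Submodule.neg_mem _ h1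

theorem prod_norm_embeddings (x : K) : ∏ γ : K →+* ℂ, ‖γ x‖ = |(Algebra.norm ℚ x : ℝ)| := by
  have := congr_arg (‖·‖) (Algebra.norm_eq_prod_embeddings ℚ ℂ x)
  rw [norm_prod, ← Fintype.prod_equiv (RingHom.equivRatAlgHom K ℂ) (fun f => ‖f x‖)
      (fun φ => ‖φ x‖) fun _ => by simp [RingHom.equivRatAlgHom_apply]] at this
  rw [← this]
  simp

end FractionalIdeals

/-! ### Gram matrices -/

section Gram

variable {K : Type u} [Field K] [NumberField K]
variable {E : Type v} [AddCommGroup E] [Module K E]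

/-- The Gram matrix of the linear combinations `∑ i, M i k • b i`. -/
theorem SesqForm.gram_sum {γ : K →+* ℂ} (h : SesqForm γ E) {ι κ : Type*} [Fintype ι]
    (b : ι → E) (M : Matrix ι κ K) :
    h.gram (fun k => ∑ i, M i k • b i) = (M.map γ).conjTranspose * h.gram b * M.map γ := by
  ext k l
  simp only [SesqForm.gram, Matrix.of_apply, Matrix.mul_apply, Matrix.conjTranspose_apply,
    Matrix.map_apply, map_sum, LinearMap.sum_apply, LinearMap.map_smulₛₗ, LinearMap.smul_apply,
    smul_eq_mul, Finset.sum_mul, RingHom.comp_apply, RCLike.star_def]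
  refine Finset.sum_congr rfl fun i _ => ?_
  rw [Finset.mul_sum]
  refine Finset.sum_congr rfl fun j _ => ?_
  ring

theorem SesqForm.gram_eq_of_basis {γ : K →+* ℂ} (h : SesqForm γ E) {ι κ : Type*} [Fintype ι]
    (b : Basis ι K E) (e : κ → E) :
    h.gram e = ((b.toMatrix e).map γ).conjTranspose * h.gram b * (b.toMatrix e).map γ := by
  rw [← SesqForm.gram_sum]
  congr 1
  ext k
  exact (b.sum_repr (e k)).symm

theorem SesqForm.det_gram_eq {γ : K →+* ℂ} (h : SesqForm γ E) {ι : Type*} [Fintype ι]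
    [DecidableEq ι] (b : Basis ι K E) (e : ι → E) :
    (h.gram e).det.re = ‖γ (b.toMatrix e).det‖ ^ 2 * (h.gram b).det.re := by
  have h1 : ((b.toMatrix e).map γ).det = γ (b.toMatrix e).det := (RingHom.map_det γ _).symm
  rw [h.gram_eq_of_basis b e, Matrix.det_mul, Matrix.det_mul, Matrix.det_conjTranspose, h1,
    mul_right_comm, RCLike.star_def, mul_comm (starRingEnd ℂ _), Complex.mul_conj,
    Complex.re_ofReal_mul, Complex.normSq_eq_norm_sq]

theorem RigidAdelicSpace.gram_posDef (A : RigidAdelicSpace K E) (γ : K →+* ℂ) {ι : Type*}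
    [Fintype ι] {e : ι → E} (he : LinearIndependent K e) : ((A.form γ).gram e).PosDef := by
  let f := Fintype.equivFin ι
  have := A.form_posDef γ _ (e ∘ f.symm) (he.comp _ f.symm.injective)
  have h2 := this.submatrix f.injective
  convert h2 using 1
  ext i j
  simp [SesqForm.gram]

end Gram

/-! ### Heights in terms of arbitrary pseudo-bases -/

namespace RigidAdelicSpace

variable {K : Type u} [Field K] [NumberField K]
variable {E : Type v} [AddCommGroup E] [Module K E]

/-- The product of the norm of the fractional ideals `a i` and the volumes of the parallelotopes
spanned by the vectors `b i` at the infinite places. If `(a, b)` is a pseudo-basis of the lattice,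
this is the power of the height with exponent `[K : ℚ]`. -/
noncomputable def pseudoVolume (A : RigidAdelicSpace K E) {ι : Type*} [Fintype ι] [DecidableEq ι]
    (a : ι → FractionalIdeal (𝓞 K)⁰ K) (b : ι → E) : ℝ :=
  (FractionalIdeal.absNorm (∏ i, a i) : ℝ) *
    ∏ γ : K →+* ℂ, (((A.form γ).gram b).det.re) ^ (1 / 2 : ℝ)

theorem det_gram_pos (A : RigidAdelicSpace K E) (γ : K →+* ℂ) {ι : Type*} [Fintype ι]
    [DecidableEq ι] {b : ι → E} (hb : LinearIndependent K b) :
    0 < ((A.form γ).gram b).det.re :=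
  (Complex.pos_iff.mp (A.gram_posDef γ hb).det_pos).1

theorem pseudoVolume_pos (A : RigidAdelicSpace K E) {ι : Type*} [Fintype ι] [DecidableEq ι]
    {a : ι → FractionalIdeal (𝓞 K)⁰ K} (ha : ∀ i, a i ≠ 0) {b : ι → E}
    (hb : LinearIndependent K b) : 0 < A.pseudoVolume a b := by
  refine mul_pos ?_ (Finset.prod_pos fun γ _ => Real.rpow_pos_of_pos (A.det_gram_pos γ hb) _)
  exact_mod_cast FractionalIdeal.absNorm_pos (Finset.prod_ne_zero_iff.mpr fun i _ => ha i)

/-- Comparison of a lattice containing `⨁ i, a i • b i` and contained in `⨁ i, a' i • b' i`. -/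
theorem pseudoVolume_le (A : RigidAdelicSpace K E) {ι : Type*} [Fintype ι] [DecidableEq ι]
    {a a' : ι → FractionalIdeal (𝓞 K)⁰ K} (b b' : Basis ι K E) (ha : ∀ i, a i ≠ 0)
    (h : ∀ i, ∀ t ∈ a i, t • b i ∈ A.lattice) (h' : ∀ x ∈ A.lattice, ∀ j, b'.repr x j ∈ a' j) :
    A.pseudoVolume a' b' ≤ A.pseudoVolume a b := by
  set P := b'.toMatrix b with hP
  have hdet : P.det ≠ 0 := by
    have : IsUnit P.det := by
      rw [← Matrix.isUnit_iff_isUnit_det]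
      exact IsUnit.of_mul_eq_one _ (b'.toMatrix_mul_toMatrix_flip b)
    exact this.ne_zero
  have h1 := FractionalIdeal.spanSingleton_det_mul_prod_le a a' P fun i t ht j => by
    have := h' _ (h i t ht) j
    rw [map_smul, Finsupp.smul_apply, smul_eq_mul, mul_comm] at this
    exact this
  have h2 := FractionalIdeal.absNorm_anti (mul_ne_zero
    (FractionalIdeal.spanSingleton_ne_zero_iff.mpr hdet)
    (Finset.prod_ne_zero_iff.mpr fun i _ => ha i)) h1
  rw [map_mul, FractionalIdeal.absNorm_span_singleton] at h2
  have h3 : (FractionalIdeal.absNorm (∏ i, a' i) : ℝ) ≤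
      |(Algebra.norm ℚ P.det : ℝ)| * (FractionalIdeal.absNorm (∏ i, a i) : ℝ) := by
    exact_mod_cast h2
  have h4 : ∏ γ : K →+* ℂ, (((A.form γ).gram b).det.re) ^ (1 / 2 : ℝ) =
      |(Algebra.norm ℚ P.det : ℝ)| *
        ∏ γ : K →+* ℂ, (((A.form γ).gram b').det.re) ^ (1 / 2 : ℝ) := by
    rw [← prod_norm_embeddings, ← Finset.prod_mul_distrib]
    refine Finset.prod_congr rfl fun γ _ => ?_
    rw [SesqForm.det_gram_eq (A.form γ) b' b, Real.mul_rpow (by positivity)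
      (A.det_gram_pos γ b'.linearIndependent).le, ← Real.sqrt_eq_rpow, Real.sqrt_sq (norm_nonneg _)]
  rw [pseudoVolume, pseudoVolume, h4]
  have h5 : 0 ≤ ∏ γ : K →+* ℂ, (((A.form γ).gram b').det.re) ^ (1 / 2 : ℝ) :=
    Finset.prod_nonneg fun γ _ => Real.rpow_nonneg (A.det_gram_pos γ b'.linearIndependent).le _
  calc _ ≤ _ := mul_le_mul_of_nonneg_right h3 h5
    _ = _ := by ring

theorem pseudoVolume_reindex (A : RigidAdelicSpace K E) {ι κ : Type*} [Fintype ι] [DecidableEq ι]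
    [Fintype κ] [DecidableEq κ] (e : κ ≃ ι) (a : ι → FractionalIdeal (𝓞 K)⁰ K) (b : ι → E) :
    A.pseudoVolume (a ∘ e) (b ∘ e) = A.pseudoVolume a b := by
  have h : ∏ k, (a ∘ e) k = ∏ i, a i := Equiv.prod_comp e a
  rw [pseudoVolume, pseudoVolume, h]
  congr 1
  refine Finset.prod_congr rfl fun γ _ => ?_
  have : (A.form γ).gram (b ∘ e) = ((A.form γ).gram b).submatrix e e := rfl
  rw [this, Matrix.det_submatrix_equiv_self]

/-- `L = ⨁ i, a i • b i`, for an arbitrary index type. -/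
def IsPseudoBasis (A : RigidAdelicSpace K E) {ι : Type*} (a : ι → FractionalIdeal (𝓞 K)⁰ K)
    (b : Basis ι K E) : Prop :=
  ∀ x, x ∈ A.lattice ↔ ∀ i, b.repr x i ∈ a i

section

variable {A : RigidAdelicSpace K E} {ι : Type*} {a : ι → FractionalIdeal (𝓞 K)⁰ K}
  {b : Basis ι K E}

theorem IsPseudoBasis.smul_mem (h : A.IsPseudoBasis a b) {i : ι} {t : K} (ht : t ∈ a i) :
    t • b i ∈ A.lattice := by
  classical
  refine (h _).mpr fun j => ?_
  rw [map_smul, Basis.repr_self, Finsupp.smul_apply, Finsupp.single_apply]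
  split_ifs with hij
  · subst hij; simpa using ht
  · rw [smul_zero]; exact (a j).1.zero_mem

theorem IsPseudoBasis.ideal_ne_zero (h : A.IsPseudoBasis a b) (i : ι) : a i ≠ 0 := by
  intro h0
  obtain ⟨d, hd, hx⟩ := A.isLattice.exists_smul_mem (b i)
  have := (h _).mp hx i
  rw [h0, FractionalIdeal.mem_zero_iff] at this
  simp [hd] at this

theorem exists_isPseudoBasis [FiniteDimensional K E] (A : RigidAdelicSpace K E) :
    ∃ (a : Fin (finrank K E) → FractionalIdeal (𝓞 K)⁰ K) (b : Basis (Fin (finrank K E)) K E),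
      A.IsPseudoBasis a b ∧ A.height = A.pseudoVolume a b ^ (1 / (finrank ℚ K : ℝ)) := by
  let p := Classical.choice A.isLattice.nonempty_pseudoBasis
  exact ⟨p.ideal, p.basis, p.mem_iff, rfl⟩

variable [FiniteDimensional K E] [Fintype ι] [DecidableEq ι]

theorem height_le (A : RigidAdelicSpace K E) (a : ι → FractionalIdeal (𝓞 K)⁰ K) (b : Basis ι K E)
    (ha : ∀ i, a i ≠ 0) (h : ∀ i, ∀ t ∈ a i, t • b i ∈ A.lattice) :
    A.height ≤ A.pseudoVolume a b ^ (1 / (finrank ℚ K : ℝ)) := by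
  obtain ⟨a', b', hab, hH⟩ := A.exists_isPseudoBasis
  rw [hH]
  refine Real.rpow_le_rpow (A.pseudoVolume_pos hab.ideal_ne_zero b'.linearIndependent).le ?_
    (by positivity)
  let e : Fin (finrank K E) ≃ ι := Fintype.equivOfCardEq (by
    rw [Fintype.card_fin, finrank_eq_card_basis b])
  rw [← A.pseudoVolume_reindex e a b]
  have := A.pseudoVolume_le (a := a ∘ e) (b.reindex e.symm) b' (fun i => ha _)
    (fun i t ht => by simpa using h (e i) t ht) (fun x hx => (hab x).mp hx)
  simpa [Basis.coe_reindex] using this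

/-- The height can be computed from any pseudo-basis. -/
theorem IsPseudoBasis.height_eq (h : A.IsPseudoBasis a b) :
    A.height = A.pseudoVolume a b ^ (1 / (finrank ℚ K : ℝ)) := by
  refine le_antisymm (A.height_le a b h.ideal_ne_zero fun i t ht => h.smul_mem ht) ?_
  obtain ⟨a', b', hab, hH⟩ := A.exists_isPseudoBasis
  rw [hH]
  refine Real.rpow_le_rpow (A.pseudoVolume_pos h.ideal_ne_zero b.linearIndependent).le ?_
    (by positivity)
  let e : Fin (finrank K E) ≃ ι := Fintype.equivOfCardEq (by
    rw [Fintype.card_fin, finrank_eq_card_basis b])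
  rw [← A.pseudoVolume_reindex e a b]
  have := A.pseudoVolume_le (a' := a ∘ e) b' (b.reindex e.symm) hab.ideal_ne_zero
    (fun i t ht => hab.smul_mem ht) (fun x hx j => by simpa using (h x).mp hx (e j))
  simpa [Basis.coe_reindex] using this

theorem height_pos (A : RigidAdelicSpace K E) : 0 < A.height := by
  obtain ⟨a', b', hab, hH⟩ := A.exists_isPseudoBasis
  rw [hH]
  exact Real.rpow_pos_of_pos (A.pseudoVolume_pos hab.ideal_ne_zero b'.linearIndependent) _

theorem height_eq_one (A : RigidAdelicSpace K E) [Subsingleton E] : A.height = 1 := by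
  have h : A.IsPseudoBasis (0 : Empty → FractionalIdeal (𝓞 K)⁰ K) (Basis.empty E) := by
    intro x
    rw [Subsingleton.elim x 0]
    simp [A.lattice.zero_mem]
  rw [h.height_eq]
  simp [pseudoVolume]

end

end RigidAdelicSpace

/-! ### Determinants of positive definite matrices -/

section Matrices

open scoped Matrix

variable {m n : Type*} [Fintype m] [Fintype n] [DecidableEq m] [DecidableEq n]

theorem Matrix.PosSemidef.one_le_det_one_add {X : Matrix n n ℂ} (hX : X.PosSemidef) :
    1 ≤ (1 + X).det.re := by
  have hH : (1 + X).IsHermitian := Matrix.isHermitian_one.add hX.1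
  rw [hH.det_eq_prod_eigenvalues]
  have h1 : ∀ i, 1 ≤ hH.eigenvalues i := by
    intro i
    rw [hH.eigenvalues_eq, Matrix.add_mulVec, Matrix.one_mulVec, dotProduct_add, map_add]
    have h2 : RCLike.re (star (hH.eigenvectorBasis i).ofLp ⬝ᵥ (hH.eigenvectorBasis i).ofLp) =
        (1 : ℝ) := by
      have := hH.eigenvectorBasis.orthonormal.1 i
      rw [dotProduct_comm, ← EuclideanSpace.inner_eq_star_dotProduct, inner_self_eq_norm_sq_to_K,
        this]
      simp
    have h3 := (Complex.nonneg_iff.mp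
      (hX.dotProduct_mulVec_nonneg (hH.eigenvectorBasis i).ofLp)).1
    rw [h2]
    exact le_add_of_nonneg_right h3
  have h4 : (1 : ℝ) ≤ ∏ i, hH.eigenvalues i := Finset.one_le_prod fun i _ => h1 i
  rw [← RCLike.ofReal_prod]
  exact h4

/-- The determinant is monotone on positive definite matrices. -/
theorem Matrix.PosDef.det_re_le {A B : Matrix n n ℂ} (hA : A.PosDef) (h : (B - A).PosSemidef) :
    A.det.re ≤ B.det.re := by
  obtain ⟨C, hC⟩ : ∃ C : Matrix n n ℂ, A = Cᴴ * C := by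
    open scoped MatrixOrder in
    obtain ⟨C, hC⟩ := CStarAlgebra.nonneg_iff_eq_star_mul_self.mp hA.posSemidef.nonneg
    exact ⟨C, hC⟩
  have hdet : C.det ≠ 0 := by
    intro h0
    have := hA.det_pos
    rw [hC, Matrix.det_mul, h0, mul_zero] at this
    exact this.ne rfl
  have hu : IsUnit C.det := isUnit_iff_ne_zero.mpr hdet
  set X := (C⁻¹)ᴴ * (B - A) * C⁻¹ with hX
  have hXp : X.PosSemidef := h.conjTranspose_mul_mul_same _
  have hB : B = Cᴴ * (1 + X) * C := by
    have h1 : Cᴴ * (C⁻¹)ᴴ = 1 := by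
      rw [← Matrix.conjTranspose_mul, Matrix.nonsing_inv_mul _ hu, Matrix.conjTranspose_one]
    have h2 : Cᴴ * X * C = B - A := by
      rw [hX, Matrix.mul_assoc, Matrix.mul_assoc ((C⁻¹)ᴴ * (B - A)), Matrix.nonsing_inv_mul _ hu,
        Matrix.mul_one, ← Matrix.mul_assoc, h1, Matrix.one_mul]
    rw [Matrix.mul_add, Matrix.add_mul, h2, Matrix.mul_one, ← hC]
    abel
  have h3 : ∀ Y : Matrix n n ℂ, (Cᴴ * Y * C).det.re = ‖C.det‖ ^ 2 * Y.det.re := by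
    intro Y
    rw [Matrix.det_mul, Matrix.det_mul, Matrix.det_conjTranspose, mul_right_comm, RCLike.star_def,
      mul_comm (starRingEnd ℂ _), Complex.mul_conj, Complex.re_ofReal_mul,
      Complex.normSq_eq_norm_sq]
  have hA' : A = Cᴴ * 1 * C := by rw [Matrix.mul_one, ← hC]
  rw [hB, h3, hA', h3, Matrix.det_one]
  exact mul_le_mul_of_nonneg_left (by simpa using hXp.one_le_det_one_add) (by positivity)

/-- A lower bound for the determinant of a block matrix, by comparison of the Schur complement
with `T`. -/
theorem Matrix.PosDef.det_mul_det_le_det_fromBlocks {G : Matrix m m ℂ} (hG : G.PosDef)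
    (X : Matrix m n ℂ) (D : Matrix n n ℂ) {T : Matrix n n ℂ} (hT : T.PosDef)
    (h : (Matrix.fromBlocks G X Xᴴ (D - T)).PosSemidef) :
    G.det.re * T.det.re ≤ (Matrix.fromBlocks G X Xᴴ D).det.re := by
  have : Invertible G := hG.isUnit.invertible
  rw [Matrix.PosDef.fromBlocks₁₁ _ _ hG] at h
  have h1 : T.det.re ≤ (D - Xᴴ * G⁻¹ * X).det.re := by
    refine hT.det_re_le ?_
    rwa [sub_right_comm] at h
  obtain ⟨h2, h3⟩ := Complex.pos_iff.mp hG.det_pos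
  rw [Matrix.det_fromBlocks₁₁, Matrix.invOf_eq_nonsing_inv, Complex.mul_re, ← h3, zero_mul,
    sub_zero]
  exact mul_le_mul_of_nonneg_left h1 h2.le

end Matrices

/-! ### Nonnegative forms -/

namespace SesqForm

variable {K : Type u} [Field K] [NumberField K]
variable {E : Type*} [AddCommGroup E] [Module K E]
variable {F : Type*} [AddCommGroup F] [Module K F]
variable {γ : K →+* ℂ}

/-- The extension of the form to `E ⊗_γ ℂ` is positive semidefinite. -/
def IsNonneg (h : SesqForm γ E) : Prop :=
  ∀ (n : ℕ) (e : Fin n → E), (h.gram e).PosSemidef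

/-- The inverse image of a form under a linear map. -/
noncomputable def comap (h : SesqForm γ F) (f : E →ₗ[K] F) : SesqForm γ E :=
  LinearMap.mk₂'ₛₗ ((starRingEnd ℂ).comp γ) γ (fun x y => h (f x) (f y))
    (by intros; simp) (by intros; simp) (by intros; simp) (by intros; simp)

@[simp]
theorem comap_apply (h : SesqForm γ F) (f : E →ₗ[K] F) (x y : E) :
    h.comap f x y = h (f x) (f y) := rfl

theorem gram_apply (h : SesqForm γ E) {ι : Type*} (e : ι → E) (i j : ι) :
    h.gram e i j = h (e i) (e j) := rfl

theorem gram_comap (h : SesqForm γ F) (f : E →ₗ[K] F) {ι : Type*} (e : ι → E) :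
    (h.comap f).gram e = h.gram (f ∘ e) := rfl

theorem gram_sub (h h' : SesqForm γ E) {ι : Type*} (e : ι → E) :
    (h - h').gram e = h.gram e - h'.gram e := rfl

theorem gram_add (h h' : SesqForm γ E) {ι : Type*} (e : ι → E) :
    (h + h').gram e = h.gram e + h'.gram e := rfl

theorem IsNonneg.gram {h : SesqForm γ E} (hh : h.IsNonneg) {ι : Type*} [Fintype ι] (e : ι → E) :
    (h.gram e).PosSemidef := by
  let f := Fintype.equivFin ι
  have h2 := (hh _ (e ∘ f.symm)).submatrix f
  convert h2 using 1
  ext i j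
  simp [SesqForm.gram]

theorem isNonneg_of_basis {h : SesqForm γ E} {ι : Type*} [Fintype ι] (b : Basis ι K E)
    (hb : (h.gram b).PosSemidef) : h.IsNonneg := by
  intro n e
  rw [h.gram_eq_of_basis b e]
  exact hb.conjTranspose_mul_mul_same _

theorem IsNonneg.add {h h' : SesqForm γ E} (hh : h.IsNonneg) (hh' : h'.IsNonneg) :
    (h + h').IsNonneg := by
  intro n e
  rw [gram_add]
  exact (hh n e).add (hh' n e)

theorem IsNonneg.comap {h : SesqForm γ F} (hh : h.IsNonneg) (f : E →ₗ[K] F) :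
    (h.comap f).IsNonneg :=
  fun n e => hh n (f ∘ e)

theorem isNonneg_zero : (0 : SesqForm γ E).IsNonneg := by
  intro n e
  have : (0 : SesqForm γ E).gram e = 0 := by ext; rfl
  rw [this]
  exact Matrix.PosSemidef.zero

end SesqForm

/-! ### Contractions -/

namespace RigidAdelicSpace

variable {K : Type u} [Field K] [NumberField K]
variable {E : Type*} [AddCommGroup E] [Module K E]
variable {F : Type*} [AddCommGroup F] [Module K F]
variable {G : Type*} [AddCommGroup G] [Module K G]

theorem isNonneg_form [FiniteDimensional K E] (A : RigidAdelicSpace K E) (γ : K →+* ℂ) :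
    (A.form γ).IsNonneg :=
  SesqForm.isNonneg_of_basis (Module.finBasis K E)
    (A.gram_posDef γ (Module.finBasis K E).linearIndependent).posSemidef

/-- A linear map that does not increase the norm at any place: it maps the lattice into the
lattice, and at the infinite places the difference of the forms is positive semidefinite. -/
structure IsContraction (A : RigidAdelicSpace K E) (B : RigidAdelicSpace K F)
    (f : E →ₗ[K] F) : Prop where
  map_mem : ∀ x ∈ A.lattice, f x ∈ B.lattice
  nonneg : ∀ γ, (A.form γ - (B.form γ).comap f).IsNonneg

theorem IsContraction.of_form_eq {A : RigidAdelicSpace K E} {B : RigidAdelicSpace K F}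
    {f : E →ₗ[K] F} (h1 : ∀ x ∈ A.lattice, f x ∈ B.lattice)
    (h2 : ∀ γ x y, B.form γ (f x) (f y) = A.form γ x y) : A.IsContraction B f := by
  refine ⟨h1, fun γ => ?_⟩
  have : A.form γ - (B.form γ).comap f = 0 := by
    ext x y
    simp [h2]
  rw [this]
  exact SesqForm.isNonneg_zero

theorem IsContraction.comp {A : RigidAdelicSpace K E} {B : RigidAdelicSpace K F}
    {C : RigidAdelicSpace K G} {f : E →ₗ[K] F} {g : F →ₗ[K] G} (hg : B.IsContraction C g)
    (hf : A.IsContraction B f) : A.IsContraction C (g ∘ₗ f) := by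
  refine ⟨fun x hx => hg.map_mem _ (hf.map_mem x hx), fun γ => ?_⟩
  have : A.form γ - (C.form γ).comap (g ∘ₗ f) =
      (A.form γ - (B.form γ).comap f) + (B.form γ - (C.form γ).comap g).comap f := by
    ext x y
    simp
  rw [this]
  exact (hf.nonneg γ).add ((hg.nonneg γ).comap f)

theorem isContraction_subtype (A : RigidAdelicSpace K E) (W : Submodule K E) :
    (A.restrict W).IsContraction A W.subtype :=
  .of_form_eq (fun _ hx => hx) fun _ _ _ => rfl

theorem isContraction_id (A : RigidAdelicSpace K E) : A.IsContraction A LinearMap.id :=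
  .of_form_eq (fun _ hx => hx) fun _ _ _ => rfl

theorem IsContraction.codRestrict {A : RigidAdelicSpace K E} {B : RigidAdelicSpace K F}
    {f : E →ₗ[K] F} (hf : A.IsContraction B f) (W : Submodule K F) (hW : ∀ x, f x ∈ W) :
    A.IsContraction (B.restrict W) (f.codRestrict W hW) :=
  ⟨hf.map_mem, hf.nonneg⟩

theorem isOKLattice_map (A : RigidAdelicSpace K E) (f : E →ₗ[K] F)
    (hf : Function.Surjective f) : IsOKLattice K (A.lattice.map f.toAddMonoidHom) where
  smul_mem a x hx := by
    obtain ⟨x, hx, rfl⟩ := hx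
    exact ⟨_, A.isLattice.smul_mem a hx, f.map_smul _ _⟩
  fg := by
    obtain ⟨S, hS⟩ := A.isLattice.fg
    classical
    refine ⟨S.image f, ?_⟩
    rw [← hS, AddMonoidHom.map_closure]
    simp
  span_eq_top := by
    have h : ((A.lattice.map f.toAddMonoidHom : AddSubgroup F) : Set F) =
      f '' (A.lattice : Set E) := rfl
    rw [h, ← Submodule.map_span, A.isLattice.span_eq_top, Submodule.map_top,
      LinearMap.range_eq_top.mpr hf]

/-- Lifting a pseudo-basis vector of the image of a lattice. -/
theorem exists_lift (A : RigidAdelicSpace K E) (f : E →ₗ[K] F) {I : FractionalIdeal (𝓞 K)⁰ K}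
    (hI : I ≠ 0) (g : F) (h : ∀ t ∈ I, ∃ x ∈ A.lattice, f x = t • g) :
    ∃ e : E, f e = g ∧ ∀ t ∈ I, t • e ∈ A.lattice := by
  have key : ∀ z ∈ I * I⁻¹, ∃ e : E, f e = z • g ∧ ∀ t ∈ I, t • e ∈ A.lattice := by
    intro z hz
    refine FractionalIdeal.mul_induction_on hz ?_ ?_
    · intro i hi j hj
      obtain ⟨x, hx, hfx⟩ := h i hi
      refine ⟨j • x, by rw [map_smul, hfx, smul_smul, mul_comm], fun t ht => ?_⟩
      have h1 : t * j ∈ I * I⁻¹ := FractionalIdeal.mul_mem_mul ht hj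
      rw [mul_inv_cancel₀ hI, FractionalIdeal.mem_one_iff] at h1
      obtain ⟨r, hr⟩ := h1
      rw [smul_smul, ← hr]
      exact A.isLattice.smul_mem r hx
    · rintro x y ⟨x', hx, hx'⟩ ⟨y', hy, hy'⟩
      exact ⟨x' + y', by rw [map_add, hx, hy, add_smul], fun t ht => by
        rw [smul_add]; exact A.lattice.add_mem (hx' t ht) (hy' t ht)⟩
  simpa using key 1 (by rw [mul_inv_cancel₀ hI]; exact FractionalIdeal.one_mem_one _)

/-- The basis of `E` composed of a basis of the kernel of a linear map `f` and the images under a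
section `s` of a basis of the target. -/
noncomputable def splitBasis {f : E →ₗ[K] F} {s : F →ₗ[K] E} (hs : ∀ y, f (s y) = y)
    {ι κ : Type*} (b : Basis ι K (LinearMap.ker f)) (g : Basis κ K F) : Basis (ι ⊕ κ) K E :=
  (b.prod g).map
    { toFun := fun p => (p.1 : E) + s p.2
      map_add' := fun p q => by simp; abel
      map_smul' := fun t p => by simp
      invFun := fun x => (⟨x - s (f x), by simp [hs]⟩, f x)
      left_inv := fun p => by ext <;> simp [hs]
      right_inv := fun x => by simp }

theorem splitBasis_inl {f : E →ₗ[K] F} {s : F →ₗ[K] E} (hs : ∀ y, f (s y) = y)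
    {ι κ : Type*} (b : Basis ι K (LinearMap.ker f)) (g : Basis κ K F) (i : ι) :
    splitBasis hs b g (Sum.inl i) = b i := by
  simp [splitBasis]

theorem splitBasis_inr {f : E →ₗ[K] F} {s : F →ₗ[K] E} (hs : ∀ y, f (s y) = y)
    {ι κ : Type*} (b : Basis ι K (LinearMap.ker f)) (g : Basis κ K F) (j : κ) :
    splitBasis hs b g (Sum.inr j) = s (g j) := by
  simp [splitBasis]

theorem splitBasis_repr_inl {f : E →ₗ[K] F} {s : F →ₗ[K] E} (hs : ∀ y, f (s y) = y)
    {ι κ : Type*} (b : Basis ι K (LinearMap.ker f)) (g : Basis κ K F) (x : E) (i : ι) :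
    (splitBasis hs b g).repr x (Sum.inl i) = b.repr ⟨x - s (f x), by simp [hs]⟩ i := by
  simp [splitBasis]

theorem splitBasis_repr_inr {f : E →ₗ[K] F} {s : F →ₗ[K] E} (hs : ∀ y, f (s y) = y)
    {ι κ : Type*} (b : Basis ι K (LinearMap.ker f)) (g : Basis κ K F) (x : E) (j : κ) :
    (splitBasis hs b g).repr x (Sum.inr j) = g.repr (f x) j := by
  simp [splitBasis]

variable [FiniteDimensional K E] [FiniteDimensional K F]

/-- The height of a space is at least the product of the heights of the kernel and the target of a
surjective contraction: the quotient norms dominate the norms of the target. -/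
theorem IsContraction.height_ker_mul_le {A : RigidAdelicSpace K E} {B : RigidAdelicSpace K F}
    {f : E →ₗ[K] F} (hf : A.IsContraction B f) (hs : Function.Surjective f) :
    (A.restrict (LinearMap.ker f)).height * B.height ≤ A.height := by
  obtain ⟨a, b, hab, hH⟩ := (A.restrict (LinearMap.ker f)).exists_isPseudoBasis
  let M : AddSubgroup F := A.lattice.map f.toAddMonoidHom
  obtain ⟨⟨c, g, hcg⟩⟩ := (A.isOKLattice_map f hs).nonempty_pseudoBasis
  have hc : ∀ j, c j ≠ 0 := by
    let B' : RigidAdelicSpace K F := { B with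
      lattice := M
      isLattice := A.isOKLattice_map f hs }
    have : B'.IsPseudoBasis c g := hcg
    exact this.ideal_ne_zero
  have hcg' : ∀ j, ∀ t ∈ c j, t • g j ∈ M := by
    intro j t ht
    refine (hcg _).mpr fun k => ?_
    rw [map_smul, Basis.repr_self, Finsupp.smul_apply, Finsupp.single_apply]
    split_ifs with hjk
    · subst hjk; simpa using ht
    · rw [smul_zero]; exact (c k).1.zero_mem
  choose e hfe he using fun j => A.exists_lift f (hc j) (g j) (hcg' j)
  let s : F →ₗ[K] E := g.constr K e
  have hsg : ∀ j, s (g j) = e j := fun j => g.constr_basis K e j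
  have hfs : ∀ y, f (s y) = y := by
    intro y
    have : f ∘ₗ s = LinearMap.id := g.ext fun j => by simp [hsg, hfe]
    exact LinearMap.congr_fun this y
  have hsM : ∀ y ∈ M, s y ∈ A.lattice := by
    intro y hy
    rw [← g.sum_repr y, map_sum]
    refine sum_mem fun j _ => ?_
    rw [map_smul, hsg]
    exact he j _ ((hcg y).mp hy j)
  let β := splitBasis hfs b g
  have hβ : A.IsPseudoBasis (Sum.elim a c) β := by
    intro x
    rw [Sum.forall]
    simp only [Sum.elim_inl, Sum.elim_inr, β, splitBasis_repr_inl, splitBasis_repr_inr]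
    rw [← hab, ← hcg]
    constructor
    · intro hx
      have h1 : f x ∈ M := ⟨x, hx, rfl⟩
      exact ⟨A.lattice.sub_mem hx (hsM _ h1), h1⟩
    · rintro ⟨h1, h2⟩
      have := A.lattice.add_mem h1 (hsM _ h2)
      simpa using this
  have hBle := B.height_le c g hc fun j t ht => by
    obtain ⟨x, hx, hx'⟩ := hcg' j t ht
    rw [← hx']
    exact hf.map_mem x hx
  have hpv : (A.restrict (LinearMap.ker f)).pseudoVolume a b * B.pseudoVolume c g ≤
      A.pseudoVolume (Sum.elim a c) β := by
    rw [pseudoVolume, pseudoVolume, pseudoVolume, Fintype.prod_sum_type]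
    simp only [Sum.elim_inl, Sum.elim_inr, map_mul, Rat.cast_mul]
    have h0 : ∀ (I : FractionalIdeal (𝓞 K)⁰ K), (0 : ℝ) ≤ FractionalIdeal.absNorm I := fun I => by
      exact_mod_cast FractionalIdeal.absNorm_nonneg I
    rw [mul_mul_mul_comm]
    refine mul_le_mul_of_nonneg_left ?_ (mul_nonneg (h0 _) (h0 _))
    rw [← Finset.prod_mul_distrib]
    refine Finset.prod_le_prod (fun γ _ => mul_nonneg
      (Real.rpow_nonneg (det_gram_pos _ γ b.linearIndependent).le _)
      (Real.rpow_nonneg (det_gram_pos _ γ g.linearIndependent).le _)) fun γ _ => ?_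
    rw [← Real.mul_rpow (det_gram_pos _ γ b.linearIndependent).le
      (det_gram_pos _ γ g.linearIndependent).le]
    refine Real.rpow_le_rpow (mul_nonneg (det_gram_pos _ γ b.linearIndependent).le
      (det_gram_pos _ γ g.linearIndependent).le) ?_ (by norm_num)
    have hherm : ((A.form γ).gram β).IsHermitian := (A.gram_posDef γ β.linearIndependent).1
    have hblock : (A.form γ).gram β = Matrix.fromBlocks
        (((A.restrict (LinearMap.ker f)).form γ).gram b)
        (Matrix.of fun i j => A.form γ (b i) (e j))
        (Matrix.of fun i j => A.form γ (b i) (e j)).conjTranspose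
        ((A.form γ).gram e) := by
      ext (i | i) (j | j)
      · simp [SesqForm.gram, β, splitBasis_inl]; rfl
      · simp [SesqForm.gram, β, splitBasis_inl, splitBasis_inr, hsg]
      · rw [← hherm.apply]
        simp [SesqForm.gram, β, splitBasis_inl, splitBasis_inr, hsg]
      · simp [SesqForm.gram, β, splitBasis_inr, hsg]
    rw [hblock]
    refine Matrix.PosDef.det_mul_det_le_det_fromBlocks
      (gram_posDef _ γ b.linearIndependent) _ _ (B.gram_posDef γ g.linearIndependent) ?_
    have hD := (hf.nonneg γ).gram β
    rw [SesqForm.gram_sub, SesqForm.gram_comap, hblock] at hD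
    convert hD using 1
    ext (i | i) (j | j)
    · simp [SesqForm.gram, β, splitBasis_inl]
    · simp [SesqForm.gram, β, splitBasis_inl]
    · simp [SesqForm.gram, β, splitBasis_inl]
    · simp [SesqForm.gram, β, splitBasis_inr, hfs]
  rw [hβ.height_eq, hH]
  have h0 := ((A.restrict (LinearMap.ker f)).pseudoVolume_pos hab.ideal_ne_zero
    b.linearIndependent).le
  have h1 := (B.pseudoVolume_pos hc g.linearIndependent).le
  refine (mul_le_mul_of_nonneg_left hBle (Real.rpow_nonneg h0 _)).trans ?_
  rw [← Real.mul_rpow h0 h1]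
  exact Real.rpow_le_rpow (mul_nonneg h0 h1) hpv (by positivity)

theorem IsContraction.height_range_le {A : RigidAdelicSpace K E} {B : RigidAdelicSpace K F}
    {f : E →ₗ[K] F} (hf : A.IsContraction B f) (hi : Function.Injective f) :
    (B.restrict (LinearMap.range f)).height ≤ A.height := by
  have h1 := (hf.codRestrict (LinearMap.range f) (LinearMap.mem_range_self f)).height_ker_mul_le
    f.surjective_rangeRestrict
  have : Subsingleton (LinearMap.ker (f.codRestrict (LinearMap.range f)
      (LinearMap.mem_range_self f))) := by
    rw [LinearMap.ker_codRestrict, LinearMap.ker_eq_bot.mpr hi]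
    infer_instance
  rwa [height_eq_one, one_mul] at h1

theorem IsContraction.height_le {A : RigidAdelicSpace K E} {B : RigidAdelicSpace K F}
    {f : E →ₗ[K] F} (hf : A.IsContraction B f) (hb : Function.Bijective f) :
    B.height ≤ A.height := by
  have h1 := hf.height_ker_mul_le hb.2
  have : Subsingleton (LinearMap.ker f) := by
    rw [LinearMap.ker_eq_bot.mpr hb.1]
    infer_instance
  rwa [height_eq_one, one_mul] at h1

/-- The heights of all subspaces `W` are at least `m ^ dim W`. If `E ≠ 0` and `0 ≤ m`, this means
that `m` is at most the minimal height. -/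
def HeightBound (A : RigidAdelicSpace K E) (m : ℝ) : Prop :=
  ∀ W : Submodule K E, m ^ finrank K W ≤ (A.restrict W).height

theorem HeightBound.of_injective {A : RigidAdelicSpace K E} {B : RigidAdelicSpace K F} {m : ℝ}
    (hB : B.HeightBound m) {f : E →ₗ[K] F} (hf : A.IsContraction B f)
    (hi : Function.Injective f) : A.HeightBound m := by
  intro W
  have hi' : Function.Injective (f ∘ₗ W.subtype) := hi.comp W.subtype_injective
  have h1 := (hf.comp (A.isContraction_subtype W)).height_range_le hi'
  rw [← LinearMap.finrank_range_of_inj hi']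
  exact (hB _).trans h1

theorem HeightBound.le_height {A : RigidAdelicSpace K E} {m : ℝ} (hA : A.HeightBound m) :
    m ^ finrank K E ≤ A.height := by
  have h1 := A.isContraction_id.height_range_le Function.injective_id
  have h2 := hA (LinearMap.range (LinearMap.id : E →ₗ[K] E))
  rw [LinearMap.finrank_range_of_inj Function.injective_id] at h2
  exact h2.trans h1

theorem HeightBound.of_ker {A : RigidAdelicSpace K E} {B : RigidAdelicSpace K F} {m : ℝ}
    (hm : 0 ≤ m) {f : E →ₗ[K] F} (hf : A.IsContraction B f)
    (hk : (A.restrict (LinearMap.ker f)).HeightBound m) (hB : B.HeightBound m) :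
    A.HeightBound m := by
  intro W
  let g := f ∘ₗ W.subtype
  have hg : (A.restrict W).IsContraction B g := hf.comp (A.isContraction_subtype W)
  have h1 := (hg.codRestrict (LinearMap.range g) (LinearMap.mem_range_self g)).height_ker_mul_le
    g.surjective_rangeRestrict
  rw [LinearMap.ker_codRestrict] at h1
  let i : LinearMap.ker g →ₗ[K] LinearMap.ker f :=
    (W.subtype ∘ₗ (LinearMap.ker g).subtype).codRestrict _ fun x => x.2
  have hi : Function.Injective i := by
    intro x y h
    have := congrArg Subtype.val h
    exact Subtype.ext (Subtype.ext this)
  have hic : ((A.restrict W).restrict (LinearMap.ker g)).IsContraction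
      (A.restrict (LinearMap.ker f)) i :=
    ((A.isContraction_subtype W).comp ((A.restrict W).isContraction_subtype _)).codRestrict _ _
  have h2 := (hk.of_injective hic hi).le_height
  have h3 := hB (LinearMap.range g)
  rw [← g.finrank_range_add_finrank_ker, pow_add, mul_comm]
  exact (mul_le_mul h2 h3 (pow_nonneg hm _) ((height_pos _).le)).trans h1

end RigidAdelicSpace

/-! ### Duality -/

section

open scoped Matrix

/-- The two Schur complements of the block matrix with diagonal blocks `A` and `B⁻¹`. -/
theorem Matrix.PosDef.posSemidef_inv_sub {m n : Type*} [Fintype m] [Fintype n] [DecidableEq m]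
    [DecidableEq n] {A : Matrix m m ℂ} {B : Matrix n n ℂ} (hA : A.PosDef) (hB : B.PosDef)
    (M : Matrix n m ℂ) (h : (A - Mᴴ * B * M).PosSemidef) :
    (B⁻¹ - M * A⁻¹ * Mᴴ).PosSemidef := by
  have : Invertible A := hA.isUnit.invertible
  have : Invertible B⁻¹ := hB.inv.isUnit.invertible
  have h1 := Matrix.PosDef.fromBlocks₁₁ Mᴴ B⁻¹ hA
  have h2 := Matrix.PosDef.fromBlocks₂₂ A Mᴴ hB.inv
  rw [Matrix.conjTranspose_conjTranspose] at h1 h2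
  rw [Matrix.nonsing_inv_nonsing_inv _ ((Matrix.isUnit_iff_isUnit_det _).mp hB.isUnit)] at h2
  exact h1.mp (h2.mpr h)

end

namespace SesqForm

variable {K : Type u} [Field K] [NumberField K]
variable {E : Type*} [AddCommGroup E] [Module K E]
variable {γ : K →+* ℂ}

theorem ext_basis {h h' : SesqForm γ E} {ι : Type*} (b : Basis ι K E)
    (H : ∀ i j, h (b i) (b j) = h' (b i) (b j)) : h = h' :=
  b.ext fun i => b.ext fun j => H i j

open scoped Matrix in
theorem gram_dual (h : SesqForm γ E) {ι κ : Type*} [Fintype ι] [DecidableEq ι] [Fintype κ]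
    [DecidableEq κ] (b : Basis ι K E) (hb : IsUnit (h.gram b).det) (c : Basis κ K E) :
    (h.dual b).gram c.dualBasis = (h.gram c)⁻¹ᵀ := by
  set R := c.toMatrix b with hR
  set P := b.toMatrix c with hP
  have hRP : R.map γ * P.map γ = 1 := by
    rw [← Matrix.map_mul, hR, hP, c.toMatrix_mul_toMatrix_flip b,
      Matrix.map_one _ (map_zero γ) (map_one γ)]
  have hPR : P.map γ * R.map γ = 1 := by
    rw [← Matrix.map_mul, hR, hP, b.toMatrix_mul_toMatrix_flip c,
      Matrix.map_one _ (map_zero γ) (map_one γ)]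
  have hQ : b.dualBasis.toMatrix c.dualBasis = Rᵀ := by
    ext i k
    rw [Basis.toMatrix_apply, Basis.dualBasis_repr, Basis.dualBasis_apply, Matrix.transpose_apply,
      hR, Basis.toMatrix_apply]
  have hinv : (h.gram c)⁻¹ = R.map γ * (h.gram b)⁻¹ * (R.map γ)ᴴ := by
    refine Matrix.inv_eq_left_inv ?_
    have h1 : (R.map γ)ᴴ * (P.map γ)ᴴ = 1 := by
      rw [← Matrix.conjTranspose_mul, hPR, Matrix.conjTranspose_one]
    calc R.map γ * (h.gram b)⁻¹ * (R.map γ)ᴴ * h.gram c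
        = R.map γ * (h.gram b)⁻¹ * ((R.map γ)ᴴ * (P.map γ)ᴴ) * h.gram b * P.map γ := by
          rw [h.gram_eq_of_basis b c]; simp only [Matrix.mul_assoc, hP]
      _ = R.map γ * ((h.gram b)⁻¹ * h.gram b) * P.map γ := by
          rw [h1, Matrix.mul_one]; simp only [Matrix.mul_assoc]
      _ = 1 := by rw [Matrix.nonsing_inv_mul _ hb, Matrix.mul_one, hRP]
  rw [SesqForm.gram_eq_of_basis _ b.dualBasis c.dualBasis, hQ, SesqForm.gram_dualBasis, hinv,
    Matrix.transpose_mul, Matrix.transpose_mul, Matrix.mul_assoc]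
  rfl

end SesqForm

theorem Module.Basis.dualBasis_dualBasis_eq {K : Type*} [Field K] {E : Type*} [AddCommGroup E]
    [Module K E] {ι : Type*} [Fintype ι] [DecidableEq ι] (b : Basis ι K E) (i : ι) :
    b.dualBasis.dualBasis i = Dual.eval K E (b i) := by
  refine b.dualBasis.ext fun j => ?_
  rw [Basis.dualBasis_apply_self, Dual.eval_apply, Basis.dualBasis_apply_self]
  simp [eq_comm]

namespace RigidAdelicSpace

variable {K : Type u} [Field K] [NumberField K]
variable {E : Type*} [AddCommGroup E] [Module K E] [FiniteDimensional K E]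
variable {F : Type*} [AddCommGroup F] [Module K F] [FiniteDimensional K F]

open scoped Matrix in
theorem gram_dual (A : RigidAdelicSpace K E) (γ : K →+* ℂ) {ι : Type*} [Fintype ι]
    [DecidableEq ι] (b : Basis ι K E) :
    (A.dual.form γ).gram b.dualBasis = ((A.form γ).gram b)⁻¹ᵀ :=
  SesqForm.gram_dual _ _ ((Matrix.isUnit_iff_isUnit_det _).mp
    (A.gram_posDef γ (Module.finBasis K E).linearIndependent).isUnit) _

theorem IsPseudoBasis.dual {A : RigidAdelicSpace K E} {ι : Type*} [Fintype ι] [DecidableEq ι]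
    {a : ι → FractionalIdeal (𝓞 K)⁰ K} {b : Basis ι K E} (h : A.IsPseudoBasis a b) :
    A.dual.IsPseudoBasis (fun i => (a i)⁻¹) b.dualBasis := by
  intro φ
  simp only [Basis.dualBasis_repr, FractionalIdeal.mem_inv_iff (h.ideal_ne_zero _),
    FractionalIdeal.mem_one_iff]
  constructor
  · intro hφ i t ht
    obtain ⟨r, hr⟩ := hφ _ (h.smul_mem ht)
    exact ⟨r, by rw [hr, map_smul, smul_eq_mul, mul_comm]⟩
  · intro hφ x hx
    rw [← b.sum_repr x, map_sum]
    refine sum_mem fun i _ => ?_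
    obtain ⟨r, hr⟩ := hφ i _ ((h x).mp hx i)
    exact ⟨r, by rw [hr, map_smul, smul_eq_mul, mul_comm]⟩

theorem height_dual (A : RigidAdelicSpace K E) : A.dual.height = A.height⁻¹ := by
  obtain ⟨a, b, h, hH⟩ := A.exists_isPseudoBasis
  have hpos := A.pseudoVolume_pos h.ideal_ne_zero b.linearIndependent
  rw [hH, h.dual.height_eq, ← Real.inv_rpow hpos.le]
  congr 1
  rw [pseudoVolume, pseudoVolume, mul_inv, Finset.prod_inv_distrib, map_inv₀, Rat.cast_inv,
    ← Finset.prod_inv_distrib]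
  congr 1
  refine Finset.prod_congr rfl fun γ _ => ?_
  have h1 := A.gram_posDef γ b.linearIndependent
  obtain ⟨h2, h3⟩ := Complex.pos_iff.mp h1.det_pos
  rw [← Real.inv_rpow h2.le, gram_dual, Matrix.det_transpose, Matrix.det_nonsing_inv,
    Ring.inverse_eq_inv']
  congr 1
  have h4 : ((A.form γ).gram b).det = (((A.form γ).gram b).det.re : ℂ) :=
    Complex.ext rfl (by simp [← h3])
  rw [h4, ← Complex.ofReal_inv, Complex.ofReal_re, Complex.ofReal_re]

theorem IsContraction.dualMap {A : RigidAdelicSpace K E} {B : RigidAdelicSpace K F}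
    {f : E →ₗ[K] F} (hf : A.IsContraction B f) : B.dual.IsContraction A.dual f.dualMap := by
  refine ⟨fun φ hφ x hx => hφ _ (hf.map_mem x hx), fun γ => ?_⟩
  let b := Module.finBasis K E
  let c := Module.finBasis K F
  let M := c.toMatrix (f ∘ b)
  refine SesqForm.isNonneg_of_basis c.dualBasis ?_
  have h1 : (f.dualMap ∘ c.dualBasis) =
      fun k => ∑ i, M.transpose i k • b.dualBasis i := by
    funext k
    refine b.ext fun j => ?_
    simp [M, Basis.toMatrix_apply, LinearMap.sum_apply, Finsupp.single_apply]
  have h2 := (hf.nonneg γ).gram b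
  rw [SesqForm.gram_sub, SesqForm.gram_comap, SesqForm.gram_eq_of_basis _ c (f ∘ b)] at h2
  have h3 := (A.gram_posDef γ b.linearIndependent).posSemidef_inv_sub
    (B.gram_posDef γ c.linearIndependent) _ h2
  have h4 : (B.dual.form γ - (A.dual.form γ).comap f.dualMap).gram c.dualBasis =
      (((B.form γ).gram c)⁻¹ - M.map γ * ((A.form γ).gram b)⁻¹ *
        (M.map γ).conjTranspose).transpose := by
    rw [SesqForm.gram_sub, SesqForm.gram_comap, h1, SesqForm.gram_sum, gram_dual, gram_dual,
      Matrix.transpose_sub, Matrix.transpose_mul, Matrix.transpose_mul, Matrix.mul_assoc]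
    rfl
  rw [h4]
  exact h3.transpose

theorem isContraction_eval (A : RigidAdelicSpace K E) :
    A.IsContraction A.dual.dual (Dual.eval K E) := by
  refine .of_form_eq (fun x hx φ hφ => hφ x hx) fun γ => ?_
  have h1 : (A.dual.dual.form γ).comap (Dual.eval K E) = A.form γ := by
    let b := Module.finBasis K E
    refine SesqForm.ext_basis b fun i j => ?_
    rw [SesqForm.comap_apply, ← Basis.dualBasis_dualBasis_eq, ← Basis.dualBasis_dualBasis_eq,
      ← SesqForm.gram_apply, gram_dual, gram_dual, ← Matrix.transpose_nonsing_inv,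
      Matrix.transpose_transpose, Matrix.nonsing_inv_nonsing_inv]
    · rfl
    · exact (Matrix.isUnit_iff_isUnit_det _).mp (A.gram_posDef γ b.linearIndependent).isUnit
  intro x y
  rw [← h1]
  rfl

/-- Evaluation on a subspace `U` of the dual space is a contraction onto the dual of `U`. -/
theorem isContraction_evalOn (A : RigidAdelicSpace K E) (U : Submodule K (Dual K E)) :
    A.IsContraction (A.dual.restrict U).dual (U.subtype.dualMap ∘ₗ Dual.eval K E) :=
  (A.dual.isContraction_subtype U).dualMap.comp A.isContraction_eval

theorem dualMap_subtype_surjective (U : Submodule K E) :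
    Function.Surjective U.subtype.dualMap :=
  LinearMap.dualMap_surjective_of_injective U.subtype_injective

theorem evalOn_surjective (U : Submodule K (Dual K E)) :
    Function.Surjective (U.subtype.dualMap ∘ₗ Dual.eval K E) :=
  Function.Surjective.comp (g := U.subtype.dualMap) (dualMap_subtype_surjective U)
    (bijective_dual_eval K E).2

theorem ker_evalOn (U : Submodule K (Dual K E)) :
    LinearMap.ker (U.subtype.dualMap ∘ₗ Dual.eval K E) = U.dualCoannihilator := by
  ext x
  simp only [LinearMap.mem_ker, Submodule.mem_dualCoannihilator, LinearMap.ext_iff]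
  exact ⟨fun h φ hφ => h ⟨φ, hφ⟩, fun h φ => h φ φ.2⟩

theorem height_dualCoannihilator_le (A : RigidAdelicSpace K E) (U : Submodule K (Dual K E)) :
    (A.restrict U.dualCoannihilator).height ≤ A.height * (A.dual.restrict U).height := by
  have h := (A.isContraction_evalOn U).height_ker_mul_le (evalOn_surjective U)
  rw [ker_evalOn, height_dual, ← div_eq_mul_inv, div_le_iff₀ (height_pos _)] at h
  exact h

theorem height_dualAnnihilator_mul_le (A : RigidAdelicSpace K E) (W : Submodule K E) :
    A.height * (A.dual.restrict W.dualAnnihilator).height ≤ (A.restrict W).height := by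
  have h := (A.isContraction_subtype W).dualMap.height_ker_mul_le (dualMap_subtype_surjective W)
  have h1 : LinearMap.ker W.subtype.dualMap = W.dualAnnihilator :=
    W.dualRestrict_ker_eq_dualAnnihilator
  rw [h1, height_dual, height_dual, ← div_eq_mul_inv, div_le_iff₀ (height_pos _),
    inv_mul_eq_div, le_div_iff₀ (height_pos _), mul_comm] at h
  exact h

/-- To a subspace `Y` of the dual of a subspace `W` belongs the annihilator of `Y` in `W`. -/
theorem exists_height_le_of_dual_restrict (A : RigidAdelicSpace K E) (W : Submodule K E)
    (Y : Submodule K (Dual K W)) :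
    ∃ T : Submodule K E, finrank K T + finrank K Y = finrank K W ∧ (A.restrict T).height ≤
      (A.restrict W).height * ((A.restrict W).dual.restrict Y).height := by
  let Z := Y.dualCoannihilator
  let g := W.subtype ∘ₗ Z.subtype
  have hg : Function.Injective g := W.subtype_injective.comp Z.subtype_injective
  have hgc : ((A.restrict W).restrict Z).IsContraction A g :=
    (A.isContraction_subtype W).comp ((A.restrict W).isContraction_subtype Z)
  refine ⟨LinearMap.range g, ?_, ?_⟩
  · rw [LinearMap.finrank_range_of_inj hg, add_comm]
    exact Subspace.finrank_add_finrank_dualCoannihilator_eq Y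
  · exact (hgc.height_range_le hg).trans ((A.restrict W).height_dualCoannihilator_le Y)

/-- The space `(W^⊥)^∨`, where `W^⊥ ⊆ E^∨` is the annihilator of `W`, plays the role of the
quotient of `E` by `W`. To a subspace of this quotient belongs a subspace of `E` containing `W`. -/
theorem exists_height_le_of_quotient (A : RigidAdelicSpace K E) (W : Submodule K E)
    (Y : Submodule K (Dual K W.dualAnnihilator)) :
    ∃ V : Submodule K E, finrank K V = finrank K W + finrank K Y ∧ (A.restrict V).height ≤
      (A.restrict W).height * ((A.dual.restrict W.dualAnnihilator).dual.restrict Y).height := by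
  obtain ⟨T, hT, hT'⟩ := A.dual.exists_height_le_of_dual_restrict W.dualAnnihilator Y
  refine ⟨T.dualCoannihilator, ?_, ?_⟩
  · have h1 := Subspace.finrank_add_finrank_dualCoannihilator_eq T
    have h3 := Subspace.finrank_add_finrank_dualAnnihilator_eq W
    omega
  · have h1 := A.height_dualCoannihilator_le T
    have h4 := A.height_dualAnnihilator_mul_le W
    calc _ ≤ _ := h1
      _ ≤ _ := mul_le_mul_of_nonneg_left hT' A.height_pos.le
      _ = A.height * (A.dual.restrict W.dualAnnihilator).height *
        ((A.dual.restrict W.dualAnnihilator).dual.restrict Y).height := by ring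
      _ ≤ _ := mul_le_mul_of_nonneg_right h4 (height_pos _).le

/-- If the slopes of `E` are at least `m` with equality for `E` itself, then the slopes of the dual
space are at least `m⁻¹`. -/
theorem HeightBound.dual {A : RigidAdelicSpace K E} {m : ℝ} (hm : 0 < m) (hA : A.HeightBound m)
    (h : A.height = m ^ finrank K E) : A.dual.HeightBound m⁻¹ := by
  intro U
  have h1 := (hA _).trans (A.height_dualCoannihilator_le U)
  rw [h, ← Subspace.finrank_add_finrank_dualCoannihilator_eq U, pow_add, mul_right_comm] at h1
  have h2 := le_of_mul_le_mul_right ((one_mul _).trans_le h1) (pow_pos hm _)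
  rw [inv_pow]
  exact (inv_le_iff_one_le_mul₀' (pow_pos hm _)).mpr h2

end RigidAdelicSpace

/-! ### Tensor products -/

theorem SesqForm.gram_tensor {K : Type u} [Field K] [NumberField K]
    {E : Type*} [AddCommGroup E] [Module K E] {F : Type*} [AddCommGroup F] [Module K F]
    {γ : K →+* ℂ} (h : SesqForm γ E) (h' : SesqForm γ F) {ι κ : Type*} [Fintype ι] [Fintype κ]
    (b : Basis ι K E) (c : Basis κ K F) :
    (h.tensor h').gram (b.tensorProduct c) =
      Matrix.kroneckerMap (fun s t => s * t) (h.gram b) (h'.gram c) := by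
  ext ⟨i, j⟩ ⟨i', j'⟩
  simp [SesqForm.gram, Basis.tensorProduct_apply]

namespace RigidAdelicSpace

variable {K : Type u} [Field K] [NumberField K]
variable {E : Type*} [AddCommGroup E] [Module K E] [FiniteDimensional K E]
variable {F : Type*} [AddCommGroup F] [Module K F] [FiniteDimensional K F]
variable {E' : Type*} [AddCommGroup E'] [Module K E'] [FiniteDimensional K E']
variable {F' : Type*} [AddCommGroup F'] [Module K F'] [FiniteDimensional K F']

theorem tensor_form_tmul (A : RigidAdelicSpace K E) (B : RigidAdelicSpace K F) (γ : K →+* ℂ)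
    (x x' : E) (y y' : F) :
    (A.tensor B).form γ (x ⊗ₜ y) (x' ⊗ₜ y') = A.form γ x x' * B.form γ y y' := rfl

theorem _root_.SesqForm.IsNonneg.tensor {γ : K →+* ℂ} {h : SesqForm γ E} {h' : SesqForm γ F}
    (hh : h.IsNonneg) (hh' : h'.IsNonneg) : (h.tensor h').IsNonneg := by
  refine SesqForm.isNonneg_of_basis
    ((Module.finBasis K E).tensorProduct (Module.finBasis K F)) ?_
  rw [SesqForm.gram_tensor]
  exact (hh.gram _).kronecker (hh'.gram _)

theorem IsContraction.tensor {A : RigidAdelicSpace K E} {B : RigidAdelicSpace K F}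
    {A' : RigidAdelicSpace K E'} {B' : RigidAdelicSpace K F'} {f : E →ₗ[K] E'} {g : F →ₗ[K] F'}
    (hf : A.IsContraction A' f) (hg : B.IsContraction B' g) :
    (A.tensor B).IsContraction (A'.tensor B') (TensorProduct.map f g) := by
  refine ⟨fun z hz => ?_, fun γ => ?_⟩
  · change z ∈ tensorLattice K A.lattice B.lattice at hz
    induction hz using AddSubgroup.closure_induction with
    | mem z hz =>
      obtain ⟨x, hx, y, hy, rfl⟩ := hz
      exact AddSubgroup.subset_closure ⟨f x, hf.map_mem x hx, g y, hg.map_mem y hy, rfl⟩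
    | zero => rw [map_zero]; exact zero_mem _
    | add x y _ _ hx hy => rw [map_add]; exact add_mem hx hy
    | neg x _ hx => rw [map_neg]; exact neg_mem hx
  · have h : (A.tensor B).form γ - ((A'.tensor B').form γ).comap (TensorProduct.map f g) =
        (A.form γ - (A'.form γ).comap f).tensor (B.form γ) +
          ((A'.form γ).comap f).tensor (B.form γ - (B'.form γ).comap g) := by
      refine SesqForm.ext_basis
        ((Module.finBasis K E).tensorProduct (Module.finBasis K F)) fun ⟨i, j⟩ ⟨k, l⟩ => ?_
      simp only [Basis.tensorProduct_apply, LinearMap.sub_apply, LinearMap.add_apply,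
        SesqForm.comap_apply, TensorProduct.map_tmul, SesqForm.tensor_tmul, tensor_form_tmul]
      ring
    rw [h]
    exact ((hf.nonneg γ).tensor (B.isNonneg_form γ)).add
      (((A'.isNonneg_form γ).comap f).tensor (hg.nonneg γ))

theorem isContraction_comm (A : RigidAdelicSpace K E) (B : RigidAdelicSpace K F) :
    (A.tensor B).IsContraction (B.tensor A) (TensorProduct.comm K E F).toLinearMap := by
  refine .of_form_eq (fun z hz => ?_) fun γ => ?_
  · change z ∈ tensorLattice K A.lattice B.lattice at hz
    induction hz using AddSubgroup.closure_induction with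
    | mem z hz =>
      obtain ⟨x, hx, y, hy, rfl⟩ := hz
      exact AddSubgroup.subset_closure ⟨y, hy, x, hx, rfl⟩
    | zero => rw [map_zero]; exact zero_mem _
    | add x y _ _ hx hy => rw [map_add]; exact add_mem hx hy
    | neg x _ hx => rw [map_neg]; exact neg_mem hx
  · have h : ((B.tensor A).form γ).comap (TensorProduct.comm K E F).toLinearMap =
        (A.tensor B).form γ := by
      refine SesqForm.ext_basis
        ((Module.finBasis K E).tensorProduct (Module.finBasis K F)) fun ⟨i, j⟩ ⟨k, l⟩ => ?_
      simp only [Basis.tensorProduct_apply, SesqForm.comap_apply, LinearEquiv.coe_coe,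
        TensorProduct.comm_tmul, tensor_form_tmul]
      ring
    intro x y
    rw [← h]
    rfl

theorem height_tensor_le (A : RigidAdelicSpace K E) (B : RigidAdelicSpace K F) :
    (A.tensor B).height ≤ A.height ^ finrank K F * B.height ^ finrank K E := by
  obtain ⟨a, b, hA, hHA⟩ := A.exists_isPseudoBasis
  obtain ⟨c, e, hB, hHB⟩ := B.exists_isPseudoBasis
  have h1 := (A.tensor B).height_le (fun p : Fin (finrank K E) × Fin (finrank K F) => a p.1 * c p.2)
    (b.tensorProduct e) (fun p => mul_ne_zero (hA.ideal_ne_zero _) (hB.ideal_ne_zero _))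
    (fun p t ht => by
      rw [Basis.tensorProduct_apply]
      refine FractionalIdeal.mul_induction_on ht ?_ ?_
      · intro s hs t ht
        rw [← TensorProduct.smul_tmul_smul]
        exact AddSubgroup.subset_closure ⟨_, hA.smul_mem hs, _, hB.smul_mem ht, rfl⟩
      · intro s t hs ht
        rw [add_smul]
        exact add_mem hs ht)
  refine h1.trans_eq ?_
  have hposA := (A.pseudoVolume_pos hA.ideal_ne_zero b.linearIndependent).le
  have hposB := (B.pseudoVolume_pos hB.ideal_ne_zero e.linearIndependent).le
  rw [hHA, hHB, Real.rpow_pow_comm hposA, Real.rpow_pow_comm hposB,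
    ← Real.mul_rpow (pow_nonneg hposA _) (pow_nonneg hposB _)]
  congr 1
  rw [pseudoVolume, pseudoVolume, pseudoVolume, mul_pow, mul_pow, mul_mul_mul_comm]
  congr 1
  · rw [Finset.prod_mul_distrib, Fintype.prod_prod_type, Fintype.prod_prod_type]
    simp [Finset.prod_pow]
  · rw [← Finset.prod_pow, ← Finset.prod_pow, ← Finset.prod_mul_distrib]
    refine Finset.prod_congr rfl fun γ _ => ?_
    have hA0 := A.det_gram_pos γ b.linearIndependent
    have hB0 := B.det_gram_pos γ e.linearIndependent
    have hA1 : ((A.form γ).gram b).det = (((A.form γ).gram b).det.re : ℂ) :=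
      Complex.ext rfl (by
        simp [← (Complex.pos_iff.mp (A.gram_posDef γ b.linearIndependent).det_pos).2])
    have hB1 : ((B.form γ).gram e).det = (((B.form γ).gram e).det.re : ℂ) :=
      Complex.ext rfl (by
        simp [← (Complex.pos_iff.mp (B.gram_posDef γ e.linearIndependent).det_pos).2])
    rw [Real.rpow_pow_comm hA0.le, Real.rpow_pow_comm hB0.le,
      ← Real.mul_rpow (pow_nonneg hA0.le _) (pow_nonneg hB0.le _)]
    congr 1
    have h2 : ((A.tensor B).form γ).gram (b.tensorProduct e) = _ :=
      SesqForm.gram_tensor (A.form γ) (B.form γ) b e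
    rw [h2, Matrix.det_kronecker, Fintype.card_fin, Fintype.card_fin, hA1, hB1]
    norm_cast

/-- The coordinate in `E` of an element of `E ⊗ F` with respect to a basis vector of `F`. -/
noncomputable def tensorCoord (E : Type*) [AddCommGroup E] [Module K E] {κ : Type*}
    (e : Basis κ K F) (j : κ) : E ⊗[K] F →ₗ[K] E :=
  (TensorProduct.rid K E).toLinearMap ∘ₗ LinearMap.lTensor E (e.coord j)

@[simp]
theorem tensorCoord_tmul {κ : Type*} (e : Basis κ K F) (j : κ) (x : E) (y : F) :
    tensorCoord E e j (x ⊗ₜ y) = e.repr y j • x := by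
  simp [tensorCoord]

theorem sum_tensorCoord {κ : Type*} [Fintype κ] (e : Basis κ K F) (z : E ⊗[K] F) :
    ∑ j, tensorCoord E e j z ⊗ₜ[K] e j = z := by
  induction z using TensorProduct.induction_on with
  | zero => simp
  | add x y hx hy =>
    simp only [map_add, TensorProduct.add_tmul, Finset.sum_add_distrib, hx, hy]
  | tmul x y =>
    simp only [tensorCoord_tmul, TensorProduct.smul_tmul]
    rw [← TensorProduct.tmul_sum, e.sum_repr]

/-- An element of `E ⊗ F` belongs to the lattice if and only if its coordinate at each basis vector
of `F` lies in the corresponding multiple of the lattice of `E`. -/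
theorem mem_tensor_iff (A : RigidAdelicSpace K E) {B : RigidAdelicSpace K F} {κ : Type*}
    [Fintype κ] {c : κ → FractionalIdeal (𝓞 K)⁰ K} {e : Basis κ K F} (hB : B.IsPseudoBasis c e)
    (z : E ⊗[K] F) :
    z ∈ (A.tensor B).lattice ↔ ∀ j, ∀ t ∈ (c j)⁻¹, t • tensorCoord E e j z ∈ A.lattice := by
  constructor
  · intro hz j t ht
    change z ∈ tensorLattice K A.lattice B.lattice at hz
    induction hz using AddSubgroup.closure_induction with
    | mem z hz =>
      obtain ⟨x, hx, y, hy, rfl⟩ := hz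
      have h1 := (FractionalIdeal.mem_inv_iff (hB.ideal_ne_zero j)).mp ht _ ((hB y).mp hy j)
      obtain ⟨r, hr⟩ := (FractionalIdeal.mem_one_iff _).mp h1
      rw [tensorCoord_tmul, smul_smul, ← hr]
      exact A.isLattice.smul_mem r hx
    | zero => rw [map_zero, smul_zero]; exact zero_mem _
    | add x y _ _ hx hy => rw [map_add, smul_add]; exact add_mem hx hy
    | neg x _ hx => rw [map_neg, smul_neg]; exact neg_mem hx
  · intro h
    rw [← sum_tensorCoord e z]
    refine sum_mem fun j _ => ?_
    have key : ∀ s ∈ c j * (c j)⁻¹,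
        s • (tensorCoord E e j z ⊗ₜ[K] e j) ∈ (A.tensor B).lattice := by
      intro s hs
      refine FractionalIdeal.mul_induction_on hs ?_ ?_
      · intro s hs t ht
        rw [mul_comm, ← TensorProduct.smul_tmul_smul]
        exact AddSubgroup.subset_closure ⟨_, h j t ht, _, hB.smul_mem hs, rfl⟩
      · intro s t hs ht
        rw [add_smul]
        exact add_mem hs ht
    simpa using key 1 (by
      rw [mul_inv_cancel₀ (hB.ideal_ne_zero j)]; exact FractionalIdeal.one_mem_one _)

theorem tensorCoord_rTensor {κ : Type*} (e : Basis κ K F) (j : κ) (f : E →ₗ[K] E')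
    (z : E ⊗[K] F) : tensorCoord E' e j (f.rTensor F z) = f (tensorCoord E e j z) := by
  induction z using TensorProduct.induction_on with
  | zero => simp
  | add x y hx hy => simp only [map_add, hx, hy]
  | tmul x y => simp

/-- For a subspace `W` of `E`, the structure of `W ⊗ F` is induced by that of `E ⊗ F`. -/
theorem mem_tensor_restrict_iff (A : RigidAdelicSpace K E) (B : RigidAdelicSpace K F)
    (W : Submodule K E) (z : W ⊗[K] F) :
    z ∈ ((A.restrict W).tensor B).lattice ↔ W.subtype.rTensor F z ∈ (A.tensor B).lattice := by
  obtain ⟨c, e, hB, -⟩ := B.exists_isPseudoBasis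
  rw [mem_tensor_iff _ hB, mem_tensor_iff _ hB]
  simp only [tensorCoord_rTensor]
  rfl

theorem form_tensor_restrict (A : RigidAdelicSpace K E) (B : RigidAdelicSpace K F)
    (W : Submodule K E) (γ : K →+* ℂ) (z z' : W ⊗[K] F) :
    (A.tensor B).form γ (W.subtype.rTensor F z) (W.subtype.rTensor F z') =
      ((A.restrict W).tensor B).form γ z z' := by
  have h : ((A.tensor B).form γ).comap (W.subtype.rTensor F) =
      ((A.restrict W).tensor B).form γ := by
    refine SesqForm.ext_basis
      ((Module.finBasis K W).tensorProduct (Module.finBasis K F)) fun ⟨i, j⟩ ⟨k, l⟩ => ?_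
    simp only [Basis.tensorProduct_apply, SesqForm.comap_apply, LinearMap.rTensor_tmul,
      tensor_form_tmul]
    rfl
  rw [← h]
  rfl

/-- If the slopes of `W ⊗ F` and `E / W ⊗ F` are at least `m`, then so are those of `E ⊗ F`. -/
theorem HeightBound.tensor_of_quotient {A : RigidAdelicSpace K E} {B : RigidAdelicSpace K F}
    {W : Submodule K E} {m : ℝ} (hm : 0 ≤ m) (h1 : ((A.restrict W).tensor B).HeightBound m)
    (h2 : ((A.dual.restrict W.dualAnnihilator).dual.tensor B).HeightBound m) :
    (A.tensor B).HeightBound m := by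
  let U := W.dualAnnihilator
  let q := U.subtype.dualMap ∘ₗ Dual.eval K E
  have hq : (A.tensor B).IsContraction ((A.dual.restrict U).dual.tensor B)
      (TensorProduct.map q LinearMap.id) := (A.isContraction_evalOn U).tensor B.isContraction_id
  refine HeightBound.of_ker hm hq ?_ h2
  have hker : LinearMap.ker q = W := by
    rw [ker_evalOn, Subspace.dualAnnihilator_dualCoannihilator_eq]
  have hinj : Function.Injective (W.subtype.rTensor F) :=
    Module.Flat.rTensor_preserves_injective_linearMap _ W.subtype_injective
  have hexact : Function.Exact W.subtype q := by
    intro x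
    rw [← LinearMap.mem_ker, hker]
    simp
  have hrange : LinearMap.ker (TensorProduct.map q (LinearMap.id : F →ₗ[K] F)) =
      LinearMap.range (W.subtype.rTensor F) := by
    ext z
    exact rTensor_exact F hexact (evalOn_surjective U) z
  let φ := LinearEquiv.ofInjective _ hinj
  let ψ : LinearMap.ker (TensorProduct.map q (LinearMap.id : F →ₗ[K] F)) →ₗ[K] W ⊗[K] F :=
    φ.symm.toLinearMap ∘ₗ (LinearEquiv.ofEq _ _ hrange).toLinearMap
  have hψ : ∀ z, W.subtype.rTensor F (ψ z) = z := by
    intro z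
    exact congrArg Subtype.val (φ.apply_symm_apply (LinearEquiv.ofEq _ _ hrange z))
  refine h1.of_injective (f := ψ) (.of_form_eq (fun z hz => ?_) fun γ z z' => ?_)
    (φ.symm.injective.comp (LinearEquiv.ofEq _ _ hrange).injective)
  · rw [mem_tensor_restrict_iff, hψ]
    exact hz
  · rw [← form_tensor_restrict, hψ, hψ]
    rfl

end RigidAdelicSpace

/-! ### Minimal heights and semistability -/

namespace RigidAdelicSpace

section

variable {K : Type u} [Field K] [NumberField K]
variable {E : Type*} [AddCommGroup E] [Module K E] [FiniteDimensional K E]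
variable {F : Type*} [AddCommGroup F] [Module K F] [FiniteDimensional K F]

theorem reducedHeight_pos (A : RigidAdelicSpace K E) : 0 < A.reducedHeight :=
  Real.rpow_pos_of_pos A.height_pos _

theorem reducedHeight_pow [Nontrivial E] (A : RigidAdelicSpace K E) :
    A.reducedHeight ^ finrank K E = A.height := by
  rw [reducedHeight, one_div]
  exact Real.rpow_inv_natCast_pow A.height_pos.le (finrank_pos (R := K)).ne'

theorem pow_le_height_iff [Nontrivial E] (A : RigidAdelicSpace K E) {m : ℝ} (hm : 0 ≤ m) :
    m ^ finrank K E ≤ A.height ↔ m ≤ A.reducedHeight := by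
  rw [← A.reducedHeight_pow]
  exact pow_le_pow_iff_left₀ hm A.reducedHeight_pos.le (finrank_pos (R := K)).ne'

theorem HeightBound.le_reducedHeight [Nontrivial E] {A : RigidAdelicSpace K E} {m : ℝ}
    (hm : 0 ≤ m) (hA : A.HeightBound m) : m ≤ A.reducedHeight :=
  (A.pow_le_height_iff hm).mp hA.le_height

theorem heightBound_iff (A : RigidAdelicSpace K E) {m : ℝ} (hm : 0 ≤ m) :
    A.HeightBound m ↔ ∀ W : Submodule K E, W ≠ ⊥ → m ≤ (A.restrict W).reducedHeight := by
  refine forall_congr' fun W => ?_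
  by_cases hW : W = ⊥
  · subst hW
    simp [height_eq_one]
  · have : Nontrivial W := Submodule.nontrivial_iff_ne_bot.mpr hW
    simp [hW, pow_le_height_iff _ hm]

theorem HeightBound.mono {A : RigidAdelicSpace K E} {m m' : ℝ} (hA : A.HeightBound m)
    (hm' : 0 ≤ m') (h : m' ≤ m) : A.HeightBound m' :=
  fun W => (pow_le_pow_left₀ hm' h _).trans (hA W)

theorem HeightBound.restrict {A : RigidAdelicSpace K E} {m : ℝ} (hA : A.HeightBound m)
    (W : Submodule K E) : (A.restrict W).HeightBound m :=
  hA.of_injective (A.isContraction_subtype W) W.subtype_injective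

theorem heightBound_of_subsingleton [Subsingleton E] (A : RigidAdelicSpace K E) (m : ℝ) :
    A.HeightBound m := fun W => by
  rw [finrank_zero_of_subsingleton, pow_zero, height_eq_one]

theorem isSemistable_iff (A : RigidAdelicSpace K E) :
    A.IsSemistable ↔ A.HeightBound A.reducedHeight :=
  (A.heightBound_iff A.reducedHeight_pos.le).symm

theorem minHeight_nonneg (A : RigidAdelicSpace K E) : 0 ≤ A.minHeight :=
  Real.sInf_nonneg (by rintro _ ⟨W, _, rfl⟩; exact (reducedHeight_pos _).le)

theorem minHeight_le (A : RigidAdelicSpace K E) {W : Submodule K E} (hW : W ≠ ⊥) :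
    A.minHeight ≤ (A.restrict W).reducedHeight :=
  csInf_le ⟨0, by rintro _ ⟨W, _, rfl⟩; exact (reducedHeight_pos _).le⟩ ⟨W, hW, rfl⟩

theorem nonempty_reducedHeights [Nontrivial E] (A : RigidAdelicSpace K E) :
    {r : ℝ | ∃ W : Submodule K E, W ≠ ⊥ ∧ r = (A.restrict W).reducedHeight}.Nonempty :=
  ⟨_, ⊤, top_ne_bot, rfl⟩

theorem le_minHeight_iff [Nontrivial E] (A : RigidAdelicSpace K E) {m : ℝ} (hm : 0 ≤ m) :
    m ≤ A.minHeight ↔ A.HeightBound m := by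
  rw [A.heightBound_iff hm]
  constructor
  · intro h W hW
    exact h.trans (A.minHeight_le hW)
  · intro h
    refine le_csInf A.nonempty_reducedHeights ?_
    rintro _ ⟨W, hW, rfl⟩
    exact h W hW

theorem heightBound_minHeight [Nontrivial E] (A : RigidAdelicSpace K E) :
    A.HeightBound A.minHeight :=
  (A.le_minHeight_iff A.minHeight_nonneg).mp le_rfl

theorem IsSemistable.minHeight_eq [Nontrivial E] {A : RigidAdelicSpace K E}
    (hA : A.IsSemistable) : A.minHeight = A.reducedHeight := by
  refine le_antisymm (A.heightBound_minHeight.le_reducedHeight A.minHeight_nonneg) ?_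
  exact (A.le_minHeight_iff A.reducedHeight_pos.le).mpr (A.isSemistable_iff.mp hA)

theorem minHeight_tensor_le_reducedHeight_mul (A : RigidAdelicSpace K E) (B : RigidAdelicSpace K F)
    {W : Submodule K E} {W' : Submodule K F} (hW : W ≠ ⊥) (hW' : W' ≠ ⊥) :
    (A.tensor B).minHeight ≤ (A.restrict W).reducedHeight * (B.restrict W').reducedHeight := by
  have : Nontrivial W := Submodule.nontrivial_iff_ne_bot.mpr hW
  have : Nontrivial W' := Submodule.nontrivial_iff_ne_bot.mpr hW'
  let f := TensorProduct.map W.subtype W'.subtype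
  have hf : Function.Injective f :=
    TensorProduct.map_injective_of_flat_flat _ _ W.subtype_injective W'.subtype_injective
  have hfc : ((A.restrict W).tensor (B.restrict W')).IsContraction (A.tensor B) f :=
    (A.isContraction_subtype W).tensor (B.isContraction_subtype W')
  have h1 := (hfc.height_range_le hf).trans (height_tensor_le _ _)
  have hdim : finrank K (LinearMap.range f) = finrank K W * finrank K W' := by
    rw [LinearMap.finrank_range_of_inj hf, finrank_tensorProduct]
  have hpos : 0 < finrank K (LinearMap.range f) := by
    rw [hdim]; exact mul_pos finrank_pos finrank_pos
  have hne : LinearMap.range f ≠ ⊥ := by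
    intro h
    rw [h, finrank_bot] at hpos
    exact hpos.ne rfl
  have : Nontrivial (LinearMap.range f) := Submodule.nontrivial_iff_ne_bot.mpr hne
  refine ((A.tensor B).minHeight_le hne).trans ?_
  refine le_of_pow_le_pow_left₀ hpos.ne'
    (mul_pos (reducedHeight_pos _) (reducedHeight_pos _)).le ?_
  rw [reducedHeight_pow]
  refine h1.trans_eq ?_
  rw [← reducedHeight_pow (A.restrict W), ← reducedHeight_pow (B.restrict W'), hdim, mul_pow]
  ring

/-- The inequality between the minimal heights that always holds. -/
theorem minHeight_tensor_le [Nontrivial E] [Nontrivial F] (A : RigidAdelicSpace K E)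
    (B : RigidAdelicSpace K F) : (A.tensor B).minHeight ≤ A.minHeight * B.minHeight := by
  have h1 : ∀ W : Submodule K E, W ≠ ⊥ →
      (A.tensor B).minHeight ≤ (A.restrict W).reducedHeight * B.minHeight := by
    intro W hW
    rw [← div_le_iff₀' (reducedHeight_pos _)]
    refine le_csInf B.nonempty_reducedHeights ?_
    rintro _ ⟨W', hW', rfl⟩
    rw [div_le_iff₀' (reducedHeight_pos _)]
    exact A.minHeight_tensor_le_reducedHeight_mul B hW hW'
  rcases B.minHeight_nonneg.eq_or_lt with h0 | h0
  · have := h1 ⊤ top_ne_bot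
    rw [← h0, mul_zero] at this ⊢
    exact this
  · rw [← div_le_iff₀ h0]
    refine le_csInf A.nonempty_reducedHeights ?_
    rintro _ ⟨W, hW, rfl⟩
    rw [div_le_iff₀ h0]
    exact h1 W hW

open Filter Topology in
theorem heightBound_mul_of_forall_lt (A : RigidAdelicSpace K E) {m f : ℝ} (hm : 0 < m)
    (h : ∀ m', 0 < m' → m' < m → A.HeightBound (m' * f)) : A.HeightBound (m * f) := by
  intro W
  have h1 : Tendsto (fun x : ℝ => (x * f) ^ finrank K W) (𝓝[<] m)
      (𝓝 ((m * f) ^ finrank K W)) := by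
    refine Tendsto.mono_left (Continuous.tendsto (by fun_prop) m) nhdsWithin_le_nhds
  refine le_of_tendsto h1 ?_
  filter_upwards [Ioo_mem_nhdsLT hm] with x hx
  exact h x hx.1 hx.2 W

/-- A space that is not semistable has a proper subspace `W` that almost realizes the minimal
height. If `m` is less than the minimal height, then the slopes of `W` and of the quotient by
`W` are at least `m`. -/
theorem exists_heightBound_of_not_isSemistable [Nontrivial E] {A : RigidAdelicSpace K E}
    (hA : ¬ A.IsSemistable) {m : ℝ} (hm : 0 < m) (hm' : m < A.minHeight) :
    ∃ W : Submodule K E, W ≠ ⊥ ∧ W ≠ ⊤ ∧ (A.restrict W).HeightBound m ∧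
      (A.dual.restrict W.dualAnnihilator).dual.HeightBound m := by
  set M := A.minHeight with hM
  have hM0 : 0 < M := hm.trans hm'
  set n := finrank K E with hn
  have hn0 : 0 < n := finrank_pos
  -- `s ^ n = M / m`
  set s : ℝ := (M / m) ^ ((n : ℝ)⁻¹) with hs
  have hMm : 1 < M / m := (one_lt_div hm).mpr hm'
  have hs1 : 1 < s := Real.one_lt_rpow hMm (by positivity)
  have hsn : s ^ n = M / m := Real.rpow_inv_natCast_pow (by positivity) hn0.ne'
  have hlt : M < A.reducedHeight := by
    refine lt_of_le_of_ne (A.heightBound_minHeight.le_reducedHeight A.minHeight_nonneg) ?_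
    intro h
    apply hA
    rw [isSemistable_iff, ← h]
    exact A.heightBound_minHeight
  have hlt' : M < min (M * s) A.reducedHeight := lt_min (lt_mul_of_one_lt_right hM0 hs1) hlt
  obtain ⟨_, ⟨W, hW, rfl⟩, hWlt⟩ := exists_lt_of_csInf_lt A.nonempty_reducedHeights hlt'
  have : Nontrivial W := Submodule.nontrivial_iff_ne_bot.mpr hW
  refine ⟨W, hW, ?_, (A.heightBound_minHeight.restrict W).mono hm.le hm'.le, ?_⟩
  · rintro rfl
    have h1 : A.height ≤ (A.restrict ⊤).height :=
      (A.isContraction_subtype ⊤).height_le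
        ⟨Submodule.subtype_injective _, fun x => ⟨⟨x, trivial⟩, rfl⟩⟩
    have h2 : A.reducedHeight ≤ (A.restrict ⊤).reducedHeight := by
      rw [← pow_le_height_iff _ A.reducedHeight_pos.le, finrank_top, reducedHeight_pow]
      exact h1
    exact (lt_min_iff.mp hWlt).2.not_ge h2
  · intro Y
    obtain ⟨V, hV, hVle⟩ := A.exists_height_le_of_quotient W Y
    rcases (finrank K Y).eq_zero_or_pos with hY | hY
    · have : Subsingleton Y := finrank_zero_iff.mp hY
      rw [hY, pow_zero, height_eq_one]
    have h1 : (A.restrict W).height ≤ (M * s) ^ finrank K W := by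
      rw [← reducedHeight_pow]
      exact pow_le_pow_left₀ (reducedHeight_pos _).le (lt_min_iff.mp hWlt).1.le _
    set H := ((A.dual.restrict W.dualAnnihilator).dual.restrict Y).height with hH
    have hH0 : 0 < H := height_pos _
    have h2 := ((A.heightBound_minHeight V).trans hVle).trans
      (mul_le_mul_of_nonneg_right h1 hH0.le)
    rw [hV, pow_add, mul_pow, mul_assoc] at h2
    have h3 : M ^ finrank K Y ≤ s ^ finrank K W * H :=
      le_of_mul_le_mul_left h2 (pow_pos hM0 _)
    have h4 : s ^ finrank K W ≤ (M / m) ^ finrank K Y := by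
      calc s ^ finrank K W ≤ s ^ n := pow_le_pow_right₀ hs1.le W.finrank_le
        _ = (M / m) ^ 1 := by rw [hsn, pow_one]
        _ ≤ _ := pow_le_pow_right₀ hMm.le hY
    have h5 := h3.trans (mul_le_mul_of_nonneg_right h4 hH0.le)
    rw [div_pow, div_mul_eq_mul_div, le_div_iff₀ (pow_pos hm _)] at h5
    exact le_of_mul_le_mul_left h5 (pow_pos hM0 _)

end

/-! ### Reduction of Bost's conjecture to semistable spaces -/

section

variable {K : Type u} [Field K] [NumberField K]
variable {F : Type u} [AddCommGroup F] [Module K F] [FiniteDimensional K F]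

/-- Lower bounds for the slopes of `E ⊗ F` have to be proved for semistable spaces `E` only. -/
theorem heightBound_tensor_of_isSemistable (B : RigidAdelicSpace K F) {f : ℝ} (hf : 0 < f)
    (H : ∀ (E : Type u) [AddCommGroup E] [Module K E] [FiniteDimensional K E] [Nontrivial E]
      (A : RigidAdelicSpace K E), A.IsSemistable → ∀ m, 0 < m → A.HeightBound m →
      (A.tensor B).HeightBound (m * f)) (n : ℕ) :
    ∀ (E : Type u) [AddCommGroup E] [Module K E] [FiniteDimensional K E]
      (A : RigidAdelicSpace K E), finrank K E = n → ∀ m, 0 < m → A.HeightBound m →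
      (A.tensor B).HeightBound (m * f) := by
  induction n using Nat.strong_induction_on with
  | _ n ih =>
    intro E _ _ _ A hn m hm hA
    rcases subsingleton_or_nontrivial E with hE | hE
    · exact heightBound_of_subsingleton _ _
    by_cases hss : A.IsSemistable
    · exact H E A hss m hm hA
    refine heightBound_mul_of_forall_lt _ hm fun m' hm' hlt => ?_
    have hle : m ≤ A.minHeight := (A.le_minHeight_iff hm.le).mpr hA
    obtain ⟨W, hW, hW', h1, h2⟩ :=
      exists_heightBound_of_not_isSemistable hss hm' (hlt.trans_le hle)
    have hpos : 0 < finrank K W := by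
      have : Nontrivial W := Submodule.nontrivial_iff_ne_bot.mpr hW
      exact finrank_pos
    have hdim := Subspace.finrank_add_finrank_dualAnnihilator_eq W
    have hdim' : finrank K (Dual K W.dualAnnihilator) = finrank K W.dualAnnihilator :=
      Subspace.dual_finrank_eq (K := K) (V := W.dualAnnihilator)
    refine HeightBound.tensor_of_quotient (mul_pos hm' hf).le
      (ih _ ?_ _ _ rfl m' hm' h1) (ih _ ?_ _ _ rfl m' hm' h2)
    · rw [← hn]
      exact Submodule.finrank_lt hW'
    · omega

/-- Bost's conjecture follows from the case of semistable spaces. -/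
theorem bostConjecture_of_isSemistable
    (H : ∀ (E F : Type u) [AddCommGroup E] [Module K E] [FiniteDimensional K E] [Nontrivial E]
      [AddCommGroup F] [Module K F] [FiniteDimensional K F] [Nontrivial F]
      (A : RigidAdelicSpace K E) (B : RigidAdelicSpace K F), A.IsSemistable → B.IsSemistable →
      (A.tensor B).HeightBound (A.reducedHeight * B.reducedHeight)) : BostConjecture K := by
  intro E F _ _ _ _ _ _ _ _ A B
  refine le_antisymm (A.minHeight_tensor_le B) ?_
  rcases A.minHeight_nonneg.eq_or_lt with hA | hA
  · rw [← hA, zero_mul]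
    exact minHeight_nonneg _
  rcases B.minHeight_nonneg.eq_or_lt with hB | hB
  · rw [← hB, mul_zero]
    exact minHeight_nonneg _
  rw [le_minHeight_iff _ (mul_pos hA hB).le]
  -- the case of a semistable second factor
  have h1 : ∀ (E' F' : Type u) [AddCommGroup E'] [Module K E'] [FiniteDimensional K E']
      [AddCommGroup F'] [Module K F'] [FiniteDimensional K F'] [Nontrivial F']
      (A' : RigidAdelicSpace K E') (B' : RigidAdelicSpace K F'), B'.IsSemistable →
      ∀ m f, 0 < m → 0 < f → A'.HeightBound m → B'.HeightBound f →
      (A'.tensor B').HeightBound (m * f) := by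
    intro E' F' _ _ _ _ _ _ _ A' B' hB' m f hm hf hA' hBf
    refine heightBound_tensor_of_isSemistable B' hf ?_ _ E' A' rfl m hm hA'
    intro E'' _ _ _ _ A'' hss m hm hA''
    exact (H E'' F' A'' B' hss hB').mono (mul_pos hm hf).le
      (mul_le_mul (hA''.le_reducedHeight hm.le) (hBf.le_reducedHeight hf.le) hf.le
        A''.reducedHeight_pos.le)
  have h2 := heightBound_tensor_of_isSemistable A hA (fun F' _ _ _ _ B' hB' f hf hBf => by
    rw [mul_comm]
    exact (h1 E F' A B' hB' _ f hA hf A.heightBound_minHeight hBf).of_injective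
      (B'.isContraction_comm A) (TensorProduct.comm K F' E).injective) _ F B rfl _ hB
    B.heightBound_minHeight
  rw [mul_comm]
  exact h2.of_injective (A.isContraction_comm B) (TensorProduct.comm K E F).injective

/-- Bost's conjecture follows from the case of spaces with a property `P`, if every semistable
space can be embedded into a semistable space with the same slope that has the property `P`. -/
theorem bostConjecture_of_bostConjectureFor
    {P : ∀ (E : Type u) [AddCommGroup E] [Module K E] [FiniteDimensional K E],
      RigidAdelicSpace K E → Prop}
    (hP : ∀ (E : Type u) [AddCommGroup E] [Module K E] [FiniteDimensional K E] [Nontrivial E]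
      (A : RigidAdelicSpace K E), A.IsSemistable →
      ∃ (E' : Type u) (_ : AddCommGroup E') (_ : Module K E') (_ : FiniteDimensional K E')
        (A' : RigidAdelicSpace K E') (f : E →ₗ[K] E'), A.IsContraction A' f ∧
        Function.Injective f ∧ A'.IsSemistable ∧ A'.reducedHeight = A.reducedHeight ∧ P E' A')
    (H : BostConjectureFor K P) : BostConjecture K := by
  refine bostConjecture_of_isSemistable fun E F _ _ _ _ _ _ _ _ A B hA hB => ?_
  obtain ⟨E', _, _, _, A', f, hf, hfi, hA', hAA', hPA⟩ := hP E A hA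
  obtain ⟨F', _, _, _, B', g, hg, hgi, hB', hBB', hPB⟩ := hP F B hB
  have : Nontrivial E' := hfi.nontrivial
  have : Nontrivial F' := hgi.nontrivial
  have : Nontrivial (E' ⊗[K] F') := by
    apply nontrivial_of_finrank_pos (R := K)
    rw [finrank_tensorProduct]
    exact mul_pos finrank_pos finrank_pos
  have h1 := H E' F' A' B' hPA hPB
  rw [hA'.minHeight_eq, hB'.minHeight_eq, hAA', hBB'] at h1
  have h2 := (A'.tensor B').heightBound_minHeight
  rw [h1] at h2
  exact h2.of_injective (hf.tensor hg) (TensorProduct.map_injective_of_flat_flat _ _ hfi hgi)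

end

end RigidAdelicSpace

/-! ### Rescaled spaces and orthogonal sums -/

namespace RigidAdelicSpace

variable {K : Type u} [Field K] [NumberField K]
variable {E : Type*} [AddCommGroup E] [Module K E]
variable {F : Type*} [AddCommGroup F] [Module K F]

/-- The space with the same lattice in which the norms at the infinite places are multiplied by
`s`. -/
noncomputable def scale (A : RigidAdelicSpace K E) (s : ℝ) (hs : 0 < s) :
    RigidAdelicSpace K E where
  lattice := A.lattice
  isLattice := A.isLattice
  form γ := LinearMap.mk₂'ₛₗ ((starRingEnd ℂ).comp γ) γ (fun x y => (s : ℂ) ^ 2 * A.form γ x y)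
    (by intros; simp [mul_add]) (by intros; simp [mul_left_comm])
    (by intros; simp [mul_add]) (by intros; simp [mul_left_comm])
  form_conj γ x y := by simp [A.form_conj]
  form_posDef γ n e he := by
    have hc : (0 : ℂ) < (s : ℂ) ^ 2 := by exact_mod_cast pow_pos hs 2
    exact (A.form_posDef γ n e he).smul hc

theorem scale_form (A : RigidAdelicSpace K E) {s : ℝ} (hs : 0 < s) (γ : K →+* ℂ) (x y : E) :
    (A.scale s hs).form γ x y = (s : ℂ) ^ 2 * A.form γ x y := rfl

theorem scale_gram (A : RigidAdelicSpace K E) {s : ℝ} (hs : 0 < s) (γ : K →+* ℂ) {ι : Type*}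
    (e : ι → E) : ((A.scale s hs).form γ).gram e = ((s : ℂ) ^ 2) • (A.form γ).gram e := rfl

theorem height_scale [FiniteDimensional K E] (A : RigidAdelicSpace K E) {s : ℝ} (hs : 0 < s) :
    (A.scale s hs).height = s ^ finrank K E * A.height := by
  obtain ⟨a, b, h, hH⟩ := A.exists_isPseudoBasis
  have h' : (A.scale s hs).IsPseudoBasis a b := h
  have hd : finrank ℚ K ≠ 0 := finrank_pos.ne'
  have hpos := (A.pseudoVolume_pos h.ideal_ne_zero b.linearIndependent).le
  have h1 : (A.scale s hs).pseudoVolume a b =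
      (s ^ finrank K E) ^ finrank ℚ K * A.pseudoVolume a b := by
    rw [pseudoVolume, pseudoVolume, mul_left_comm, ← Embeddings.card K ℂ, ← Finset.card_univ,
      ← Finset.prod_const, ← Finset.prod_mul_distrib]
    congr 1
    refine Finset.prod_congr rfl fun γ _ => ?_
    have h2 : (((s : ℂ) ^ 2) ^ finrank K E) = (((s ^ finrank K E) ^ 2 : ℝ) : ℂ) := by
      push_cast
      ring
    rw [scale_gram, Matrix.det_smul, Fintype.card_fin, h2, Complex.re_ofReal_mul,
      Real.mul_rpow (by positivity) (A.det_gram_pos γ b.linearIndependent).le,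
      ← Real.sqrt_eq_rpow (_ ^ 2), Real.sqrt_sq (by positivity)]
  rw [h'.height_eq, hH, h1, Real.mul_rpow (by positivity) hpos, one_div,
    Real.pow_rpow_inv_natCast (by positivity) hd]

theorem HeightBound.scale [FiniteDimensional K E] {A : RigidAdelicSpace K E} {m : ℝ}
    (hA : A.HeightBound m) {s : ℝ} (hs : 0 < s) : (A.scale s hs).HeightBound (s * m) := by
  intro W
  have h : (A.scale s hs).restrict W = (A.restrict W).scale s hs := rfl
  rw [h, height_scale, mul_pow]
  exact mul_le_mul_of_nonneg_left (hA W) (by positivity)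

theorem _root_.Matrix.PosDef.fromBlocks_zero {m n : Type*} [Fintype m] [Fintype n] [DecidableEq m]
    [DecidableEq n] {G : Matrix m m ℂ} {H : Matrix n n ℂ} (hG : G.PosDef) (hH : H.PosDef) :
    (Matrix.fromBlocks G 0 0 H).PosDef := by
  have : Invertible G := hG.isUnit.invertible
  have h1 := Matrix.PosDef.fromBlocks₁₁ 0 H hG
  rw [Matrix.conjTranspose_zero, Matrix.mul_zero, sub_zero] at h1
  rw [(h1.mpr hH.posSemidef).posDef_iff_det_ne_zero, Matrix.det_fromBlocks_zero₂₁]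
  exact mul_ne_zero hG.det_pos.ne' hH.det_pos.ne'

/-- The orthogonal sum of two forms. -/
noncomputable def _root_.SesqForm.prod {γ : K →+* ℂ} (h : SesqForm γ E) (h' : SesqForm γ F) :
    SesqForm γ (E × F) :=
  h.comap (LinearMap.fst K E F) + h'.comap (LinearMap.snd K E F)

theorem _root_.SesqForm.prod_apply {γ : K →+* ℂ} (h : SesqForm γ E) (h' : SesqForm γ F)
    (x y : E × F) : h.prod h' x y = h x.1 y.1 + h' x.2 y.2 := rfl

theorem _root_.SesqForm.gram_prod {γ : K →+* ℂ} (h : SesqForm γ E) (h' : SesqForm γ F)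
    {ι κ : Type*} (b : Basis ι K E) (c : Basis κ K F) :
    (h.prod h').gram (b.prod c) = Matrix.fromBlocks (h.gram b) 0 0 (h'.gram c) := by
  ext (i | i) (j | j) <;> simp [SesqForm.gram, SesqForm.prod_apply]

/-- The orthogonal sum of two rigid adelic spaces. -/
noncomputable def prod [FiniteDimensional K E] [FiniteDimensional K F] (A : RigidAdelicSpace K E)
    (B : RigidAdelicSpace K F) : RigidAdelicSpace K (E × F) where
  lattice := A.lattice.prod B.lattice
  isLattice :=
    { smul_mem := fun a x hx => ⟨A.isLattice.smul_mem a hx.1, B.isLattice.smul_mem a hx.2⟩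
      fg := by
        have h1 := A.isLattice.fg
        have h2 := B.isLattice.fg
        rw [← AddSubgroup.toIntSubmodule_toAddSubgroup A.lattice,
          ← Submodule.fg_iff_addSubgroup_fg] at h1
        rw [← AddSubgroup.toIntSubmodule_toAddSubgroup B.lattice,
          ← Submodule.fg_iff_addSubgroup_fg] at h2
        have h3 := h1.prod h2
        rw [Submodule.fg_iff_addSubgroup_fg] at h3
        exact h3
      span_eq_top := by
        rw [eq_top_iff]
        rintro ⟨x, y⟩ -
        obtain ⟨d, hd, hx⟩ := A.isLattice.exists_smul_mem x
        obtain ⟨e, he, hy⟩ := B.isLattice.exists_smul_mem y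
        have hd' : (d : K) ≠ 0 := by simpa using hd
        have he' : (e : K) ≠ 0 := by simpa using he
        have h : ((x, y) : E × F) = (d : K)⁻¹ • ((d : K) • x, (0 : F)) +
            (e : K)⁻¹ • ((0 : E), (e : K) • y) := by
          simp [smul_smul, hd', he']
        rw [h]
        exact add_mem (Submodule.smul_mem _ _ (Submodule.subset_span ⟨hx, B.lattice.zero_mem⟩))
          (Submodule.smul_mem _ _ (Submodule.subset_span ⟨A.lattice.zero_mem, hy⟩)) }
  form γ := (A.form γ).prod (B.form γ)
  form_conj γ x y := by simp [SesqForm.prod_apply, A.form_conj, B.form_conj]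
  form_posDef γ n e he := by
    refine SesqForm.gram_posDef_of_basis _ ((Module.finBasis K E).prod (Module.finBasis K F)) ?_
      e he
    rw [SesqForm.gram_prod]
    exact (A.gram_posDef γ (Module.finBasis K E).linearIndependent).fromBlocks_zero
      (B.gram_posDef γ (Module.finBasis K F).linearIndependent)

variable [FiniteDimensional K E] [FiniteDimensional K F]

theorem prod_form_apply (A : RigidAdelicSpace K E) (B : RigidAdelicSpace K F) (γ : K →+* ℂ)
    (x y : E × F) : (A.prod B).form γ x y = A.form γ x.1 y.1 + B.form γ x.2 y.2 := rfl

theorem isContraction_inl (A : RigidAdelicSpace K E) (B : RigidAdelicSpace K F) :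
    A.IsContraction (A.prod B) (LinearMap.inl K E F) :=
  .of_form_eq (fun _ hx => ⟨hx, B.lattice.zero_mem⟩) fun γ x y => by simp [prod_form_apply]

theorem height_prod_le (A : RigidAdelicSpace K E) (B : RigidAdelicSpace K F) :
    (A.prod B).height ≤ A.height * B.height := by
  obtain ⟨a, b, hA, hHA⟩ := A.exists_isPseudoBasis
  obtain ⟨c, e, hB, hHB⟩ := B.exists_isPseudoBasis
  have h1 := (A.prod B).height_le (Sum.elim a c) (b.prod e)
    (by
      rintro (i | j)
      · exact hA.ideal_ne_zero i
      · exact hB.ideal_ne_zero j)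
    (by
      rintro (i | j) t ht
      · exact ⟨by simpa using hA.smul_mem ht, by simp [B.lattice.zero_mem]⟩
      · exact ⟨by simp [A.lattice.zero_mem], by simpa using hB.smul_mem ht⟩)
  refine h1.trans_eq ?_
  have hposA := (A.pseudoVolume_pos hA.ideal_ne_zero b.linearIndependent).le
  have hposB := (B.pseudoVolume_pos hB.ideal_ne_zero e.linearIndependent).le
  rw [hHA, hHB, ← Real.mul_rpow hposA hposB]
  congr 1
  rw [pseudoVolume, pseudoVolume, pseudoVolume, mul_mul_mul_comm, Fintype.prod_sum_type]
  simp only [Sum.elim_inl, Sum.elim_inr, map_mul, Rat.cast_mul]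
  congr 1
  rw [← Finset.prod_mul_distrib]
  refine Finset.prod_congr rfl fun γ _ => ?_
  have h2 : ((A.prod B).form γ).gram (b.prod e) = _ :=
    SesqForm.gram_prod (A.form γ) (B.form γ) b e
  have h3 := (Complex.pos_iff.mp (A.gram_posDef γ b.linearIndependent).det_pos).2
  rw [← Real.mul_rpow (A.det_gram_pos γ b.linearIndependent).le
    (B.det_gram_pos γ e.linearIndependent).le, h2, Matrix.det_fromBlocks_zero₂₁, Complex.mul_re,
    ← h3, zero_mul, sub_zero]

theorem HeightBound.prod {A : RigidAdelicSpace K E} {B : RigidAdelicSpace K F} {m : ℝ}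
    (hm : 0 ≤ m) (hA : A.HeightBound m) (hB : B.HeightBound m) : (A.prod B).HeightBound m := by
  refine HeightBound.of_ker (f := LinearMap.snd K E F) hm ⟨fun x hx => hx.2, fun γ => ?_⟩ ?_ hB
  · have h : (A.prod B).form γ - (B.form γ).comap (LinearMap.snd K E F) =
        (A.form γ).comap (LinearMap.fst K E F) := by
      ext x y
      simp [prod_form_apply]
    rw [h]
    exact (A.isNonneg_form γ).comap _
  · refine hA.of_injective
      (f := LinearMap.fst K E F ∘ₗ (LinearMap.ker (LinearMap.snd K E F)).subtype)
      (.of_form_eq (fun x hx => hx.1) fun γ x y => ?_) fun x y h => ?_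
    · have hx : x.1.2 = 0 := x.2
      change A.form γ x.1.1 y.1.1 = A.form γ x.1.1 y.1.1 + B.form γ x.1.2 y.1.2
      rw [hx, map_zero, LinearMap.zero_apply, add_zero]
    · have hx : x.1.2 = 0 := x.2
      have hy : y.1.2 = 0 := y.2
      exact Subtype.ext (Prod.ext h (hx.trans hy.symm))

/-- The sum of a semistable space `E` and a space of the same dimension, the inverse slope, and
rescaled so as to have the slope of `E`, is semistable. -/
theorem IsSemistable.prod_scale [Nontrivial E] {A : RigidAdelicSpace K E} (hA : A.IsSemistable)
    {B : RigidAdelicSpace K F} (hdim : finrank K F = finrank K E) (hH : B.height = A.height⁻¹)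
    (hB : B.HeightBound A.reducedHeight⁻¹) :
    (A.prod (B.scale (A.reducedHeight ^ 2) (pow_pos A.reducedHeight_pos 2))).IsSemistable ∧
    (A.prod (B.scale (A.reducedHeight ^ 2) (pow_pos A.reducedHeight_pos 2))).reducedHeight =
      A.reducedHeight := by
  set m := A.reducedHeight with hm
  have hm0 : 0 < m := A.reducedHeight_pos
  have h1 : (B.scale (m ^ 2) (pow_pos hm0 2)).HeightBound m := by
    convert hB.scale (pow_pos hm0 2) using 1
    field_simp
  have h2 := HeightBound.prod hm0.le (A.isSemistable_iff.mp hA) h1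
  have h3 : (A.prod (B.scale (m ^ 2) (pow_pos hm0 2))).reducedHeight = m := by
    refine le_antisymm ?_ (h2.le_reducedHeight hm0.le)
    refine le_of_pow_le_pow_left₀ (finrank_pos (R := K) (M := E × F)).ne' hm0.le ?_
    rw [reducedHeight_pow]
    refine (height_prod_le _ _).trans_eq ?_
    rw [height_scale, hH, mul_left_comm, mul_inv_cancel₀ A.height_pos.ne', mul_one, finrank_prod,
      hdim, ← pow_mul, two_mul]
  refine ⟨?_, h3⟩
  rw [isSemistable_iff, h3]
  exact h2

open scoped Matrix in
/-- The dual form of a sum `A ⊕ B` with `B` rescaled. -/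
theorem gram_dual_prod_scale (A : RigidAdelicSpace K E) (B : RigidAdelicSpace K F) {s : ℝ}
    (hs : 0 < s) (γ : K →+* ℂ) {ι κ : Type*} [Fintype ι] [DecidableEq ι] [Fintype κ]
    [DecidableEq κ] (b : Basis ι K E) (c : Basis κ K F) :
    ((A.prod (B.scale s hs)).dual.form γ).gram (b.prod c).dualBasis =
      Matrix.fromBlocks ((A.form γ).gram b)⁻¹ᵀ 0 0
        (((s⁻¹ : ℝ) : ℂ) ^ 2 • ((B.form γ).gram c)⁻¹ᵀ) := by
  have hs' : (s : ℂ) ≠ 0 := by exact_mod_cast hs.ne'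
  have hG := (Matrix.isUnit_iff_isUnit_det _).mp (A.gram_posDef γ b.linearIndependent).isUnit
  have hG' := (Matrix.isUnit_iff_isUnit_det _).mp (B.gram_posDef γ c.linearIndependent).isUnit
  have h1 : ((A.prod (B.scale s hs)).form γ).gram (b.prod c) = Matrix.fromBlocks
      ((A.form γ).gram b) 0 0 (((s : ℂ) ^ 2) • (B.form γ).gram c) :=
    SesqForm.gram_prod (A.form γ) ((B.scale s hs).form γ) b c
  have h2 : (Matrix.fromBlocks ((A.form γ).gram b) 0 0 (((s : ℂ) ^ 2) • (B.form γ).gram c))⁻¹ =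
      Matrix.fromBlocks ((A.form γ).gram b)⁻¹ 0 0
        (((s⁻¹ : ℝ) : ℂ) ^ 2 • ((B.form γ).gram c)⁻¹) := by
    refine Matrix.inv_eq_left_inv ?_
    rw [Matrix.fromBlocks_multiply]
    simp [Matrix.nonsing_inv_mul _ hG, Matrix.nonsing_inv_mul _ hG', smul_smul, hs']
  rw [gram_dual, h1, h2, Matrix.fromBlocks_transpose]
  simp

/-! ### Similarities -/

/-- Membership in the lattice is detected by the dual lattice. -/
theorem mem_lattice_iff (A : RigidAdelicSpace K E) (x : E) :
    x ∈ A.lattice ↔ ∀ φ ∈ A.dual.lattice, φ x ∈ (algebraMap (𝓞 K) K).range := by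
  refine ⟨fun hx φ hφ => hφ x hx, fun h => ?_⟩
  obtain ⟨a, b, hab, -⟩ := A.exists_isPseudoBasis
  refine (hab x).mpr fun i => ?_
  rw [← inv_inv (a i), FractionalIdeal.mem_inv_iff (inv_ne_zero (hab.ideal_ne_zero i))]
  intro t ht
  obtain ⟨r, hr⟩ := h _ (hab.dual.smul_mem ht)
  rw [FractionalIdeal.mem_one_iff]
  refine ⟨r, ?_⟩
  rw [hr, LinearMap.smul_apply, smul_eq_mul, Basis.dualBasis_apply, mul_comm]

omit [FiniteDimensional K E] [FiniteDimensional K F] in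
theorem baseChange_mem_span {A : RigidAdelicSpace K E} {B : RigidAdelicSpace K F} {f : E →ₗ[K] F}
    (hf : ∀ x ∈ A.lattice, f x ∈ B.lattice) (v : HeightOneSpectrum (𝓞 K))
    {y : v.adicCompletion K ⊗[K] E}
    (hy : y ∈ Submodule.span (v.adicCompletionIntegers K)
      {z : v.adicCompletion K ⊗[K] E | ∃ l ∈ A.lattice, z = 1 ⊗ₜ[K] l}) :
    f.baseChange (v.adicCompletion K) y ∈ Submodule.span (v.adicCompletionIntegers K)
      {z : v.adicCompletion K ⊗[K] F | ∃ l ∈ B.lattice, z = 1 ⊗ₜ[K] l} := by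
  induction hy using Submodule.span_induction with
  | mem y hy =>
    obtain ⟨l, hl, rfl⟩ := hy
    exact Submodule.subset_span ⟨f l, hf l hl, by simp⟩
  | zero => rw [map_zero]; exact zero_mem _
  | add x y _ _ hx hy => rw [map_add]; exact add_mem hx hy
  | smul r y _ hy =>
    have h : f.baseChange (v.adicCompletion K) (r • y) =
        r • f.baseChange (v.adicCompletion K) y :=
      (f.baseChange (v.adicCompletion K)).map_smul (r : v.adicCompletion K) y
    rw [h]
    exact Submodule.smul_mem _ _ hy

omit [FiniteDimensional K E] [FiniteDimensional K F] in
/-- A linear map that identifies the lattices preserves the norms at the finite places. -/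
theorem finiteNorm_baseChange {A : RigidAdelicSpace K E} {B : RigidAdelicSpace K F}
    (σ : E ≃ₗ[K] F) (h : ∀ x, σ x ∈ B.lattice ↔ x ∈ A.lattice) (v : HeightOneSpectrum (𝓞 K))
    (x : v.adicCompletion K ⊗[K] E) :
    B.finiteNorm v (σ.toLinearMap.baseChange (v.adicCompletion K) x) = A.finiteNorm v x := by
  have h' : ∀ y ∈ B.lattice, σ.symm.toLinearMap y ∈ A.lattice := fun y hy => by
    rw [← h]
    simpa using hy
  have hinv : ∀ z, σ.symm.toLinearMap.baseChange (v.adicCompletion K)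
      (σ.toLinearMap.baseChange (v.adicCompletion K) z) = z := by
    intro z
    rw [← LinearMap.comp_apply, ← LinearMap.baseChange_comp, LinearEquiv.symm_comp,
      LinearMap.baseChange_id, LinearMap.id_apply]
  rw [finiteNorm, finiteNorm]
  congr 1
  ext r
  refine exists_congr fun α => and_congr_right fun _ => ⟨?_, ?_⟩
  · rintro ⟨y, hy, hxy⟩
    refine ⟨_, baseChange_mem_span h' v hy, ?_⟩
    rw [← map_smul, ← hxy, hinv]
  · rintro ⟨y, hy, rfl⟩
    exact ⟨_, baseChange_mem_span (fun x hx => (h x).mpr hx) v hy, map_smul _ _ _⟩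

omit [FiniteDimensional K E] [FiniteDimensional K F] in
theorem isSimilarity_of_bijective {A : RigidAdelicSpace K E} {B : RigidAdelicSpace K F}
    {σ : E →ₗ[K] F} (hσ : Function.Bijective σ) (h : ∀ x, σ x ∈ B.lattice ↔ x ∈ A.lattice)
    {c : ℝ} (hc : 0 < c) (hform : ∀ γ x y, B.form γ (σ x) (σ y) = (c : ℂ) ^ 2 * A.form γ x y) :
    A.IsSimilarity B σ := by
  refine ⟨fun γ => ⟨c, hc, hform γ⟩, fun _ => 1, fun _ => one_pos, by simp, fun v x => ?_⟩
  rw [one_mul]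
  exact finiteNorm_baseChange (LinearEquiv.ofBijective σ hσ) h v x

/-! ### Hyperbolic spaces -/

/-- The map `E ⊕ E^∨ → (E ⊕ E^∨)^∨` belonging to the bilinear form
`((x, φ), (y, ψ)) ↦ φ y + ε * ψ x`. -/
noncomputable def hyperbolicMap (E : Type*) [AddCommGroup E] [Module K E] (ε : K) :
    (E × Dual K E) →ₗ[K] Dual K (E × Dual K E) :=
  LinearMap.mk₂ K (fun p q => p.2 q.1 + ε * q.2 p.1)
    (by intros; simp; ring) (by intros; simp; ring) (by intros; simp; ring) (by intros; simp; ring)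

theorem hyperbolicMap_apply (ε : K) (p q : E × Dual K E) :
    hyperbolicMap E ε p q = p.2 q.1 + ε * q.2 p.1 := rfl

theorem hyperbolicMap_bijective {ε : K} (hε : ε ≠ 0) :
    Function.Bijective (hyperbolicMap E ε) := by
  have hinj : Function.Injective (hyperbolicMap E ε) := by
    rw [injective_iff_map_eq_zero]
    rintro ⟨x, φ⟩ h
    have h1 : ∀ (y : E) (ψ : Dual K E), φ y + ε * ψ x = 0 := fun y ψ => LinearMap.congr_fun h (y, ψ)
    have h2 : φ = 0 := LinearMap.ext fun y => by simpa using h1 y 0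
    have h3 : x = 0 := by
      rw [← Module.forall_dual_apply_eq_zero_iff K]
      intro ψ
      simpa [hε] using h1 0 ψ
    rw [h2, h3]
    rfl
  exact ⟨hinj, (LinearMap.injective_iff_surjective_of_finrank_eq_finrank
    (Subspace.dual_finrank_eq (K := K) (V := E × Dual K E)).symm).mp hinj⟩

theorem isSimilarity_hyperbolicMap (A : RigidAdelicSpace K E) {s : ℝ} (hs : 0 < s) {ε : K}
    (hε : ε = 1 ∨ ε = -1) :
    (A.prod (A.dual.scale s hs)).IsSimilarity (A.prod (A.dual.scale s hs)).dual
      (hyperbolicMap E ε) := by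
  have hε2 : ε * ε = 1 := by rcases hε with rfl | rfl <;> simp
  have hε0 : ε ≠ 0 := left_ne_zero_of_mul_eq_one hε2
  have hεR : ε ∈ (algebraMap (𝓞 K) K).range := by
    rcases hε with rfl | rfl
    · exact one_mem _
    · exact neg_mem (one_mem _)
  refine isSimilarity_of_bijective (hyperbolicMap_bijective hε0) ?_ (inv_pos.mpr hs) ?_
  · rintro ⟨x, φ⟩
    constructor
    · intro h
      have h1 : ∀ y ∈ A.lattice, ∀ ψ ∈ A.dual.lattice,
          φ y + ε * ψ x ∈ (algebraMap (𝓞 K) K).range := fun y hy ψ hψ => h (y, ψ) ⟨hy, hψ⟩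
      refine ⟨(A.mem_lattice_iff x).mpr fun ψ hψ => ?_, fun y hy => ?_⟩
      · have h2 := mul_mem hεR (h1 0 A.lattice.zero_mem ψ hψ)
        rwa [map_zero, zero_add, ← mul_assoc, hε2, one_mul] at h2
      · have h2 := h1 y hy 0 (zero_mem _)
        rwa [LinearMap.zero_apply, mul_zero, add_zero] at h2
    · rintro ⟨hx, hφ⟩ ⟨y, ψ⟩ ⟨hy, hψ⟩
      exact add_mem (hφ y hy) (mul_mem hεR (hψ x hx))
  · intro γ
    let b := Module.finBasis K E
    let β := b.prod b.dualBasis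
    have hG := (Matrix.isUnit_iff_isUnit_det _).mp (A.gram_posDef γ b.linearIndependent).isUnit
    have hl : ∀ i, hyperbolicMap E ε (β (Sum.inl i)) = ε • β.dualBasis (Sum.inr i) := by
      intro i
      ext y <;> simp [hyperbolicMap_apply, β]
    have hr : ∀ i, hyperbolicMap E ε (β (Sum.inr i)) = β.dualBasis (Sum.inl i) := by
      intro i
      ext y <;> simp [hyperbolicMap_apply, β]
    have hγ : (starRingEnd ℂ) (γ ε) * γ ε = 1 := by
      rcases hε with rfl | rfl <;> simp
    have hgr : ∀ p q, (A.prod (A.dual.scale s hs)).dual.form γ (β.dualBasis p) (β.dualBasis q) =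
        Matrix.fromBlocks ((A.form γ).gram b)⁻¹.transpose 0 0
          (((s⁻¹ : ℝ) : ℂ) ^ 2 • (A.form γ).gram b) p q := by
      intro p q
      have h1 := A.gram_dual_prod_scale A.dual hs γ b b.dualBasis
      rw [A.gram_dual γ b, ← Matrix.transpose_nonsing_inv, Matrix.transpose_transpose,
        Matrix.nonsing_inv_nonsing_inv _ hG] at h1
      rw [← h1]
      rfl
    have hgr' : ∀ p q, (A.prod (A.dual.scale s hs)).form γ (β p) (β q) =
        Matrix.fromBlocks ((A.form γ).gram b) 0 0
          (((s : ℂ) ^ 2) • ((A.form γ).gram b)⁻¹.transpose) p q := by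
      intro p q
      rw [← gram_dual]
      exact congrFun₂ (SesqForm.gram_prod (A.form γ) ((A.dual.scale s hs).form γ)
        b b.dualBasis) p q
    have h : ((A.prod (A.dual.scale s hs)).dual.form γ).comap (hyperbolicMap E ε) =
        ((A.prod (A.dual.scale s hs)).scale s⁻¹ (inv_pos.mpr hs)).form γ := by
      have hs' : (s : ℂ) ≠ 0 := by exact_mod_cast hs.ne'
      refine SesqForm.ext_basis β ?_
      rintro (i | i) (j | j)
      · rw [SesqForm.comap_apply, scale_form, hl, hl, LinearMap.map_smulₛₗ, LinearMap.map_smulₛₗ,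
          LinearMap.smul_apply, hgr, hgr', smul_eq_mul, smul_eq_mul, ← mul_assoc, mul_comm (γ ε),
          RingHom.comp_apply, hγ]
        simp
      · rw [SesqForm.comap_apply, scale_form, hl, hr, LinearMap.map_smulₛₗ,
          LinearMap.smul_apply, hgr, hgr']
        simp
      · rw [SesqForm.comap_apply, scale_form, hl, hr, LinearMap.map_smulₛₗ, hgr, hgr']
        simp
      · rw [SesqForm.comap_apply, scale_form, hr, hr, hgr, hgr']
        simp [hs']
    intro x y
    exact LinearMap.congr_fun (LinearMap.congr_fun h x) y

end RigidAdelicSpace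

/-- A semistable space embeds into a semistable orthogonal or symplectic hyperbolic space of the
same slope. -/
theorem RigidAdelicSpace.IsSemistable.exists_hyperbolic {K : Type u} [Field K] [NumberField K]
    {E : Type u} [AddCommGroup E] [Module K E] [FiniteDimensional K E] [Nontrivial E]
    {A : RigidAdelicSpace K E} (hA : A.IsSemistable) {ε : K} (hε : ε = 1 ∨ ε = -1) :
    ∃ A' : RigidAdelicSpace K (E × Dual K E), A.IsContraction A' (LinearMap.inl K E (Dual K E)) ∧
      A'.IsSemistable ∧ A'.reducedHeight = A.reducedHeight ∧
      A'.IsSimilarity A'.dual (hyperbolicMap E ε) := by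
  obtain ⟨h1, h2⟩ := hA.prod_scale (B := A.dual) Subspace.dual_finrank_eq A.height_dual
    (HeightBound.dual A.reducedHeight_pos (A.isSemistable_iff.mp hA) A.reducedHeight_pow.symm)
  exact ⟨_, A.isContraction_inl _, h1, h2, A.isSimilarity_hyperbolicMap _ hε⟩

/-! ### Conjugate spaces -/

section Conjugation

variable {K : Type u} [Field K] [NumberField K]

theorem Ideal.absNorm_map_ringEquiv (c : 𝓞 K ≃+* 𝓞 K) (I : Ideal (𝓞 K)) :
    Ideal.absNorm (I.map (c : 𝓞 K →+* 𝓞 K)) = Ideal.absNorm I := by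
  rw [Ideal.absNorm_apply, Ideal.absNorm_apply, Submodule.cardQuot_apply, Submodule.cardQuot_apply]
  exact (Nat.card_congr (Ideal.quotientEquiv I _ c rfl).toEquiv).symm

/-- There is a pseudo-basis with integral ideals. -/
theorem RigidAdelicSpace.exists_isPseudoBasis_coeIdeal {E : Type*} [AddCommGroup E] [Module K E]
    [FiniteDimensional K E] (A : RigidAdelicSpace K E) :
    ∃ (I : Fin (finrank K E) → Ideal (𝓞 K)) (b : Basis (Fin (finrank K E)) K E),
      A.IsPseudoBasis (fun i => (I i : FractionalIdeal (𝓞 K)⁰ K)) b := by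
  obtain ⟨a, b, hab, -⟩ := A.exists_isPseudoBasis
  choose d I hd hI using fun i => (a i).exists_eq_spanSingleton_mul
  have hd' : ∀ i, algebraMap (𝓞 K) K (d i) ≠ 0 := fun i => by simpa using hd i
  refine ⟨I, b.unitsSMul fun i => (Units.mk0 _ (hd' i))⁻¹, fun x => (hab x).trans ?_⟩
  refine forall_congr' fun i => ?_
  rw [Basis.repr_unitsSMul, inv_inv, hI i, FractionalIdeal.mem_singleton_mul]
  change _ ↔ algebraMap (𝓞 K) K (d i) * b.repr x i ∈ _
  constructor
  · rintro ⟨y, hy, h⟩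
    rwa [h, mul_inv_cancel_left₀ (hd' i)]
  · intro h
    exact ⟨_, h, by rw [inv_mul_cancel_left₀ (hd' i)]⟩

end Conjugation

section CMFields

variable {K : Type u} [Field K] [NumberField K] [IsCMField K]
variable {E : Type*} [AddCommGroup E] [Module K E]

/-- A basis of `E`, as a basis of the conjugate space. -/
noncomputable def Module.Basis.conjSpace {ι : Type*} [Fintype ι] (b : Basis ι K E) :
    Basis ι K (ConjSpace K E) :=
  Basis.ofEquivFun
    { toFun := fun x i => IsCMField.complexConj K (b.repr ((ConjSpace.of K).symm x) i)
      map_add' := fun x y => by ext; simp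
      map_smul' := fun a x => by
        ext
        simp [ConjSpace.of_symm_smul]
      invFun := fun f => ConjSpace.of K (∑ i, IsCMField.complexConj K (f i) • b i)
      left_inv := fun x => by
        apply (ConjSpace.of K).symm.injective
        simp only [IsCMField.complexConj_apply_apply, AddEquiv.symm_apply_apply, b.sum_repr]
      right_inv := fun f => by
        ext i
        simp only [AddEquiv.symm_apply_apply, b.repr_sum_self, IsCMField.complexConj_apply_apply] }

theorem Module.Basis.conjSpace_repr {ι : Type*} [Fintype ι] (b : Basis ι K E)
    (x : ConjSpace K E) (i : ι) :
    b.conjSpace.repr x i = IsCMField.complexConj K (b.repr ((ConjSpace.of K).symm x) i) := rfl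

theorem Module.Basis.conjSpace_apply {ι : Type*} [Fintype ι] (b : Basis ι K E) (i : ι) :
    b.conjSpace i = ConjSpace.of K (b i) := by
  classical
  refine b.conjSpace.repr.injective (Finsupp.ext fun j => ?_)
  rw [Basis.repr_self, Basis.conjSpace_repr, AddEquiv.symm_apply_apply, Basis.repr_self]
  by_cases h : i = j
  · subst h; simp
  · simp [h]

instance [FiniteDimensional K E] : FiniteDimensional K (ConjSpace K E) :=
  (Module.finBasis K E).conjSpace.finiteDimensional_of_finite

theorem finrank_conjSpace [FiniteDimensional K E] : finrank K (ConjSpace K E) = finrank K E := by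
  rw [finrank_eq_card_basis (Module.finBasis K E).conjSpace, Fintype.card_fin]

namespace RigidAdelicSpace

theorem conj_form (A : RigidAdelicSpace K E) (γ : K →+* ℂ) (x y : ConjSpace K E) :
    A.conj.form γ x y = A.form (ComplexEmbedding.conjugate γ)
      ((ConjSpace.of K).symm x) ((ConjSpace.of K).symm y) := rfl

theorem mem_conj_lattice (A : RigidAdelicSpace K E) (x : ConjSpace K E) :
    x ∈ A.conj.lattice ↔ (ConjSpace.of K).symm x ∈ A.lattice := by
  constructor
  · rintro ⟨y, hy, rfl⟩
    exact hy
  · intro hx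
    exact ⟨_, hx, rfl⟩

theorem conj_gram (A : RigidAdelicSpace K E) (γ : K →+* ℂ) {ι : Type*} [Fintype ι]
    (b : Basis ι K E) : (A.conj.form γ).gram b.conjSpace =
      (A.form (ComplexEmbedding.conjugate γ)).gram b := by
  ext i j
  rw [SesqForm.gram_apply, SesqForm.gram_apply, conj_form, Basis.conjSpace_apply,
    Basis.conjSpace_apply]
  rfl

variable [FiniteDimensional K E]

theorem height_conj (A : RigidAdelicSpace K E) : A.conj.height = A.height := by
  obtain ⟨I, b, h⟩ := A.exists_isPseudoBasis_coeIdeal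
  let c : 𝓞 K ≃+* 𝓞 K := RingOfIntegers.mapRingEquiv (IsCMField.complexConj K).toRingEquiv
  have hc : ∀ r : 𝓞 K, algebraMap (𝓞 K) K (c r) =
      IsCMField.complexConj K (algebraMap (𝓞 K) K r) := fun r => rfl
  have h' : A.conj.IsPseudoBasis
      (fun i => ((I i).map (c : 𝓞 K →+* 𝓞 K) : FractionalIdeal (𝓞 K)⁰ K)) b.conjSpace := by
    intro x
    rw [mem_conj_lattice, h]
    refine forall_congr' fun i => ?_
    rw [Basis.conjSpace_repr, FractionalIdeal.mem_coeIdeal, FractionalIdeal.mem_coeIdeal]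
    constructor
    · rintro ⟨r, hr, hrx⟩
      exact ⟨c r, Ideal.mem_map_of_mem _ hr, by rw [hc, hrx]⟩
    · rintro ⟨r, hr, hrx⟩
      obtain ⟨s, hs, rfl⟩ := (Ideal.mem_map_of_equiv c r).mp hr
      refine ⟨s, hs, (IsCMField.complexConj K).injective ?_⟩
      rw [← hc]
      exact hrx
  rw [h.height_eq, h'.height_eq]
  congr 1
  rw [pseudoVolume, pseudoVolume, map_prod, map_prod]
  simp only [FractionalIdeal.coeIdeal_absNorm, Ideal.absNorm_map_ringEquiv, conj_gram]
  congr 1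
  exact Equiv.prod_comp (ComplexEmbedding.involutive_conjugate K).toPerm
    fun γ => ((A.form γ).gram b).det.re ^ (1 / 2 : ℝ)

theorem HeightBound.conj {A : RigidAdelicSpace K E} {m : ℝ} (hA : A.HeightBound m) :
    A.conj.HeightBound m := by
  intro W
  let W' : Submodule K E :=
    { carrier := {x | ConjSpace.of K x ∈ W}
      add_mem' := fun hx hy => W.add_mem hx hy
      zero_mem' := W.zero_mem
      smul_mem' := fun a x hx => by
        have h : IsCMField.complexConj K a • ConjSpace.of K x ∈ W := W.smul_mem _ hx
        have h1 : IsCMField.complexConj K a • ConjSpace.of K x = ConjSpace.of K (a • x) := by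
          apply (ConjSpace.of K).symm.injective
          rw [ConjSpace.of_symm_smul, IsCMField.complexConj_apply_apply]
          rfl
        change ConjSpace.of K (a • x) ∈ W
        rwa [h1] at h }
  let f : W →ₗ[K] ConjSpace K W' :=
    { toFun := fun x => ConjSpace.of K ⟨(ConjSpace.of K).symm x.1, x.2⟩
      map_add' := fun x y => rfl
      map_smul' := fun a x => rfl }
  have hf : Function.Bijective f :=
    ⟨fun x y h => Subtype.ext (congrArg (fun z : ConjSpace K W' =>
      ConjSpace.of K ((ConjSpace.of K).symm z).1) h),
      fun y => ⟨⟨ConjSpace.of K ((ConjSpace.of K).symm y).1, ((ConjSpace.of K).symm y).2⟩, rfl⟩⟩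
  have hfc : (A.conj.restrict W).IsContraction (A.restrict W').conj f := by
    refine .of_form_eq (fun x hx => ?_) fun γ x y => rfl
    rw [mem_conj_lattice]
    exact (A.mem_conj_lattice x.1).mp hx
  have h1 := hfc.height_le hf
  rw [height_conj] at h1
  rw [(LinearEquiv.ofBijective f hf).finrank_eq, finrank_conjSpace]
  exact (hA W').trans h1

/-! ### Hermitian hyperbolic spaces -/

/-- The map belonging to the Hermitian form `((x, φ), (y, ψ)) ↦ φ y + conj (ψ x)` on the sum of
`E` and its conjugate dual. -/
noncomputable def hermitianMap (K : Type u) [Field K] [NumberField K] [IsCMField K] (E : Type*)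
    [AddCommGroup E] [Module K E] : (E × ConjSpace K (Dual K E)) →ₗ[K]
      ConjSpace K (Dual K (E × ConjSpace K (Dual K E))) where
  toFun p := ConjSpace.of K
    { toFun := fun q => (ConjSpace.of K).symm p.2 q.1 +
        IsCMField.complexConj K ((ConjSpace.of K).symm q.2 p.1)
      map_add' := fun q q' => by simp; ring
      map_smul' := fun a q => by simp [ConjSpace.of_symm_smul, mul_add] }
  map_add' p p' := by
    apply (ConjSpace.of K).symm.injective
    refine LinearMap.ext fun q => ?_
    change (ConjSpace.of K).symm (p.2 + p'.2) q.1 +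
      IsCMField.complexConj K ((ConjSpace.of K).symm q.2 (p.1 + p'.1)) =
      ((ConjSpace.of K).symm p.2 q.1 + IsCMField.complexConj K ((ConjSpace.of K).symm q.2 p.1)) +
      ((ConjSpace.of K).symm p'.2 q.1 + IsCMField.complexConj K ((ConjSpace.of K).symm q.2 p'.1))
    rw [map_add, map_add, map_add, LinearMap.add_apply]
    ring
  map_smul' a p := by
    apply (ConjSpace.of K).symm.injective
    refine LinearMap.ext fun q => ?_
    rw [RingHom.id_apply, ConjSpace.of_symm_smul]
    change (ConjSpace.of K).symm (a • p.2) q.1 +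
      IsCMField.complexConj K ((ConjSpace.of K).symm q.2 (a • p.1)) =
      IsCMField.complexConj K a * ((ConjSpace.of K).symm p.2 q.1 +
        IsCMField.complexConj K ((ConjSpace.of K).symm q.2 p.1))
    rw [ConjSpace.of_symm_smul, map_smul, smul_eq_mul, map_mul, LinearMap.smul_apply, smul_eq_mul,
      mul_add]

omit [FiniteDimensional K E] in
theorem hermitianMap_apply (p q : E × ConjSpace K (Dual K E)) :
    (ConjSpace.of K).symm (hermitianMap K E p) q = (ConjSpace.of K).symm p.2 q.1 +
      IsCMField.complexConj K ((ConjSpace.of K).symm q.2 p.1) := rfl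

theorem hermitianMap_bijective : Function.Bijective (hermitianMap K E) := by
  have hinj : Function.Injective (hermitianMap K E) := by
    rw [injective_iff_map_eq_zero]
    rintro ⟨x, φ⟩ h
    have h1 : ∀ (y : E) (ψ : Dual K E), (ConjSpace.of K).symm φ y +
        IsCMField.complexConj K (ψ x) = 0 := fun y ψ => by
      have h2 := LinearMap.congr_fun (congrArg (ConjSpace.of K).symm h) (y, ConjSpace.of K ψ)
      exact h2
    have h2 : (ConjSpace.of K).symm φ = 0 := LinearMap.ext fun y => by simpa using h1 y 0
    have h3 : x = 0 := by
      rw [← Module.forall_dual_apply_eq_zero_iff K]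
      intro ψ
      simpa using h1 0 ψ
    rw [h3]
    exact Prod.ext rfl h2
  refine ⟨hinj, (LinearMap.injective_iff_surjective_of_finrank_eq_finrank ?_).mp hinj⟩
  rw [finrank_conjSpace, Subspace.dual_finrank_eq]

omit [FiniteDimensional K E] in
theorem complexConj_mem_range {x : K} (hx : x ∈ (algebraMap (𝓞 K) K).range) :
    IsCMField.complexConj K x ∈ (algebraMap (𝓞 K) K).range := by
  obtain ⟨r, rfl⟩ := hx
  exact ⟨RingOfIntegers.mapRingEquiv (IsCMField.complexConj K).toRingEquiv r, rfl⟩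

theorem isSimilarity_hermitianMap (A : RigidAdelicSpace K E) {s : ℝ} (hs : 0 < s) :
    (A.prod (A.dual.conj.scale s hs)).IsSimilarity (A.prod (A.dual.conj.scale s hs)).dual.conj
      (hermitianMap K E) := by
  refine isSimilarity_of_bijective hermitianMap_bijective ?_ (inv_pos.mpr hs) ?_
  · rintro ⟨x, φ⟩
    rw [mem_conj_lattice]
    constructor
    · intro h
      have h1 : ∀ y ∈ A.lattice, ∀ ψ ∈ A.dual.lattice, (ConjSpace.of K).symm φ y +
          IsCMField.complexConj K (ψ x) ∈ (algebraMap (𝓞 K) K).range :=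
        fun y hy ψ hψ => h (y, ConjSpace.of K ψ) ⟨hy, ⟨ψ, hψ, rfl⟩⟩
      refine ⟨(A.mem_lattice_iff x).mpr fun ψ hψ => ?_, ⟨(ConjSpace.of K).symm φ, ?_, rfl⟩⟩
      · have h2 := complexConj_mem_range (h1 0 A.lattice.zero_mem ψ hψ)
        rwa [map_zero, zero_add, IsCMField.complexConj_apply_apply] at h2
      · intro y hy
        have h2 := h1 y hy 0 (zero_mem _)
        rwa [LinearMap.zero_apply, map_zero, add_zero] at h2
    · rintro ⟨hx, hφ⟩ ⟨y, ψ⟩ ⟨hy, hψ⟩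
      have hφ' := (A.dual.mem_conj_lattice φ).mp hφ
      have hψ' := (A.dual.mem_conj_lattice ψ).mp hψ
      exact add_mem (hφ' y hy) (complexConj_mem_range (hψ' x hx))
  · intro γ
    let γ' := ComplexEmbedding.conjugate γ
    have hγγ : ComplexEmbedding.conjugate γ' = γ := ComplexEmbedding.involutive_conjugate K γ
    let b := Module.finBasis K E
    let β := b.prod b.dualBasis.conjSpace
    have hG := (Matrix.isUnit_iff_isUnit_det _).mp (A.gram_posDef γ b.linearIndependent).isUnit
    have hl : ∀ i, (ConjSpace.of K).symm (hermitianMap K E (β (Sum.inl i))) =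
        β.dualBasis (Sum.inr i) := by
      intro i
      refine LinearMap.ext fun q => ?_
      rw [hermitianMap_apply]
      simp [β, Basis.conjSpace_repr]
    have hr : ∀ i, (ConjSpace.of K).symm (hermitianMap K E (β (Sum.inr i))) =
        β.dualBasis (Sum.inl i) := by
      intro i
      refine LinearMap.ext fun q => ?_
      rw [hermitianMap_apply]
      simp [β, Basis.conjSpace_apply]
    have hgr : ∀ p q, (A.prod (A.dual.conj.scale s hs)).dual.form γ' (β.dualBasis p)
        (β.dualBasis q) = Matrix.fromBlocks ((A.form γ').gram b)⁻¹.transpose 0 0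
          (((s⁻¹ : ℝ) : ℂ) ^ 2 • (A.form γ).gram b) p q := by
      intro p q
      have h1 := A.gram_dual_prod_scale A.dual.conj hs γ' b b.dualBasis.conjSpace
      rw [conj_gram, hγγ, A.gram_dual γ b, ← Matrix.transpose_nonsing_inv,
        Matrix.transpose_transpose, Matrix.nonsing_inv_nonsing_inv _ hG] at h1
      rw [← h1]
      rfl
    have hgr' : ∀ p q, (A.prod (A.dual.conj.scale s hs)).form γ (β p) (β q) =
        Matrix.fromBlocks ((A.form γ).gram b) 0 0
          (((s : ℂ) ^ 2) • ((A.form γ').gram b)⁻¹.transpose) p q := by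
      intro p q
      rw [← gram_dual, ← conj_gram]
      exact congrFun₂ (SesqForm.gram_prod (A.form γ) ((A.dual.conj.scale s hs).form γ)
        b b.dualBasis.conjSpace) p q
    have h : ((A.prod (A.dual.conj.scale s hs)).dual.conj.form γ).comap (hermitianMap K E) =
        ((A.prod (A.dual.conj.scale s hs)).scale s⁻¹ (inv_pos.mpr hs)).form γ := by
      have hs' : (s : ℂ) ≠ 0 := by exact_mod_cast hs.ne'
      refine SesqForm.ext_basis β ?_
      rintro (i | i) (j | j)
      · rw [SesqForm.comap_apply, scale_form, conj_form, hl, hl, hgr, hgr']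
        simp
      · rw [SesqForm.comap_apply, scale_form, conj_form, hl, hr, hgr, hgr']
        simp
      · rw [SesqForm.comap_apply, scale_form, conj_form, hl, hr, hgr, hgr']
        simp
      · rw [SesqForm.comap_apply, scale_form, conj_form, hr, hr, hgr, hgr']
        simp [hs']
    intro x y
    exact LinearMap.congr_fun (LinearMap.congr_fun h x) y

end RigidAdelicSpace

/-- A semistable space embeds into a semistable unitary hyperbolic space of the same slope. -/
theorem RigidAdelicSpace.IsSemistable.exists_unitary {E : Type u} [AddCommGroup E] [Module K E]
    [FiniteDimensional K E] [Nontrivial E] {A : RigidAdelicSpace K E} (hA : A.IsSemistable) :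
    ∃ A' : RigidAdelicSpace K (E × ConjSpace K (Dual K E)),
      A.IsContraction A' (LinearMap.inl K E (ConjSpace K (Dual K E))) ∧
      A'.IsSemistable ∧ A'.reducedHeight = A.reducedHeight ∧ A'.IsUnitary := by
  obtain ⟨h1, h2⟩ := hA.prod_scale (B := A.dual.conj)
    (by rw [finrank_conjSpace, Subspace.dual_finrank_eq])
    (by rw [height_conj, height_dual])
    (HeightBound.dual A.reducedHeight_pos (A.isSemistable_iff.mp hA) A.reducedHeight_pow.symm).conj
  refine ⟨_, A.isContraction_inl _, h1, h2, hermitianMap K E, A.isSimilarity_hermitianMap _, ?_⟩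
  intro x y
  rw [hermitianMap_apply, hermitianMap_apply, map_add, IsCMField.complexConj_apply_apply, add_comm]

end CMFields

/-! ### The equivalences -/

theorem BostConjecture.bostConjectureFor {K : Type u} [Field K] [NumberField K]
    (h : BostConjecture K) (P : ∀ (E : Type u) [AddCommGroup E] [Module K E]
      [FiniteDimensional K E], RigidAdelicSpace K E → Prop) : BostConjectureFor K P := by
  intro E F _ _ _ _ _ _ _ _ A B _ _
  exact h E F A B

theorem theorem5p1 (K : Type u) [Field K] [NumberField K] :
    (BostConjecture K ↔
      BostConjectureFor K (fun _ _ _ _ A => A.IsSemistable ∧ A.IsIsodual)) ∧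
    (BostConjecture K ↔
      BostConjectureFor K (fun _ _ _ _ A => A.IsSemistable ∧ A.IsOrthogonal)) ∧
    (BostConjecture K ↔
      BostConjectureFor K (fun _ _ _ _ A => A.IsSemistable ∧ A.IsSymplectic)) ∧
    (∀ [IsCMField K], BostConjecture K ↔
      BostConjectureFor K (fun _ _ _ _ A => A.IsSemistable ∧ A.IsUnitary)) := by
  refine ⟨⟨fun h => h.bostConjectureFor _, ?_⟩, ⟨fun h => h.bostConjectureFor _, ?_⟩,
    ⟨fun h => h.bostConjectureFor _, ?_⟩, fun {_} => ⟨fun h => h.bostConjectureFor _, ?_⟩⟩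
  · refine RigidAdelicSpace.bostConjecture_of_bostConjectureFor fun E _ _ _ _ A hA => ?_
    obtain ⟨A', h1, h2, h3, h4⟩ := hA.exists_hyperbolic (ε := 1) (Or.inl rfl)
    exact ⟨_, _, _, inferInstance, A', _, h1, LinearMap.inl_injective, h2, h3, h2, _, h4⟩
  · refine RigidAdelicSpace.bostConjecture_of_bostConjectureFor fun E _ _ _ _ A hA => ?_
    obtain ⟨A', h1, h2, h3, h4⟩ := hA.exists_hyperbolic (ε := 1) (Or.inl rfl)
    refine ⟨_, _, _, inferInstance, A', _, h1, LinearMap.inl_injective, h2, h3, h2, _, h4, ?_⟩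
    intro x y
    rw [RigidAdelicSpace.hyperbolicMap_apply, RigidAdelicSpace.hyperbolicMap_apply]
    ring
  · refine RigidAdelicSpace.bostConjecture_of_bostConjectureFor fun E _ _ _ _ A hA => ?_
    obtain ⟨A', h1, h2, h3, h4⟩ := hA.exists_hyperbolic (ε := -1) (Or.inr rfl)
    refine ⟨_, _, _, inferInstance, A', _, h1, LinearMap.inl_injective, h2, h3, h2, _, h4, ?_⟩
    intro x
    rw [RigidAdelicSpace.hyperbolicMap_apply]
    ring
  · refine RigidAdelicSpace.bostConjecture_of_bostConjectureFor fun E _ _ _ _ A hA => ?_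
    obtain ⟨A', h1, h2, h3, h4⟩ := hA.exists_unitary
    exact ⟨_, _, _, inferInstance, A', _, h1, LinearMap.inl_injective, h2, h3, h2, h4⟩
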